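/- \textbf{Notation.} For a partition $\lambda$ let $(1^r)=(1,\dots,1)$ ($r$ ones). Let $R$ be a discrete valuation ring with maximal ideal $\mathfrak m$ and finite residue field of cardinality $q$. The Hall algebra $\mathrm{Hall}(R)$ is the free abelian group on the isomorphism classes $[M]$ of finite $R$-modules, with multiplication $[N]\cdot[L]=\sum_{[M]} g^M_{N,L}[M]$, where $g^M_{N,L}$ is the number of submodules $A\subset M$ with $A\cong L$ and $M/A\cong N$; it is a unital associative ring. Put $u_\lambda=[\bigoplus_i R/\mathfrak m^{\lambda_i}]\in\mathrm{Hall}(R)$. A finite $\mathbb F_1[[t]]$-module is a finite pointed set $(K,*)$ with a map $T:K\to K$ such that $T(*)=*$, $T$ is injective on $K\setminus T^{-1}(*)$, and $T^n(K)=\{*\}$ for some $n$. Its submodules are the $T$-stable subsets $A$ containing $*$, and $K/A$ is obtained by collapsing $A$ to the marked point. $\mathrm{Hall}(\mathbb F_1[[t]])$ is defined from these modules by the same formula, and $u_\lambda\in\mathrm{Hall}(\mathbb F_1[[t]])$ is the class of the module consisting, besides $*$, of one $T$-chain of length $\lambda_i$ ending in $*$ for every part $\lambda_i$ of $\lambda$.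 $\Lambda=\bigoplus_{k\ge0}\Lambda^k$ is the ring of symmetric functions over $\mathbb Z$, where $\Lambda^k=\varprojlim_n\Lambda_n^k$ and $\Lambda_n^k$ is the group of symmetric polynomials in $\mathbb Z[x_1,\dots,x_n]$ that are homogeneous of degree $k$, with transition maps $x_{n+1}\mapsto 0$; $m_\lambda\in\Lambda$ denotes the monomial symmetric function. \textbf{Theorem.} \begin{enumerate} \item For every discrete valuation ring $R$ with finite residue field, the ring $\mathrm{Hall}(R)$ is commutative, the family $(u_{(1^r)})_{r>0}$ is algebraically independent over $\mathbb Z$ and generates $\mathrm{Hall}(R)$ as a $\mathbb Z$-algebra, and there is a unique isomorphism of $\mathbb Z$-algebras $\psi:\mathrm{Hall}(R)\to\Lambda$ with $\psi(u_{(1^r)})=m_{(1^r)}$ for all $r>0$. \item The families $(u_\lambda)_\lambda$, $(u_\lambda)_\lambda$ and $(m_\lambda)_\lambda$, where $\lambda$ runs through all partitions, are $\mathbb Z$-bases of $\mathrm{Hall}(R)$ (for every $R$ as above), of $\mathrm{Hall}(\mathbb F_1[[t]])$ and of $\Lambda$, respectively. There are polynomials $g_{\mu\nu}^\lambda(t)\in\mathbb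 Z[t]$, independent of $R$, such that for every discrete valuation ring $R$ with residue field of finite cardinality $q$ and all partitions $\mu,\nu$ \[u_\mu u_\nu=\sum_\lambda g_{\mu\nu}^\lambda(q)\,u_\lambda\quad\text{in }\mathrm{Hall}(R),\] and such that the numbers $g_{\mu\nu}^\lambda(1)$ are the structure constants of $\mathrm{Hall}(\mathbb F_1[[t]])$ with respect to $(u_\lambda)$ and the structure constants of $\Lambda$ with respect to $(m_\lambda)$: \[u_\mu u_\nu=\sum_\lambda g_{\mu\nu}^\lambda(1)\,u_\lambda\ \text{ in }\mathrm{Hall}(\mathbb F_1[[t]]),\qquad m_\mu m_\nu=\sum_\lambda g_{\mu\nu}^\lambda(1)\,m_\lambda\ \text{ in }\Lambda.\] \end{enumerate} -/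

import Mathlib

open scoped Polynomial

universe u

noncomputable section

/-! ### The Hall algebra of a finitary category -/

/-- The part of a finitary (proto-abelian) category that enters the definition of its Hall algebra:
the objects up to isomorphism and, for every object `M`, the finite poset `Sub M` of its
subobjects, where `A : Sub M` has an underlying object `sub A` and a quotient object `quo A = M/A`.
The remaining fields are the standard compatibilities (subobjects of `P ≤ M` are the subobjects of
`M` below `P`, subobjects of `M/A` are the subobjects of `M` above `A`, Noether's isomorphism
theorems) and the finiteness of the number of extensions of `N` by `L`, up to isomorphism. -/
structure HallSystem where
  Ob : Type (u + 1)
  iso : Setoid Ob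
  Sub : Ob → Type u
  [order : ∀ M, PartialOrder (Sub M)]
  [bounded : ∀ M, BoundedOrder (Sub M)]
  [finite : ∀ M, Finite (Sub M)]
  sub : ∀ {M : Ob}, Sub M → Ob
  quo : ∀ {M : Ob}, Sub M → Ob
  zero : Ob
  sub_bot : ∀ M, iso (sub (⊥ : Sub M)) zero
  quo_bot : ∀ M, iso (quo (⊥ : Sub M)) M
  sub_top : ∀ M, iso (sub (⊤ : Sub M)) M
  quo_top : ∀ M, iso (quo (⊤ : Sub M)) zero
  eq_bot : ∀ {M} (A : Sub M), iso (sub A) zero → A = ⊥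
  eq_top : ∀ {M} (A : Sub M), iso (quo A) zero → A = ⊤
  congr : ∀ {M N}, iso M N → ∃ e : Sub M ≃ Sub N, ∀ A, iso (sub A) (sub (e A)) ∧
    iso (quo A) (quo (e A))
  below : ∀ {M} (P : Sub M), Sub (sub P) ≃ Set.Iic P
  above : ∀ {M} (A : Sub M), Sub (quo A) ≃ Set.Ici A
  sub_below : ∀ {M} (P : Sub M) (A : Sub (sub P)), iso (sub A) (sub (below P A).1)
  quo_above : ∀ {M} (A : Sub M) (B : Sub (quo A)), iso (quo B) (quo (above A B).1)
  noether : ∀ {M} (A P : Sub M) (h : A ≤ P),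
    iso (sub ((above A).symm ⟨P, h⟩)) (quo ((below P).symm ⟨A, h⟩))
  finite_ext : ∀ L N : Ob,
    {c : Quotient iso | ∃ (M : Ob) (A : Sub M), Quotient.mk iso M = c ∧ iso (sub A) L ∧
      iso (quo A) N}.Finite

namespace HallSystem

attribute [instance] HallSystem.order HallSystem.bounded HallSystem.finite

variable (S : HallSystem.{u})

/-- The set of isomorphism classes of objects. -/
abbrev Iso : Type (u + 1) := Quotient S.iso

variable {S} in
/-- The isomorphism class `[M]`. -/
abbrev cls (M : S.Ob) : S.Iso := Quotient.mk S.iso M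

variable {S} in
lemma cls_eq {M N : S.Ob} (h : S.iso M N) : S.cls M = S.cls N := Quotient.sound h

/-- The Hall number `g^M_{N,L}`: the number of subobjects `A` of `M` with `A ≅ L` and `M/A ≅ N`;
here `N`, `L`, `M` are given by their isomorphism classes `n`, `l`, `m`. -/
def hallNumber (n l m : S.Iso) : ℕ :=
  Quotient.lift
    (fun M : S.Ob => Nat.card {A : S.Sub M // S.cls (S.sub A) = l ∧ S.cls (S.quo A) = n})
    (by
      intro M N h
      obtain ⟨e, he⟩ := S.congr h
      refine Nat.card_congr (e.subtypeEquiv fun A => ?_)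
      rw [cls_eq (he A).1, cls_eq (he A).2]) m

lemma hallNumber_mk (n l : S.Iso) (M : S.Ob) : S.hallNumber n l (S.cls M) =
    Nat.card {A : S.Sub M // S.cls (S.sub A) = l ∧ S.cls (S.quo A) = n} := rfl

lemma finite_support (n l : S.Iso) :
    (Function.support fun m => (S.hallNumber n l m : ℤ)).Finite := by
  induction n using Quotient.inductionOn with | _ N => ?_
  induction l using Quotient.inductionOn with | _ L => ?_
  refine (S.finite_ext L N).subset fun m hm => ?_
  induction m using Quotient.inductionOn with | _ M => ?_
  simp only [Function.mem_support, ne_eq, Nat.cast_eq_zero] at hm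
  have : Nonempty {A : S.Sub M // S.cls (S.sub A) = S.cls L ∧ S.cls (S.quo A) = S.cls N} := by
    by_contra h
    rw [not_nonempty_iff] at h
    exact hm (by rw [hallNumber_mk]; exact Nat.card_of_isEmpty)
  obtain ⟨A, h1, h2⟩ := this
  exact ⟨M, A, rfl, Quotient.exact h1, Quotient.exact h2⟩

/-- The Hall algebra: the free abelian group on the set of isomorphism classes, with the
multiplication `[N] * [L] = ∑_{[M]} g^M_{N,L} [M]`. -/
def Alg : Type (u + 1) := S.Iso →₀ ℤ

instance : AddCommGroup S.Alg := inferInstanceAs (AddCommGroup (S.Iso →₀ ℤ))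

instance : FunLike S.Alg S.Iso ℤ := inferInstanceAs (FunLike (S.Iso →₀ ℤ) S.Iso ℤ)

/-- The basis element of the Hall algebra attached to an isomorphism class. -/
def basisElt (c : S.Iso) : S.Alg := Finsupp.single c (1 : ℤ)

/-- The product `[N] * [L] = ∑_{[M]} g^M_{N,L} [M]` of two isomorphism classes. -/
def classMul (n l : S.Iso) : S.Alg :=
  Finsupp.ofSupportFinite (fun m => (S.hallNumber n l m : ℤ)) (S.finite_support n l)

/-- The bilinear extension of `classMul`. -/
def mulLin : S.Alg →ₗ[ℤ] S.Alg →ₗ[ℤ] S.Alg :=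
  Finsupp.linearCombination ℤ (fun n : S.Iso =>
    (Finsupp.linearCombination ℤ (fun l : S.Iso => S.classMul n l) : (S.Iso →₀ ℤ) →ₗ[ℤ] S.Alg))

instance : Mul S.Alg := ⟨fun x y => S.mulLin x y⟩
instance : One S.Alg := ⟨S.basisElt (S.cls S.zero)⟩

lemma mul_def (x y : S.Alg) : x * y = S.mulLin x y := rfl

lemma basisElt_mul (n l : S.Iso) : S.basisElt n * S.basisElt l = S.classMul n l := by
  rw [mul_def, mulLin, basisElt, basisElt]
  erw [Finsupp.linearCombination_single, one_smul, Finsupp.linearCombination_single, one_smul]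

variable {S} in
@[ext] lemma alg_ext {x y : S.Alg} (h : ∀ M, x (S.cls M) = y (S.cls M)) : x = y :=
  Finsupp.ext fun c => Quotient.inductionOn c h

@[simp] lemma add_coe (x y : S.Alg) (m : S.Iso) : (x + y) m = x m + y m := rfl
@[simp] lemma zero_coe (m : S.Iso) : (0 : S.Alg) m = 0 := rfl

lemma alg_induction {p : S.Alg → Prop} (zero : p 0) (add : ∀ x y, p x → p y → p (x + y))
    (single : ∀ (a : ℤ) (c : S.Iso), p (a • S.basisElt c)) (x : S.Alg) : p x := by
  refine Finsupp.induction_linear (motive := p) x zero add fun c a => ?_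
  have h := single a c
  have : (a • S.basisElt c : S.Alg) = (Finsupp.single c a : S.Iso →₀ ℤ) := by
    change a • (Finsupp.single c (1 : ℤ)) = _
    rw [Finsupp.smul_single, smul_eq_mul, mul_one]
  rwa [this] at h

@[simp] lemma smul_coe (a : ℤ) (x : S.Alg) (m : S.Iso) : (a • x) m = a * x m := by
  exact Finsupp.smul_apply a (x : S.Iso →₀ ℤ) m

open Classical in
lemma basisElt_coe (c m : S.Iso) : S.basisElt c m = if c = m then 1 else 0 :=
  Finsupp.single_apply

instance (M : S.Ob) : Fintype (S.Sub M) := Fintype.ofFinite _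

lemma mul_coe (x y : S.Alg) (M : S.Ob) :
    (x * y) (S.cls M) = ∑ A : S.Sub M, x (S.cls (S.quo A)) * y (S.cls (S.sub A)) := by
  classical
  induction x using S.alg_induction with
  | zero => simp [mul_def]
  | add x x' hx hx' =>
    have : (x + x') * y = x * y + x' * y := by simp [mul_def]
    rw [this, add_coe, hx, hx', ← Finset.sum_add_distrib]
    exact Finset.sum_congr rfl fun A _ => by rw [add_coe, add_mul]
  | single a n =>
    induction y using S.alg_induction with
    | zero => simp [mul_def]
    | add y y' hy hy' =>
      have (x : S.Alg) : x * (y + y') = x * y + x * y' := by simp [mul_def]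
      rw [this, add_coe, hy, hy', ← Finset.sum_add_distrib]
      exact Finset.sum_congr rfl fun A _ => by rw [add_coe, mul_add]
    | single b l =>
      have : (a • S.basisElt n) * (b • S.basisElt l) = a • b • S.classMul n l := by
        rw [← basisElt_mul]; simp only [mul_def, map_smul, LinearMap.smul_apply]
        exact smul_comm b a _
      rw [this, smul_coe, smul_coe]
      change a * (b * (S.hallNumber n l (S.cls M) : ℤ)) = _
      rw [hallNumber_mk, Nat.card_eq_fintype_card, Fintype.card_subtype, Finset.card_filter,
        Nat.cast_sum, Finset.mul_sum, Finset.mul_sum]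
      refine Finset.sum_congr rfl fun A _ => ?_
      rw [smul_coe, smul_coe, basisElt_coe, basisElt_coe]
      by_cases h1 : S.cls (S.sub A) = l <;> by_cases h2 : S.cls (S.quo A) = n <;>
        simp [h1, h2, eq_comm]
      all_goals (intro h; first | exact absurd h.symm h1 | exact absurd h.symm h2)

lemma one_def : (1 : S.Alg) = S.basisElt (S.cls S.zero) := rfl

lemma mul_assoc' (x y z : S.Alg) : x * y * z = x * (y * z) := by
  classical
  ext M
  have e1 (A : S.Sub M) : (x * y) (S.cls (S.quo A)) * z (S.cls (S.sub A)) =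
      ∑ P : S.Sub M, if h : A ≤ P then x (S.cls (S.quo P)) *
        (y (S.cls (S.sub ((S.above A).symm ⟨P, h⟩))) * z (S.cls (S.sub A))) else 0 := by
    rw [mul_coe, Finset.sum_mul, ← (S.above A).symm.sum_comp, Finset.sum_dite,
      Finset.sum_const_zero, add_zero]
    refine Finset.sum_bij' (fun P _ => ⟨P.1, by simpa using (show A ≤ P.1 from P.2)⟩)
      (fun P _ => ⟨P.1, by have := P.2; simp only [Finset.mem_filter] at this; exact this.2⟩) ?_ ?_ ?_ ?_ ?_
    · simp
    · simp
    · simp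
    · simp
    · intro P _
      have := cls_eq (S.quo_above A ((S.above A).symm P))
      rw [Equiv.apply_symm_apply] at this
      rw [this, mul_assoc]
  have e2 (P : S.Sub M) : x (S.cls (S.quo P)) * (y * z) (S.cls (S.sub P)) =
      ∑ A : S.Sub M, if h : A ≤ P then x (S.cls (S.quo P)) *
        (y (S.cls (S.sub ((S.above A).symm ⟨P, h⟩))) * z (S.cls (S.sub A))) else 0 := by
    rw [mul_coe, Finset.mul_sum, ← (S.below P).symm.sum_comp, Finset.sum_dite,
      Finset.sum_const_zero, add_zero]
    refine Finset.sum_bij' (fun A _ => ⟨A.1, by simpa using (show A.1 ≤ P from A.2)⟩)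
      (fun A _ => ⟨A.1, by have := A.2; simp only [Finset.mem_filter] at this; exact this.2⟩) ?_ ?_ ?_ ?_ ?_
    · simp
    · simp
    · simp
    · simp
    · intro A _
      have h1 := cls_eq (S.sub_below P ((S.below P).symm A))
      rw [Equiv.apply_symm_apply] at h1
      have h2 := cls_eq (S.noether A.1 P A.2)
      rw [h1, h2]
  rw [mul_coe, mul_coe, Finset.sum_congr rfl fun A _ => e1 A, Finset.sum_congr rfl fun A _ => e2 A,
    Finset.sum_comm]

lemma one_mul' (x : S.Alg) : 1 * x = x := by
  classical
  ext M
  rw [mul_coe, Finset.sum_eq_single (⊤ : S.Sub M), one_def, basisElt_coe,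
    cls_eq (S.quo_top M), cls_eq (S.sub_top M)]
  · simp
  · intro A _ hA
    rw [one_def, basisElt_coe, if_neg, zero_mul]
    exact fun h => hA (S.eq_top A (Quotient.exact h.symm))
  · simp

lemma mul_one' (x : S.Alg) : x * 1 = x := by
  classical
  ext M
  rw [mul_coe, Finset.sum_eq_single (⊥ : S.Sub M), one_def, basisElt_coe,
    cls_eq (S.quo_bot M), cls_eq (S.sub_bot M)]
  · simp
  · intro A _ hA
    rw [one_def, basisElt_coe, if_neg, mul_zero]
    exact fun h => hA (S.eq_bot A (Quotient.exact h.symm))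
  · simp

/-- The Hall algebra is a unital associative ring. -/
instance : Ring S.Alg :=
  { (inferInstance : AddCommGroup S.Alg), (inferInstance : Mul S.Alg),
    (inferInstance : One S.Alg) with
    left_distrib := fun x y z => by simp [mul_def]
    right_distrib := fun x y z => by simp [mul_def]
    zero_mul := fun x => by simp [mul_def]
    mul_zero := fun x => by simp [mul_def]
    mul_assoc := S.mul_assoc'
    one_mul := S.one_mul'
    mul_one := S.mul_one' }

end HallSystem

/-! ### Finite modules over a discrete valuation ring -/

/-- A finite module over `R`. -/
structure FinMod (R : Type u) [CommRing R] where
  carrier : Type u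
  [addCommGroup : AddCommGroup carrier]
  [module : Module R carrier]
  [finite : Finite carrier]

namespace FinMod

attribute [instance] FinMod.addCommGroup FinMod.module FinMod.finite

variable (R : Type u) [CommRing R]

/-- Isomorphism of finite modules. -/
def isoSetoid : Setoid (FinMod R) where
  r M N := Nonempty (M.carrier ≃ₗ[R] N.carrier)
  iseqv := ⟨fun _ => ⟨.refl _ _⟩, fun ⟨e⟩ => ⟨e.symm⟩, fun ⟨e⟩ ⟨f⟩ => ⟨e.trans f⟩⟩

variable {R}

lemma pow_smul_eq_zero [IsDomain R] [IsDiscreteValuationRing R] {M : Type u} [AddCommGroup M]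
    [Module R M] [Finite M] (x : M) (a : R)
    (ha : a ∈ IsLocalRing.maximalIdeal R ^ Nat.card M) : a • x = 0 := by
  obtain ⟨p, hp⟩ := IsDiscreteValuationRing.exists_irreducible R
  rw [hp.maximalIdeal_eq, Ideal.span_singleton_pow, Ideal.mem_span_singleton] at ha
  obtain ⟨b, rfl⟩ := ha
  have key : p ^ Nat.card M • x = 0 := by
    have hninj : ¬ Function.Injective fun i : Fin (Nat.card M + 1) => p ^ (i : ℕ) • x := by
      intro h
      have := Nat.card_le_card_of_injective _ h
      simp at this
    have aux : ∀ i j : Fin (Nat.card M + 1), i < j → p ^ (i : ℕ) • x = p ^ (j : ℕ) • x →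
        p ^ Nat.card M • x = 0 := by
      intro i j hij h
      have hij' : (i : ℕ) < j := hij
      obtain ⟨k, hk⟩ := Nat.exists_eq_add_of_lt hij'
      have hu : IsUnit (1 - p ^ (k + 1)) := by
        apply IsLocalRing.isUnit_one_sub_self_of_mem_nonunits
        rw [← IsLocalRing.mem_maximalIdeal]
        exact Ideal.pow_mem_of_mem _ (by rw [hp.maximalIdeal_eq]; exact Ideal.mem_span_singleton_self p)
          _ (Nat.succ_pos k)
      have h0 : (1 - p ^ (k + 1)) • p ^ (i : ℕ) • x = 0 := by
        rw [sub_smul, one_smul, smul_smul, ← pow_add, h, hk, sub_eq_zero]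
        congr 2; ring
      rw [hu.smul_eq_zero] at h0
      have : Nat.card M = (Nat.card M - i) + i := by have := i.2; omega
      rw [this, pow_add, mul_smul, h0, smul_zero]
    simp only [Function.Injective, not_forall] at hninj
    obtain ⟨i, j, h, hne⟩ := hninj
    rcases lt_or_gt_of_ne hne with hlt | hlt
    · exact aux i j hlt h
    · exact aux j i hlt h.symm
  rw [mul_comm, mul_smul, key, smul_zero]

lemma finite_quot [IsDomain R] [IsDiscreteValuationRing R]
    [Finite (IsLocalRing.ResidueField R)] (n : ℕ) :
    Finite (R ⧸ IsLocalRing.maximalIdeal R ^ n) :=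
  have : Finite (R ⧸ IsLocalRing.maximalIdeal R) :=
    inferInstanceAs (Finite (IsLocalRing.ResidueField R))
  Ideal.finite_quotient_pow (IsNoetherian.noetherian _) n

lemma finite_card_eq [IsDomain R] [IsDiscreteValuationRing R]
    [Finite (IsLocalRing.ResidueField R)] (n : ℕ) :
    {c : Quotient (isoSetoid R) | ∃ M : FinMod R, Quotient.mk _ M = c ∧
      Nat.card M.carrier = n}.Finite := by
  classical
  have := finite_quot (R := R) n
  have h (M : FinMod R) (hM : Nat.card M.carrier = n) :
      ∃ K : Submodule R (Fin n → R ⧸ IsLocalRing.maximalIdeal R ^ n),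
        Nonempty ((_ ⧸ K) ≃ₗ[R] M.carrier) := by
    let e : M.carrier ≃ Fin n := Finite.equivFinOfCardEq hM
    let f (i : Fin n) : (R ⧸ IsLocalRing.maximalIdeal R ^ n) →ₗ[R] M.carrier :=
      Submodule.liftQ (IsLocalRing.maximalIdeal R ^ n)
        (LinearMap.toSpanSingleton R M.carrier (e.symm i))
        (fun a ha => pow_smul_eq_zero (e.symm i) a (by rwa [hM]))
    let F : (Fin n → R ⧸ IsLocalRing.maximalIdeal R ^ n) →ₗ[R] M.carrier :=
      LinearMap.lsum R (fun _ => R ⧸ IsLocalRing.maximalIdeal R ^ n) ℕ f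
    have hF : Function.Surjective F := by
      intro x
      refine ⟨Pi.single (e x) (Submodule.Quotient.mk 1), ?_⟩
      change LinearMap.lsum R (fun _ => R ⧸ IsLocalRing.maximalIdeal R ^ n) ℕ f _ = x
      rw [LinearMap.lsum_piSingle]
      change (LinearMap.toSpanSingleton R M.carrier (e.symm (e x))) 1 = x
      simp
    exact ⟨LinearMap.ker F, ⟨F.quotKerEquivOfSurjective hF⟩⟩
  choose K hK using h
  let G : {c : Quotient (isoSetoid R) | ∃ M : FinMod R, Quotient.mk _ M = c ∧
      Nat.card M.carrier = n} → Submodule R (Fin n → R ⧸ IsLocalRing.maximalIdeal R ^ n) :=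
    fun c => K c.2.choose c.2.choose_spec.2
  have hG : Function.Injective G := by
    intro c d hcd
    obtain ⟨e⟩ := hK c.2.choose c.2.choose_spec.2
    obtain ⟨f⟩ := hK d.2.choose d.2.choose_spec.2
    apply Subtype.ext
    rw [← c.2.choose_spec.1, ← d.2.choose_spec.1]
    exact Quotient.sound ⟨e.symm.trans ((Submodule.quotEquivOfEq _ _ hcd).trans f)⟩
  have := Finite.of_injective G hG
  exact Set.toFinite _

variable (R) in
/-- The category of finite `R`-modules: the subobjects of `M` are its submodules. -/
def system [IsDomain R] [IsDiscreteValuationRing R] [Finite (IsLocalRing.ResidueField R)] :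
    HallSystem where
  Ob := FinMod R
  iso := isoSetoid R
  Sub M := Submodule R M.carrier
  sub A := ⟨A⟩
  quo {M} A :=
    have : Finite (M.carrier ⧸ A) := Finite.of_surjective _ A.mkQ_surjective
    ⟨M.carrier ⧸ A⟩
  zero := ⟨PUnit⟩
  sub_bot _ := ⟨Submodule.botEquivPUnit⟩
  quo_bot _ := ⟨Submodule.quotEquivOfEqBot _ rfl⟩
  sub_top _ := ⟨Submodule.topEquiv⟩
  quo_top M := by
    have : Subsingleton (M.carrier ⧸ (⊤ : Submodule R M.carrier)) :=
      Submodule.Quotient.subsingleton_iff.mpr rfl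
    exact ⟨LinearEquiv.ofSubsingleton _ _⟩
  eq_bot A := fun ⟨e⟩ => by
    have : Subsingleton A := e.injective.subsingleton (β := PUnit)
    exact Submodule.eq_bot_of_subsingleton
  eq_top A := fun ⟨e⟩ =>
    Submodule.Quotient.subsingleton_iff.mp (e.injective.subsingleton (β := PUnit))
  congr := fun ⟨e⟩ => ⟨(Submodule.orderIsoMapComap e).toEquiv, fun A =>
    ⟨⟨e.submoduleMap A⟩, ⟨Submodule.Quotient.equiv A _ e rfl⟩⟩⟩
  below P := (Submodule.mapIic P).toEquiv
  above A := (Submodule.comapMkQRelIso A).toEquiv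
  sub_below P A := ⟨Submodule.equivMapOfInjective _ P.injective_subtype A⟩
  quo_above A B := by
    refine ⟨((Submodule.quotEquivOfEq _ _ ?_).trans
      ((B.mkQ.comp A.mkQ).quotKerEquivOfSurjective
        ((Submodule.mkQ_surjective B).comp (Submodule.mkQ_surjective A)))).symm⟩
    rw [LinearMap.ker_comp, Submodule.ker_mkQ]
    rfl
  noether {M} A P h := by
    refine ⟨((Submodule.quotEquivOfEq _ _ ?_).trans
      ((A.mkQ.submoduleMap P).quotKerEquivOfSurjective
        (LinearMap.submoduleMap_surjective A.mkQ P))).symm⟩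
    change A.comap P.subtype = _
    ext x
    rw [LinearMap.mem_ker, ← Submodule.coe_eq_zero]
    simp
  finite_ext L N := by
    refine (finite_card_eq (Nat.card L.carrier * Nat.card N.carrier)).subset ?_
    rintro c ⟨M, A, rfl, ⟨e⟩, ⟨f⟩⟩
    refine ⟨M, rfl, ?_⟩
    rw [Submodule.card_eq_card_quotient_mul_card A]
    exact congrArg₂ _ (Nat.card_congr e.toEquiv) (Nat.card_congr f.toEquiv)

end FinMod

/-! ### Finite `𝔽₁[[t]]`-modules -/

/-- A finite `𝔽₁[[t]]`-module: a finite pointed set (a finite dimensional vector space over `𝔽₁`)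
with a nilpotent endomorphism `T`. An endomorphism of `(K, pt)` in `Vect_{𝔽₁}` is a map fixing `pt`
which is injective off the preimage of `pt`. -/
structure F1Mod where
  carrier : Type
  [finite : Finite carrier]
  pt : carrier
  T : carrier → carrier
  map_pt : T pt = pt
  inj : ∀ x y, T x ≠ pt → T x = T y → x = y
  nilp : ∃ n : ℕ, ∀ x, T^[n] x = pt

namespace F1Mod

attribute [instance] F1Mod.finite

/-- An isomorphism: a bijection preserving the marked points and commuting with `T`. -/
def Isom (K L : F1Mod) : Prop :=
  ∃ e : K.carrier ≃ L.carrier, e K.pt = L.pt ∧ ∀ x, e (K.T x) = L.T (e x)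

/-- Isomorphism of finite `𝔽₁[[t]]`-modules as an equivalence relation. -/
def isoSetoid : Setoid F1Mod where
  r := Isom
  iseqv := ⟨fun _ => ⟨.refl _, rfl, fun _ => rfl⟩,
    fun {K L} ⟨e, h, h'⟩ => ⟨e.symm, by simp [← h], fun x => by
      apply e.injective; rw [h']; simp⟩,
    fun ⟨e, h, h'⟩ ⟨f, k, k'⟩ => ⟨e.trans f, by simp [h, k], fun x => by simp [h', k']⟩⟩

/-- A submodule: a subset containing the marked point and stable under `T`. -/
@[ext] structure Sub (K : F1Mod) where
  carrier : Set K.carrier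
  pt_mem : K.pt ∈ carrier
  T_mem : ∀ x ∈ carrier, K.T x ∈ carrier

variable {K L : F1Mod}

lemma Sub.carrier_injective : Function.Injective (Sub.carrier (K := K)) := fun _ _ => Sub.ext

instance : PartialOrder K.Sub := PartialOrder.lift Sub.carrier Sub.carrier_injective

instance : BoundedOrder K.Sub where
  top := ⟨Set.univ, trivial, fun _ _ => trivial⟩
  bot := ⟨{K.pt}, rfl, fun x hx => by rw [Set.mem_singleton_iff] at *; rw [hx, K.map_pt]⟩
  le_top _ := Set.subset_univ _
  bot_le A := Set.singleton_subset_iff.mpr A.pt_mem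

instance : Finite K.Sub := Finite.of_injective _ Sub.carrier_injective

/-- A submodule as an `𝔽₁[[t]]`-module. -/
def Sub.toMod (A : K.Sub) : F1Mod where
  carrier := A.carrier
  pt := ⟨K.pt, A.pt_mem⟩
  T x := ⟨K.T x, A.T_mem x x.2⟩
  map_pt := Subtype.ext K.map_pt
  inj x y h h' := Subtype.ext (K.inj x y (fun e => h (Subtype.ext e)) (congrArg Subtype.val h'))
  nilp := by
    obtain ⟨n, hn⟩ := K.nilp
    refine ⟨n, fun x => Subtype.ext ?_⟩
    change _ = K.pt
    rw [← hn x]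
    have : Function.Semiconj (Subtype.val : A.carrier → K.carrier)
      (fun x => ⟨K.T x, A.T_mem x x.2⟩) K.T := fun _ => rfl
    exact this.iterate_right n x

/-- The equivalence relation on `K` which collapses the submodule `A` to a point. -/
def Sub.collapse (A : K.Sub) : Setoid K.carrier where
  r x y := x = y ∨ (x ∈ A.carrier ∧ y ∈ A.carrier)
  iseqv := ⟨fun _ => .inl rfl, fun h => h.elim (fun h => .inl h.symm) (fun h => .inr ⟨h.2, h.1⟩),
    fun {x y z} h h' => by
      rcases h with rfl | h
      · exact h'
      · rcases h' with rfl | h'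
        · exact .inr h
        · exact .inr ⟨h.1, h'.2⟩⟩

lemma Sub.mk_eq_pt (A : K.Sub) (x : K.carrier) :
    Quotient.mk A.collapse x = Quotient.mk A.collapse K.pt ↔ x ∈ A.carrier := by
  rw [Quotient.eq]
  constructor
  · rintro (h | h)
    · rw [h]; exact A.pt_mem
    · exact h.1
  · exact fun h => .inr ⟨h, A.pt_mem⟩

/-- The quotient `K/A`, obtained from `K` by collapsing `A` to the marked point. -/
def Sub.quotient (A : K.Sub) : F1Mod where
  carrier := Quotient A.collapse
  pt := Quotient.mk _ K.pt
  T := Quotient.map K.T (by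
    rintro x y (rfl | h)
    · exact .inl rfl
    · exact .inr ⟨A.T_mem _ h.1, A.T_mem _ h.2⟩)
  map_pt := by rw [Quotient.map_mk, K.map_pt]
  inj x y := by
    induction x using Quotient.inductionOn with | _ x => ?_
    induction y using Quotient.inductionOn with | _ y => ?_
    rw [Quotient.map_mk, Quotient.map_mk, ne_eq, A.mk_eq_pt]
    intro h h'
    rcases Quotient.exact h' with h' | h'
    · rw [K.inj x y (fun e => h (by rw [e]; exact A.pt_mem)) h']
    · exact absurd h'.1 h
  nilp := by
    obtain ⟨n, hn⟩ := K.nilp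
    refine ⟨n, fun x => ?_⟩
    induction x using Quotient.inductionOn with | _ x => ?_
    rw [← hn x]
    have : Function.Semiconj (Quotient.mk A.collapse) K.T (Quotient.map K.T (by
      rintro x y (rfl | h)
      · exact .inl rfl
      · exact .inr ⟨A.T_mem _ h.1, A.T_mem _ h.2⟩)) := fun _ => rfl
    exact (this.iterate_right n x).symm

lemma Sub.quotient_iso (A : K.Sub) (f : K.carrier → L.carrier)
    (hf : ∀ x, f (K.T x) = L.T (f x)) (surj : Function.Surjective f)
    (hker : ∀ x, f x = L.pt ↔ x ∈ A.carrier)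
    (hinj : ∀ x y, f x = f y → x = y ∨ f x = L.pt) : Isom A.quotient L := by
  let g : A.quotient.carrier → L.carrier := Quotient.lift f (by
    rintro x y (rfl | h)
    · rfl
    · rw [(hker x).mpr h.1, (hker y).mpr h.2])
  have hg : Function.Bijective g := by
    constructor
    · intro x y
      induction x using Quotient.inductionOn with | _ x => ?_
      induction y using Quotient.inductionOn with | _ y => ?_
      intro h
      have h : f x = f y := h
      refine Quotient.sound ?_
      rcases hinj x y h with h' | h'
      · exact .inl h'
      · exact .inr ⟨(hker x).mp h', (hker y).mp (h ▸ h')⟩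
    · intro y
      obtain ⟨x, rfl⟩ := surj y
      exact ⟨Quotient.mk _ x, rfl⟩
  refine ⟨Equiv.ofBijective g hg, (hker _).mpr A.pt_mem, fun x => ?_⟩
  induction x using Quotient.inductionOn with | _ x => exact hf x

/-- The zero module. -/
def zero : F1Mod := ⟨Unit, (), id, rfl, fun _ _ _ _ => rfl, ⟨0, fun _ => rfl⟩⟩

lemma isom_zero_of (h : ∀ x : K.carrier, x = K.pt) : Isom K zero :=
  ⟨⟨fun _ => (), fun _ => K.pt, fun x => (h x).symm, fun _ => rfl⟩, rfl, fun _ => rfl⟩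

lemma eq_pt_of_isom_zero (h : Isom K zero) (x : K.carrier) : x = K.pt := by
  obtain ⟨e, -⟩ := h
  exact e.injective rfl

/-- Submodules of a submodule `P` are the submodules below `P`. -/
def Sub.below (P : K.Sub) : P.toMod.Sub ≃ Set.Iic P where
  toFun A := ⟨⟨Subtype.val '' A.carrier, ⟨_, A.pt_mem, rfl⟩, by
    rintro _ ⟨x, hx, rfl⟩
    exact ⟨_, A.T_mem x hx, rfl⟩⟩, by rintro _ ⟨x, hx, rfl⟩; exact x.2⟩
  invFun A := ⟨Subtype.val ⁻¹' A.1.carrier, A.1.pt_mem, fun x hx => A.1.T_mem x.1 hx⟩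
  left_inv A := Sub.ext (Set.preimage_image_eq _ Subtype.val_injective)
  right_inv A := Subtype.ext (Sub.ext (by
    have h : A.1.carrier ⊆ P.carrier := A.2
    change Subtype.val '' (Subtype.val ⁻¹' A.1.carrier) = _
    rw [Subtype.image_preimage_val]
    exact Set.inter_eq_right.mpr h))

/-- Submodules of `K/A` are the submodules above `A`. -/
def Sub.above (A : K.Sub) : A.quotient.Sub ≃ Set.Ici A where
  toFun B := ⟨⟨Quotient.mk A.collapse ⁻¹' B.carrier, B.pt_mem, fun x hx => B.T_mem _ hx⟩, by
    intro x hx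
    change Quotient.mk A.collapse x ∈ B.carrier
    rw [(A.mk_eq_pt x).mpr hx]
    exact B.pt_mem⟩
  invFun P := ⟨Quotient.mk A.collapse '' P.1.carrier, ⟨_, P.1.pt_mem, rfl⟩, by
    rintro _ ⟨x, hx, rfl⟩
    exact ⟨_, P.1.T_mem x hx, rfl⟩⟩
  left_inv B := Sub.ext (Set.image_preimage_eq _ Quotient.mk_surjective)
  right_inv P := Subtype.ext (Sub.ext (by
    have h : A.carrier ⊆ P.1.carrier := P.2
    refine Set.Subset.antisymm ?_ (Set.subset_preimage_image _ _)
    rintro x ⟨y, hy, hxy⟩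
    rcases Quotient.exact hxy with rfl | h'
    · exact hy
    · exact h h'.2))

lemma finite_card_le (n : ℕ) :
    {c : Quotient isoSetoid | ∃ M : F1Mod, Quotient.mk _ M = c ∧ Nat.card M.carrier = n}.Finite := by
  let D := {c : Quotient isoSetoid | ∃ M : F1Mod, Quotient.mk _ M = c ∧ Nat.card M.carrier = n}
  let e (c : D) : c.2.choose.carrier ≃ Fin n := Finite.equivFinOfCardEq c.2.choose_spec.2
  let G : D → Fin n × (Fin n → Fin n) :=
    fun c => (e c c.2.choose.pt, fun i => e c (c.2.choose.T ((e c).symm i)))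
  have hG : Function.Injective G := by
    intro c d hcd
    apply Subtype.ext
    rw [← c.2.choose_spec.1, ← d.2.choose_spec.1]
    have h1 := congrArg Prod.fst hcd
    have h2 := congrArg Prod.snd hcd
    refine Quotient.sound ⟨(e c).trans (e d).symm, ?_, fun x => ?_⟩
    · rw [Equiv.trans_apply, Equiv.symm_apply_eq]; exact h1
    · have := congrFun h2 (e c x)
      simp only [G, Equiv.symm_apply_apply] at this
      rw [Equiv.trans_apply, Equiv.symm_apply_eq, this]
      rfl
  have := Finite.of_injective G hG
  exact Set.toFinite D

lemma card_le (A : K.Sub) :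
    Nat.card K.carrier ≤ Nat.card (A.toMod.carrier × A.quotient.carrier) := by
  classical
  let f : K.carrier → A.carrier × Quotient A.collapse := fun x =>
    (if h : x ∈ A.carrier then ⟨x, h⟩ else ⟨K.pt, A.pt_mem⟩, Quotient.mk _ x)
  refine Nat.card_le_card_of_injective f fun x y h => ?_
  have h1 := congrArg Prod.fst h
  rcases Quotient.exact (congrArg Prod.snd h) with h' | h'
  · exact h'
  · simp only [f] at h1
    rw [dif_pos h'.1, dif_pos h'.2] at h1
    exact congrArg Subtype.val h1

/-- The category of finite `𝔽₁[[t]]`-modules. -/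
def system : HallSystem.{0} where
  Ob := F1Mod
  iso := isoSetoid
  Sub := F1Mod.Sub
  sub := Sub.toMod
  quo := Sub.quotient
  zero := zero
  sub_bot _ := isom_zero_of fun x => Subtype.ext x.2
  quo_bot M := Sub.quotient_iso _ id (fun _ => rfl) Function.surjective_id (fun _ => Iff.rfl)
    fun _ _ h => .inl h
  sub_top M := ⟨Equiv.Set.univ _, rfl, fun _ => rfl⟩
  quo_top M := isom_zero_of fun x => by
    induction x using Quotient.inductionOn with | _ x => exact Quotient.sound (.inr ⟨trivial, trivial⟩)
  eq_bot {M} A h := by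
    refine bot_unique fun x hx => ?_
    exact congrArg Subtype.val (eq_pt_of_isom_zero h ⟨x, hx⟩)
  eq_top {M} A h := by
    refine top_unique fun x _ => ?_
    exact (A.mk_eq_pt x).mp (eq_pt_of_isom_zero h (Quotient.mk _ x))
  congr {M N} := by
    rintro ⟨e, he, he'⟩
    have he'' (y : N.carrier) : e.symm (N.T y) = M.T (e.symm y) := by
      rw [Equiv.symm_apply_eq, he', Equiv.apply_symm_apply]
    refine ⟨⟨fun A => ⟨e.symm ⁻¹' A.carrier, ?_, fun y hy => ?_⟩,
      fun A => ⟨e ⁻¹' A.carrier, ?_, fun y hy => ?_⟩, fun A => ?_, fun A => ?_⟩, fun A => ⟨?_, ?_⟩⟩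
    · change e.symm N.pt ∈ A.carrier
      rw [← he, Equiv.symm_apply_apply]; exact A.pt_mem
    · change e.symm (N.T y) ∈ A.carrier
      rw [he'']; exact A.T_mem _ hy
    · change e M.pt ∈ A.carrier
      rw [he]; exact A.pt_mem
    · change e (M.T y) ∈ A.carrier
      rw [he']; exact A.T_mem _ hy
    · exact Sub.ext (by ext; simp)
    · exact Sub.ext (by ext; simp)
    · exact ⟨e.subtypeEquiv fun x => by simp, Subtype.ext he, fun x => Subtype.ext (he' x.1)⟩
    · refine Sub.quotient_iso A (fun x => Quotient.mk _ (e x)) (fun x => ?_)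
        (Quotient.mk_surjective.comp e.surjective) (fun x => ?_) fun x y h => ?_
      · exact congrArg (Quotient.mk _) (he' x)
      · exact (Sub.mk_eq_pt _ _).trans (by simp)
      · rcases Quotient.exact h with h | h
        · exact .inl (e.injective h)
        · exact .inr ((Sub.mk_eq_pt _ _).mpr h.1)
  below := Sub.below
  above := Sub.above
  sub_below P A := ⟨Equiv.Set.image _ _ Subtype.val_injective, rfl, fun _ => rfl⟩
  quo_above {M} A B := by
    refine isoSetoid.symm (Sub.quotient_iso _
      (fun x => Quotient.mk B.collapse (Quotient.mk A.collapse x)) (fun _ => rfl)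
      (Quotient.mk_surjective.comp Quotient.mk_surjective) (fun x => ?_) fun x y h => ?_)
    · exact B.mk_eq_pt _
    · rcases Quotient.exact h with h | h
      · rcases Quotient.exact h with h' | h'
        · exact .inl h'
        · refine .inr ((B.mk_eq_pt _).mpr ?_)
          rw [(A.mk_eq_pt x).mpr h'.1]
          exact B.pt_mem
      · exact .inr ((B.mk_eq_pt _).mpr h.1)
  noether {M} A P h := by
    refine isoSetoid.symm (Sub.quotient_iso _
      (fun x : P.carrier => (⟨Quotient.mk A.collapse x.1, x.1, x.2, rfl⟩ :
        (A.above.symm ⟨P, h⟩).carrier)) (fun _ => rfl) ?_ (fun x => ?_) fun x y h => ?_)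
    · rintro ⟨_, x, hx, rfl⟩
      exact ⟨⟨x, hx⟩, rfl⟩
    · exact Subtype.ext_iff.trans (A.mk_eq_pt x.1)
    · rcases Quotient.exact (congrArg Subtype.val h) with h | h
      · exact .inl (Subtype.ext h)
      · exact .inr (Subtype.ext ((A.mk_eq_pt x.1).mpr h.1))
  finite_ext L N := by
    refine (Set.Finite.biUnion (Set.finite_Iic (Nat.card (L.carrier × N.carrier)))
      fun n _ => finite_card_le n).subset ?_
    rintro c ⟨M, A, rfl, ⟨e, -⟩, ⟨f, -⟩⟩
    refine Set.mem_biUnion (x := Nat.card M.carrier) ?_ ⟨M, rfl, rfl⟩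
    exact (card_le A).trans (Nat.card_congr (e.prodCongr f)).le

end F1Mod

/-! ### Partitions and the modules of a given type -/

/-- The set of all partitions. -/
abbrev Ptn : Type := Σ n : ℕ, n.Partition

/-- The partition `(1^r) = (1, …, 1)` of `r`. -/
def onesPtn (r : ℕ) : Ptn :=
  ⟨r, ⟨Multiset.replicate r 1, fun h => by rw [Multiset.eq_of_mem_replicate h]; exact one_pos,
    by simp⟩⟩

section

variable (R : Type u) [CommRing R] [IsDomain R] [IsDiscreteValuationRing R]
  [Finite (IsLocalRing.ResidueField R)]

/-- The Hall algebra of the category of finite `R`-modules. -/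
abbrev HallDVR : Type (u + 1) := (FinMod.system R).Alg

/-- The finite `R`-module `⨁ᵢ R/𝔪^{λᵢ}` of type `lam`, where `i` runs through the parts of `lam`
(with multiplicity). -/
def FinMod.ofPtn (lam : Ptn) : FinMod R :=
  have := FinMod.finite_quot (R := R)
  ⟨(i : lam.2.parts) → R ⧸ IsLocalRing.maximalIdeal R ^ (i : ℕ)⟩

/-- The element `u_λ` of `Hall(R)`: the isomorphism class of the modules of type `lam`. -/
def uDVR (lam : Ptn) : HallDVR R :=
  (FinMod.system R).basisElt ((FinMod.system R).cls (FinMod.ofPtn R lam))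

end

/-- The Hall algebra of the category of finite `𝔽₁[[t]]`-modules. -/
abbrev HallF1 : Type 1 := F1Mod.system.Alg

/-- The finite `𝔽₁[[t]]`-module of type `lam`: apart from the marked point `none`, it has for every
part `i` of `lam` (with multiplicity) the elements `(i, 0), …, (i, λᵢ - 1)`, and `T` maps
`(i, j + 1)` to `(i, j)` and `(i, 0)` to the marked point. -/
def F1Mod.ofPtn (lam : Ptn) : F1Mod where
  carrier := Option (Σ i : lam.2.parts, Fin (i : ℕ))
  pt := none
  T x := x.bind fun p =>
    if (p.2 : ℕ) = 0 then none else some ⟨p.1, ⟨p.2 - 1, lt_of_le_of_lt (Nat.sub_le _ _) p.2.2⟩⟩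
  map_pt := rfl
  inj := by
    rintro (_ | ⟨i, j⟩) (_ | ⟨i', j'⟩) h h'
    · rfl
    · exact absurd rfl h
    · exact absurd h' h
    · by_cases hj : (j : ℕ) = 0
      · exact absurd (by simp [hj]) h
      · by_cases hj' : (j' : ℕ) = 0
        · exact absurd (by rw [h']; simp [hj']) h
        · simp only [Option.bind_some, if_neg hj, if_neg hj', Option.some.injEq] at h'
          obtain ⟨rfl, h2⟩ := Sigma.mk.inj h'
          have := Fin.ext_iff.mp (eq_of_heq h2)
          simp only at this
          have : j = j' := Fin.ext (by omega)
          rw [this]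
  nilp := by
    refine ⟨lam.1 + 1, ?_⟩
    have key : ∀ (n : ℕ) (i : lam.2.parts) (j : Fin (i : ℕ)), (j : ℕ) < n →
        (fun x : Option (Σ i : lam.2.parts, Fin (i : ℕ)) => x.bind fun p =>
          if (p.2 : ℕ) = 0 then none
          else some ⟨p.1, ⟨p.2 - 1, lt_of_le_of_lt (Nat.sub_le _ _) p.2.2⟩⟩)^[n]
            (some ⟨i, j⟩) = none := by
      intro n
      induction n with
      | zero => intro i j h; exact absurd h (Nat.not_lt_zero _)
      | succ n ih =>
        intro i j h
        rw [Function.iterate_succ_apply]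
        by_cases hj : (j : ℕ) = 0
        · simp only [Option.bind_some, if_pos hj]
          exact Function.iterate_fixed rfl n
        · simp only [Option.bind_some, if_neg hj]
          exact ih i ⟨j - 1, _⟩ (by simp only; omega)
    rintro (_ | ⟨i, j⟩)
    · exact Function.iterate_fixed rfl _
    · refine key _ i j ?_
      have h1 : (i : ℕ) ∈ lam.2.parts := Multiset.coe_mem
      have h2 := Multiset.le_sum_of_mem h1
      rw [lam.2.parts_sum] at h2
      have := j.2
      omega

/-- The element `u_λ` of `Hall(𝔽₁[[t]])`: the isomorphism class of the modules of type `lam`. -/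
def uF1 (lam : Ptn) : HallF1 := F1Mod.system.basisElt (F1Mod.system.cls (F1Mod.ofPtn lam))

/-! ### The ring of symmetric functions -/

namespace SymFun

open MvPolynomial

/-- The inverse limit `Λ^k = lim Λ_n^k`, where `Λ_n^k` is the group of symmetric polynomials in
`ℤ[x_1, …, x_n]` which are homogeneous of degree `k`, and `Λ_{n+1}^k → Λ_n^k` sets the last variable
to `0`. -/
def piece (k : ℕ) : AddSubgroup (∀ n : ℕ, MvPolynomial (Fin n) ℤ) where
  carrier := {f | ∀ n, (f n).IsSymmetric ∧ (f n).IsHomogeneous k ∧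
    killCompl (Fin.castSucc_injective n) (f (n + 1)) = f n}
  zero_mem' n := ⟨.zero, isHomogeneous_zero _ _ _, map_zero _⟩
  add_mem' hf hg n := ⟨(hf n).1.add (hg n).1, (hf n).2.1.add (hg n).2.1, by
    rw [Pi.add_apply, map_add, (hf n).2.2, (hg n).2.2]; rfl⟩
  neg_mem' hf n := ⟨(hf n).1.neg, (hf n).2.1.neg, by
    rw [Pi.neg_apply, map_neg, (hf n).2.2]; rfl⟩

instance : SetLike.GradedMonoid piece where
  one_mem n := ⟨.one, isHomogeneous_one _ _, map_one _⟩
  mul_mem _ _ _ _ hf hg n := ⟨(hf n).1.mul (hg n).1, (hf n).2.1.mul (hg n).2.1, by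
    rw [Pi.mul_apply, map_mul, (hf n).2.2, (hg n).2.2]; rfl⟩

end SymFun

/-- The ring of symmetric functions `Λ = ⨁_k Λ^k`. -/
abbrev SymFun : Type := DirectSum ℕ fun k => SymFun.piece k

namespace SymFun

open MvPolynomial

lemma killCompl_msymm {k : ℕ} (μ : k.Partition) (n : ℕ) :
    killCompl (Fin.castSucc_injective n) (msymm (Fin (n + 1)) ℤ μ) = msymm (Fin n) ℤ μ := by
  rw [msymm, msymm, map_sum]
  symm
  have hof (s : Sym (Fin n) k) : Nat.Partition.ofSym (s.map Fin.castSucc) = Nat.Partition.ofSym s := by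
    ext1
    simp only [Nat.Partition.ofSym, Sym.val_eq_coe, Sym.coe_map]
    rw [Multiset.dedup_map_of_injective (Fin.castSucc_injective n), Multiset.map_map]
    refine Multiset.map_congr rfl fun i _ => ?_
    exact Multiset.count_map_eq_count' _ _ (Fin.castSucc_injective n) _
  refine Finset.sum_of_injOn (fun s => ⟨s.1.map Fin.castSucc, by rw [hof, s.2]⟩) ?_ ?_ ?_ ?_
  · intro s _ t _ h
    exact Subtype.ext (Sym.map_injective (Fin.castSucc_injective n) k (congrArg Subtype.val h))
  · simp
  · intro s _ hs
    have hlast : Fin.last n ∈ s.1.1 := by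
      by_contra hl
      refine hs ?_
      have h (a : Fin (n + 1)) (ha : a ∈ s.1.1) : ∃ b : Fin n, b.castSucc = a :=
        Fin.exists_castSucc_eq.mpr fun h => hl (h ▸ ha)
      obtain ⟨⟨s, hs'⟩, hμ⟩ := s
      obtain ⟨t, rfl⟩ : ∃ t : Multiset (Fin n), t.map Fin.castSucc = s :=
        by
          choose f hf using h
          refine ⟨s.attach.map fun a => f a.1 a.2, ?_⟩
          rw [Multiset.map_map]
          exact (Multiset.map_congr rfl fun a _ => hf a.1 a.2).trans s.attach_map_val
      have ht : t.card = k := by simpa using hs'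
      refine ⟨⟨⟨t, ht⟩, ?_⟩, Finset.mem_coe.mpr (Finset.mem_univ _), ?_⟩
      · exact (hof (⟨t, ht⟩ : Sym (Fin n) k)).symm.trans hμ
      · rfl
    rw [map_multiset_prod, Multiset.map_map]
    refine Multiset.prod_eq_zero (Multiset.mem_map.mpr ⟨_, hlast, ?_⟩)
    simp [killCompl]
  · intro s _
    rw [map_multiset_prod, Multiset.map_map]
    simp only [Sym.val_eq_coe, Sym.coe_map, Multiset.map_map]
    congr 1
    refine Multiset.map_congr rfl fun i _ => ?_
    have := killCompl_rename_app (Fin.castSucc_injective n) (X i : MvPolynomial (Fin n) ℤ)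
    rw [rename_X] at this
    exact this.symm

/-- The monomial symmetric function `m_λ`, given by the monomial symmetric polynomials
`m_λ(x_1, …, x_n)` for all `n` (which vanish for `n` less than the length of `lam`). -/
def monom (lam : Ptn) : SymFun :=
  DirectSum.of (fun k => piece k) lam.1 ⟨fun n => msymm (Fin n) ℤ lam.2, fun n =>
    ⟨msymm_isSymmetric _ _ _, by
      change (msymm (Fin n) ℤ lam.2).IsHomogeneous lam.1
      unfold msymm
      refine IsHomogeneous.sum _ _ _ fun s _ => ?_
      have h (t : Multiset (Fin n)) : (t.map (X : Fin n → MvPolynomial (Fin n) ℤ)).prod.IsHomogeneous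
          t.card := by
        induction t using Multiset.induction_on with
        | empty => simpa using isHomogeneous_one _ _
        | cons a t ih =>
          rw [Multiset.map_cons, Multiset.prod_cons, Multiset.card_cons, add_comm]
          exact (isHomogeneous_X _ _).mul ih
      have := h s.1.1
      rwa [s.1.2] at this,
    killCompl_msymm _ _⟩⟩

end SymFun

end

/-!
The three rings `Hall(R)`, `Hall(𝔽₁[[t]])` and `Λ` have bases indexed by the partitions, and in each
of them the products `u_μ u_{(1^r)}` (in `Λ`: `m_μ m_{(1^r)}`) follow one Pieri rule. For a
partition `λ` and a set `J` of `r` of its parts, let `λ - 1_J` be the partition obtained by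
decreasing the parts in `J` by one. The coefficient of `u_λ` in `u_μ u_{(1^r)}` is the value of
`pieriPoly μ r λ = ∑ t^{dim C_J}`, the sum over the sets `J` with `λ - 1_J = μ`, at the cardinality
`q` of the residue field for `Hall(R)` and at `1` for the other two rings.

* `Hall(R)`: a submodule of type `(1^r)` of the module `M` of type `λ` is an `r`-dimensional
  subspace `A` of the socle. The intersections of the socle with the `𝔪^i M` are members of a
  complete flag. If `A` lies in the Schubert cell `C_J` of that flag, then the lengths of the modules `𝔪^i (M/A)`,
  which determine the type (`excess_injective`), show that `M/A` has type `λ - 1_J`; and the cell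
  has `q^{dim C_J}` elements (`IsSocleFlag.card_jumps_eq`, `isPieriBasis_basisDVR`).
* `Hall(𝔽₁[[t]])`: a submodule of type `(1^r)` is a set `J` of `r` of the chains of which the last
  element is collapsed (`isPieriBasis_basisF1`).
* `Λ`: the monomial `x^λ` arises from `m_μ m_{(1^r)}` once for every `J` with `x^λ / x^J` of
  shape `μ` (`SymFun.isPieriBasis_monomBasis`).

All the rest is formal (`IsPieriBasis`). If `λ` has length `r`, then `u_λ` occurs in
`u_{λ - (1^r)} u_{(1^r)}` with coefficient `1`, all other partitions occurring there are longer, and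
so `u_λ` is expressed by `u_{λ - (1^r)} u_{(1^r)}` and longer partitions of the same size. Induction
yields that the `u_{(1^r)}` generate, and a recursion, the same for all three rings, for polynomials
`structPoly` which give the structure constants. Commutativity needs to be checked for the
generators only, where it is a symmetry of Grassmannians (`pieriPoly_ones_comm`). In each
degree there are as many monomials in the generators as basis elements, and a surjective endomorphism of a finitely
generated module is injective, so the generators are algebraically independent. Hence `Hall(R)` and
`Λ` are polynomial rings in the generators, and the isomorphism follows.
-/

/-! ### Partitions, removal of vertical strips and the Pieri polynomials -/

namespace Ptn

lemma ext_parts {mu nu : Ptn} (h : mu.2.parts = nu.2.parts) : mu = nu := by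
  obtain ⟨m, mu⟩ := mu
  obtain ⟨n, nu⟩ := nu
  have hmn : m = n := by rw [← mu.parts_sum, ← nu.parts_sum, h]
  subst hmn
  congr 1
  exact Nat.Partition.ext h

/-- The partition whose parts are the nonzero elements of a multiset. -/
def ofMultiset (s : Multiset ℕ) : Ptn := ⟨s.sum, Nat.Partition.ofSums s.sum s rfl⟩

lemma ofMultiset_parts (s : Multiset ℕ) : (ofMultiset s).2.parts = s.filter (· ≠ 0) := rfl

lemma parts_filter (mu : Ptn) : mu.2.parts.filter (· ≠ 0) = mu.2.parts :=
  Multiset.filter_eq_self.mpr fun _ h => (mu.2.parts_pos h).ne'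

/-- The parts of a partition in decreasing order, continued by zeros. -/
def seq (lam : Ptn) (i : ℕ) : ℕ := (lam.2.parts.sort (· ≥ ·)).getD i 0

/-- The length of a partition. -/
def len (lam : Ptn) : ℕ := Multiset.card lam.2.parts

lemma length_sort (lam : Ptn) : (lam.2.parts.sort (· ≥ ·)).length = lam.len :=
  Multiset.length_sort (s := lam.2.parts) (r := (· ≥ ·))

lemma map_seq (lam : Ptn) : (Finset.range lam.len).val.map lam.seq = lam.2.parts := by
  conv_rhs => rw [← Multiset.sort_eq lam.2.parts (· ≥ ·)]
  change ((List.range lam.len).map lam.seq : Multiset ℕ) = _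
  congr 1
  refine List.ext_getElem
    (by rw [List.length_map, List.length_range, length_sort]) fun i h1 h2 => ?_
  rw [List.getElem_map, List.getElem_range, seq, List.getD_eq_getElem _ _ h2]

lemma seq_pos (lam : Ptn) {i : ℕ} (hi : i < lam.len) : 0 < lam.seq i := by
  refine lam.2.parts_pos ?_
  rw [← lam.map_seq]
  exact Multiset.mem_map_of_mem _ (Finset.mem_range.mpr hi)

lemma seq_eq_zero (lam : Ptn) {i : ℕ} (hi : lam.len ≤ i) : lam.seq i = 0 :=
  List.getD_eq_default _ _ (by rwa [length_sort])

lemma seq_antitone (lam : Ptn) : Antitone lam.seq := by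
  intro i j hij
  rcases lt_or_ge j lam.len with hj | hj
  · have hi : i < lam.len := hij.trans_lt hj
    rw [← length_sort] at hi hj
    rw [seq, seq, List.getD_eq_getElem _ _ hi, List.getD_eq_getElem _ _ hj]
    rcases hij.eq_or_lt with rfl | hij
    · exact le_rfl
    · exact List.pairwise_iff_getElem.mp (Multiset.pairwise_sort lam.2.parts (· ≥ ·)) i j hi hj hij
  · rw [seq_eq_zero _ hj]; exact Nat.zero_le _

end Ptn

/-- The sum `∑_{x ∈ s} (x - i)^+`. For the type of a finite module over a discrete valuation ring
this is the length of `𝔪^i M`. -/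
def excess (s : Multiset ℕ) (i : ℕ) : ℕ := (s.map (· - i)).sum

lemma excess_second_difference (s : Multiset ℕ) (x : ℕ) :
    excess s x + excess s (x + 2) = 2 * excess s (x + 1) + s.count (x + 1) := by
  induction s using Multiset.induction_on with
  | empty => simp [excess]
  | cons a s ih =>
    simp only [excess, Multiset.map_cons, Multiset.sum_cons, Multiset.count_cons] at *
    split_ifs <;> omega

/-- A partition is determined by the numbers `∑_i (λ_i - k)^+`, whose second difference counts the
parts of a given size. -/
lemma excess_injective {s t : Multiset ℕ} (hs : 0 ∉ s) (ht : 0 ∉ t)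
    (h : ∀ i, excess s i = excess t i) : s = t := by
  ext x
  rcases x with _ | x
  · rw [Multiset.count_eq_zero_of_notMem hs, Multiset.count_eq_zero_of_notMem ht]
  · have h1 := excess_second_difference s x
    have h2 := excess_second_difference t x
    rw [h, h, h] at h1
    omega

lemma excess_filter (s : Multiset ℕ) (i : ℕ) : excess (s.filter (· ≠ 0)) i = excess s i := by
  induction s using Multiset.induction_on with
  | empty => rfl
  | cons a s ih =>
    rcases Nat.eq_zero_or_pos a with rfl | ha
    · rw [Multiset.filter_cons_of_neg (p := (· ≠ 0)) _ (by simp), ih]; simp [excess]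
    · rw [Multiset.filter_cons_of_pos (p := (· ≠ 0)) _ ha.ne']
      simp only [excess, Multiset.map_cons, Multiset.sum_cons] at *
      rw [ih]

lemma Ptn.excess_injective {mu nu : Ptn} (h : ∀ i, excess mu.2.parts i = excess nu.2.parts i) :
    mu = nu :=
  Ptn.ext_parts (_root_.excess_injective (fun h => (mu.2.parts_pos h).ne rfl)
    (fun h => (nu.2.parts_pos h).ne rfl) h)

section strip

variable {ι κ : Type*} [DecidableEq ι] [DecidableEq κ]

/-- The multiset obtained from the family `(f j)_{j ∈ s}` by subtracting `1` from the members with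
`j ∈ J` and dropping the zeros. -/
def strip (s : Finset ι) (f : ι → ℕ) (J : Finset ι) : Multiset ℕ :=
  (s.val.map fun j => f j - if j ∈ J then 1 else 0).filter (· ≠ 0)

lemma zero_notMem_strip (s : Finset ι) (f : ι → ℕ) (J : Finset ι) : 0 ∉ strip s f J := by
  simp [strip]

/-- Subtracting `1` from the members with `j ∈ J` lowers `∑_j (f j - i)^+` by the number of those
`j ∈ J` with `f j > i`. -/
lemma excess_strip (s : Finset ι) (f : ι → ℕ) {J : Finset ι} (hJ : J ⊆ s) (i : ℕ) :
    excess (strip s f J) i + (J.filter fun j => i < f j).card = ∑ j ∈ s, (f j - i) := by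
  rw [strip, excess_filter, excess, Multiset.map_map]
  have h1 : (J.filter fun j => i < f j) = s.filter fun j => j ∈ J ∧ i < f j := by
    ext j; simp only [Finset.mem_filter]; exact ⟨fun h => ⟨hJ h.1, h⟩, fun h => h.2⟩
  rw [h1, Finset.card_filter]
  change ∑ j ∈ s, (f j - (if j ∈ J then 1 else 0) - i) + _ = _
  rw [← Finset.sum_add_distrib]
  refine Finset.sum_congr rfl fun j _ => ?_
  by_cases h : j ∈ J <;> by_cases h' : i < f j <;> simp [h, h'] <;> omega

lemma sum_strip (s : Finset ι) (f : ι → ℕ) {J : Finset ι} (hJ : J ⊆ s) (hf : ∀ j ∈ J, 0 < f j) :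
    (strip s f J).sum + J.card = ∑ j ∈ s, f j := by
  have h := excess_strip s f hJ 0
  rw [Finset.filter_true_of_mem hf] at h
  simpa [excess] using h

/-- The number of subsets `J` of `s` with `r` elements such that subtracting `1` at the members of
`J` turns the family `f` into `mu`. -/
def stripCount (s : Finset ι) (f : ι → ℕ) (r : ℕ) (mu : Multiset ℕ) : ℕ :=
  ((s.powersetCard r).filter fun J => strip s f J = mu).card

lemma strip_map (s : Finset ι) (e : ι ↪ κ) (f : κ → ℕ) (J : Finset ι) :
    strip (s.map e) f (J.map e) = strip s (f ∘ e) J := by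
  simp [strip, Finset.map_val, Multiset.map_map]

lemma stripCount_map (s : Finset ι) (e : ι ↪ κ) (f : κ → ℕ) (r : ℕ) (mu : Multiset ℕ) :
    stripCount (s.map e) f r mu = stripCount s (f ∘ e) r mu := by
  rw [stripCount, stripCount, Finset.powersetCard_map, Finset.filter_map, Finset.card_map]
  congr 1
  refine Finset.filter_congr fun J _ => ?_
  rw [Function.comp_apply]
  change strip (s.map e) f (J.map e) = mu ↔ _
  rw [strip_map]

end strip

/-- Two families with the same multiset of values differ by a bijection of the index sets. -/
lemma exists_equiv_of_map_eq {ι κ α : Type*} [Fintype ι] [Fintype κ] (f : ι → α) (g : κ → α)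
    (h : (Finset.univ : Finset ι).val.map f = (Finset.univ : Finset κ).val.map g) :
    ∃ e : ι ≃ κ, ∀ i, g (e i) = f i := by
  classical
  have hc (a : α) : Nonempty ({i // f i = a} ≃ {k // g k = a}) := by
    rw [← Fintype.card_eq, Fintype.card_subtype, Fintype.card_subtype]
    have := congrArg (Multiset.count a) h
    rw [Multiset.count_map, Multiset.count_map] at this
    simpa [Finset.card_def, Finset.filter_val, eq_comm] using this
  let e := fun a => (hc a).some
  exact ⟨Equiv.ofFiberEquiv e, fun i => Equiv.ofFiberEquiv_map e i⟩

lemma stripCount_congr {ι κ : Type*} [DecidableEq ι] [DecidableEq κ] {s : Finset ι} {t : Finset κ}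
    {f : ι → ℕ} {g : κ → ℕ} (h : s.val.map f = t.val.map g) (r : ℕ) (mu : Multiset ℕ) :
    stripCount s f r mu = stripCount t g r mu := by
  have hs : (Finset.univ : Finset s).val.map (fun x : s => f x) = s.val.map f := by
    conv_rhs => rw [← Finset.attach_map_val (s := s), Finset.map_val, Multiset.map_map]
    rfl
  have ht : (Finset.univ : Finset t).val.map (fun x : t => g x) = t.val.map g := by
    conv_rhs => rw [← Finset.attach_map_val (s := t), Finset.map_val, Multiset.map_map]
    rfl
  obtain ⟨e, he⟩ := exists_equiv_of_map_eq (fun x : s => f x) (fun x : t => g x)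
    (by rw [hs, ht, h])
  have h1 := stripCount_map (Finset.univ : Finset s) (Function.Embedding.subtype _) f r mu
  have h2 := stripCount_map (Finset.univ : Finset t) (Function.Embedding.subtype _) g r mu
  have h3 := stripCount_map (Finset.univ : Finset s) e.toEmbedding (fun x : t => g x) r mu
  rw [Finset.univ_eq_attach, Finset.attach_map_val] at h1 h2
  rw [h1, h2]
  rw [← Finset.univ_eq_attach, ← Finset.univ_eq_attach]
  rw [Finset.map_univ_equiv] at h3
  have h4 : (fun x : t => g x) ∘ e.toEmbedding = f ∘ (Function.Embedding.subtype (· ∈ s)) :=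
    funext fun x => he x
  rw [h4] at h3
  exact h3.symm

/-- The number of pairs `i < j` with `i ∉ J` and `j ∈ J`: the dimension of the Schubert cell
indexed by `J`. -/
def cellDim (J : Finset ℕ) : ℕ := ∑ j ∈ J, (Finset.range j \ J).card

/-- The polynomial which gives the coefficient of `u_λ` in `u_μ u_{(1^r)}`: the sum of `t^{dim C_J}`
over the Schubert cells `C_J` of the Grassmannian of `r`-dimensional subspaces of the socle which
consist of submodules with quotient of type `μ`. -/
noncomputable def pieriPoly (mu : Ptn) (r : ℕ) (lam : Ptn) : ℤ[X] :=
  ∑ J ∈ ((Finset.range lam.len).powersetCard r).filter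
    (fun J => strip (Finset.range lam.len) lam.seq J = mu.2.parts), Polynomial.X ^ cellDim J

lemma pieriPoly_eval_one (mu : Ptn) (r : ℕ) (lam : Ptn) : (pieriPoly mu r lam).eval 1 =
    stripCount (Finset.range lam.len) lam.seq r mu.2.parts := by
  simp [pieriPoly, Polynomial.eval_finsetSum, stripCount]

lemma sum_seq (lam : Ptn) : ∑ j ∈ Finset.range lam.len, lam.seq j = lam.1 := by
  rw [← lam.2.parts_sum, ← lam.map_seq]; rfl

lemma pieriPoly_eq_zero {mu : Ptn} {r : ℕ} {lam : Ptn} (h : lam.1 ≠ mu.1 + r) :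
    pieriPoly mu r lam = 0 := by
  rw [pieriPoly, Finset.filter_eq_empty_iff.mpr, Finset.sum_empty]
  intro J hJ h'
  rw [Finset.mem_powersetCard] at hJ
  have h1 := sum_strip (Finset.range lam.len) lam.seq hJ.1
    fun j hj => lam.seq_pos (Finset.mem_range.mp (hJ.1 hj))
  rw [h', mu.2.parts_sum, hJ.2, sum_seq] at h1
  exact h h1.symm

/-- The partition `λ - (1^r)`, where `r` is the length of `λ`. -/
def Ptn.pred (lam : Ptn) : Ptn := Ptn.ofMultiset (lam.2.parts.map (· - 1))

lemma pieriPoly_eq_zero_of_len_lt {mu : Ptn} {r : ℕ} {lam : Ptn} (h : lam.len < r) :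
    pieriPoly mu r lam = 0 := by
  rw [pieriPoly, Finset.powersetCard_eq_empty.mpr (by simpa using h)]
  rfl

/-- If `r` is the length of `λ`, only `J = {0, …, r-1}` has `r` elements, and its cell is a
point. -/
lemma pieriPoly_len (mu lam : Ptn) [Decidable (lam.pred = mu)] :
    pieriPoly mu lam.len lam = if lam.pred = mu then 1 else 0 := by
  have h1 : strip (Finset.range lam.len) lam.seq (Finset.range lam.len) =
      lam.pred.2.parts := by
    rw [Ptn.pred, Ptn.ofMultiset_parts, strip]
    conv_rhs => rw [← lam.map_seq, Multiset.map_map]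
    congr 1
    refine Multiset.map_congr rfl fun j hj => ?_
    have hj : j ∈ Finset.range lam.len := hj
    simp [Finset.mem_range.mp hj]
  have h2 : cellDim (Finset.range lam.len) = 0 := by
    refine Finset.sum_eq_zero fun j hj => ?_
    rw [Finset.card_eq_zero, Finset.sdiff_eq_empty_iff_subset]
    exact Finset.range_subset_range.mpr (Finset.mem_range.mp hj).le
  have h3 := Finset.powersetCard_self (Finset.range lam.len)
  rw [Finset.card_range] at h3
  rw [pieriPoly, h3, Finset.filter_singleton, h1]
  by_cases h : lam.pred = mu
  · rw [if_pos h, if_pos (by rw [h]), Finset.sum_singleton, h2, pow_zero]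
  · rw [if_neg h, if_neg fun h' => h (Ptn.ext_parts h'), Finset.sum_empty]

lemma multiset_eq_of_filter_eq {s t : Multiset ℕ} (h : s.filter (· ≠ 0) = t.filter (· ≠ 0))
    (hc : Multiset.card s = Multiset.card t) : s = t := by
  have key (s : Multiset ℕ) : s.filter (· ≠ 0) +
      Multiset.replicate (Multiset.card s - Multiset.card (s.filter (· ≠ 0))) 0 = s := by
    have h1 := Multiset.filter_add_not (· ≠ 0) s
    have h2 : s.filter (fun a => ¬ a ≠ 0) = Multiset.replicate
        (Multiset.card (s.filter fun a => ¬ a ≠ 0)) 0 :=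
      Multiset.eq_replicate_card.mpr fun b hb => by simpa using (Multiset.mem_filter.mp hb).2
    have h3 := congrArg Multiset.card h1
    rw [Multiset.card_add] at h3
    rw [← h3, Nat.add_sub_cancel_left, ← h2, h1]
  rw [← key s, ← key t, h, hc]

/-- A partition is determined by its length `r` and the partition `λ - (1^r)`. -/
lemma Ptn.eq_of_pred_eq {lam kap : Ptn} (h : lam.pred = kap.pred) (hl : lam.len = kap.len) :
    lam = kap := by
  have h1 : lam.2.parts.map (· - 1) = kap.2.parts.map (· - 1) :=
    multiset_eq_of_filter_eq (congrArg (fun k : Ptn => k.2.parts) h) (by simpa [len] using hl)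
  have key (k : Ptn) : (k.2.parts.map (· - 1)).map (· + 1) = k.2.parts := by
    rw [Multiset.map_map]
    conv_rhs => rw [← Multiset.map_id k.2.parts]
    refine Multiset.map_congr rfl fun x hx => ?_
    exact Nat.sub_add_cancel (k.2.parts_pos hx)
  exact Ptn.ext_parts (by rw [← key lam, h1, key kap])

lemma Ptn.pred_size (lam : Ptn) : lam.pred.1 + lam.len = lam.1 := by
  classical
  by_contra h
  have h1 := pieriPoly_len lam.pred lam
  rw [if_pos rfl, pieriPoly_eq_zero (Ne.symm h)] at h1
  exact zero_ne_one h1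

lemma Ptn.len_pos {lam : Ptn} (h : lam.1 ≠ 0) : 0 < lam.len := by
  rw [Ptn.len, Multiset.card_pos]
  intro h'
  apply h
  rw [← lam.2.parts_sum, h', Multiset.sum_zero]

lemma Ptn.len_le (lam : Ptn) : lam.len ≤ lam.1 := by
  have := lam.pred_size; omega

lemma Ptn.eq_empty {lam : Ptn} (h : lam.1 = 0) : lam = onesPtn 0 := by
  refine Ptn.ext_parts ?_
  have h1 := lam.len_le
  rw [h, Nat.le_zero, Ptn.len, Multiset.card_eq_zero] at h1
  rw [h1]; rfl

/-! ### Symmetry of the Pieri polynomials on columns -/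

lemma cellDim_eq_card_pairs {J : Finset ℕ} {n : ℕ} (hJ : J ⊆ Finset.range n) :
    cellDim J = ((Finset.range n ×ˢ Finset.range n).filter
      fun p => p.1 < p.2 ∧ p.1 ∉ J ∧ p.2 ∈ J).card := by
  rw [cellDim, ← Finset.card_sigma]
  refine Finset.card_bij' (fun p _ => (p.2, p.1)) (fun p _ => ⟨p.2, p.1⟩) ?_ ?_
    (fun _ _ => rfl) (fun _ _ => rfl)
  · rintro ⟨j, i⟩ h
    simp only [Finset.mem_sigma, Finset.mem_sdiff, Finset.mem_range, Finset.mem_filter,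
      Finset.mem_product] at h ⊢
    have := Finset.mem_range.mp (hJ h.1)
    exact ⟨⟨by omega, this⟩, h.2.1, h.2.2, h.1⟩
  · rintro ⟨i, j⟩ h
    simp only [Finset.mem_sigma, Finset.mem_sdiff, Finset.mem_range, Finset.mem_filter,
      Finset.mem_product] at h ⊢
    exact ⟨h.2.2.2, h.2.1, h.2.2.1⟩

/-- For a set `J` with `{0, …, a-1} ⊆ J ⊆ {0, …, n-1}`: the set which contains `{0, …, a-1}`, too,
and whose remaining elements form the reversed complement of `J` in `{a, …, n-1}`. -/
def flipSet (a n : ℕ) (J : Finset ℕ) : Finset ℕ :=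
  (Finset.range n).filter fun j => j < a ∨ a + n - 1 - j ∉ J

lemma mem_flipSet {a n j : ℕ} {J : Finset ℕ} :
    j ∈ flipSet a n J ↔ j < n ∧ (j < a ∨ a + n - 1 - j ∉ J) := by simp [flipSet]

lemma flipSet_flipSet {a n : ℕ} {J : Finset ℕ} (hJ : J ⊆ Finset.range n)
    (ha : Finset.range a ⊆ J) : flipSet a n (flipSet a n J) = J := by
  ext j
  rw [mem_flipSet, mem_flipSet]
  by_cases hj : j < a
  · have h1 := ha (Finset.mem_range.mpr hj)
    exact iff_of_true ⟨Finset.mem_range.mp (hJ h1), .inl hj⟩ h1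
  · by_cases hn : j < n
    · have h1 : a + n - 1 - j < n := by omega
      have h2 : ¬ a + n - 1 - j < a := by omega
      have h3 : a + n - 1 - (a + n - 1 - j) = j := by omega
      simp [hj, hn, h1, h2, h3]
    · exact iff_of_false (fun h => hn h.1) fun h => hn (Finset.mem_range.mp (hJ h))

/-- The union of `{0, …, a-1}` and a reflected copy of the complement of `J` has `a + (n - |J|)`
elements. -/
lemma card_flipSet {a n : ℕ} {J : Finset ℕ} (hJ : J ⊆ Finset.range n)
    (ha : Finset.range a ⊆ J) : (flipSet a n J).card + J.card = n + a := by
  have h0 : flipSet a n J = Finset.range a ∪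
      ((Finset.range n \ J).image fun j => a + n - 1 - j) := by
    ext j
    simp only [mem_flipSet, Finset.mem_union, Finset.mem_image, Finset.mem_sdiff,
      Finset.mem_range]
    constructor
    · rintro ⟨hn, h⟩
      by_cases hj : j < a
      · exact .inl hj
      · exact .inr ⟨a + n - 1 - j, ⟨by omega, h.resolve_left hj⟩, by omega⟩
    · rintro (h | ⟨i, ⟨hi, hiJ⟩, rfl⟩)
      · exact ⟨Finset.mem_range.mp (hJ (ha (Finset.mem_range.mpr h))), .inl h⟩
      · have hai : ¬ i < a := fun h => hiJ (ha (Finset.mem_range.mpr h))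
        refine ⟨by omega, .inr ?_⟩
        rwa [show a + n - 1 - (a + n - 1 - i) = i by omega]
  have hlow (i : ℕ) (hi : i ∈ Finset.range n \ J) : a ≤ i ∧ i < n := by
    rw [Finset.mem_sdiff, Finset.mem_range] at hi
    exact ⟨not_lt.mp fun h => hi.2 (ha (Finset.mem_range.mpr h)), hi.1⟩
  rw [h0, Finset.card_union_of_disjoint, Finset.card_range, Finset.card_image_of_injOn,
    Finset.card_sdiff_of_subset hJ, Finset.card_range]
  · have := Finset.card_le_card hJ
    rw [Finset.card_range] at this
    omega
  · intro i hi j hj h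
    have h1 := hlow i hi
    have h2 := hlow j hj
    simp only at h
    omega
  · rw [Finset.disjoint_left]
    intro j hj h
    obtain ⟨i, hi, rfl⟩ := Finset.mem_image.mp h
    have := hlow i hi
    rw [Finset.mem_range] at hj
    omega

/-- The reflection `j ↦ a + n - 1 - j` reverses the order and exchanges membership in `J` and
nonmembership in `flipSet a n J` for indices `≥ a`; the smaller indices lie in both sets and occur
in no pair `i < j` with `i ∉ J`. -/
lemma cellDim_flipSet_le {a n : ℕ} {J : Finset ℕ} (hJ : J ⊆ Finset.range n)
    (ha : Finset.range a ⊆ J) : cellDim J ≤ cellDim (flipSet a n J) := by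
  rw [cellDim_eq_card_pairs hJ,
    cellDim_eq_card_pairs (J := flipSet a n J) (n := n) (Finset.filter_subset _ _)]
  refine Finset.card_le_card_of_injOn (fun p => (a + n - 1 - p.2, a + n - 1 - p.1)) ?_ ?_
  · rintro ⟨i, j⟩ h
    simp only [Finset.coe_filter, Finset.mem_product, Finset.mem_range, Set.mem_ofPred_eq,
      mem_flipSet] at h ⊢
    have hai : ¬ i < a := fun h' => h.2.2.1 (ha (Finset.mem_range.mpr h'))
    have h3 : a + n - 1 - (a + n - 1 - i) = i := by omega
    have h4 : a + n - 1 - (a + n - 1 - j) = j := by omega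
    rw [h3, h4]
    refine ⟨⟨by omega, by omega⟩, by omega, ?_, by omega, .inr h.2.2.1⟩
    rintro ⟨-, h' | h'⟩
    · omega
    · exact h' h.2.2.2
  · rintro ⟨i, j⟩ h ⟨i', j'⟩ h' e
    simp only [Finset.coe_filter, Finset.mem_product, Finset.mem_range, Set.mem_ofPred_eq] at h h'
    simp only [Prod.mk.injEq] at e ⊢
    omega

lemma range_subset_flipSet {a n : ℕ} {J : Finset ℕ} (hJ : J ⊆ Finset.range n)
    (ha : Finset.range a ⊆ J) : Finset.range a ⊆ flipSet a n J := fun _ hj =>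
  mem_flipSet.mpr ⟨Finset.mem_range.mp (hJ (ha hj)), .inl (Finset.mem_range.mp hj)⟩

lemma cellDim_flipSet {a n : ℕ} {J : Finset ℕ} (hJ : J ⊆ Finset.range n)
    (ha : Finset.range a ⊆ J) : cellDim (flipSet a n J) = cellDim J := by
  refine le_antisymm ?_ (cellDim_flipSet_le hJ ha)
  have := cellDim_flipSet_le (J := flipSet a n J) (Finset.filter_subset _ _)
    (range_subset_flipSet hJ ha)
  rwa [flipSet_flipSet hJ ha] at this

lemma strip_eq_ones_iff {lam : Ptn} {J : Finset ℕ} {r : ℕ} (hJ : J ⊆ Finset.range lam.len)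
    (hr : lam.1 = r + J.card) :
    strip (Finset.range lam.len) lam.seq J = (onesPtn r).2.parts ↔
      ∀ j < lam.len, lam.seq j ≤ 1 + if j ∈ J then 1 else 0 := by
  have h1 := sum_strip (Finset.range lam.len) lam.seq hJ
    fun j hj => lam.seq_pos (Finset.mem_range.mp (hJ hj))
  rw [sum_seq, hr, Nat.add_right_cancel_iff] at h1
  have h2 : (onesPtn r).2.parts = Multiset.replicate r 1 := rfl
  rw [h2, Multiset.eq_replicate]
  have h3 : (∀ b ∈ strip (Finset.range lam.len) lam.seq J, b = 1) ↔
      ∀ j < lam.len, lam.seq j ≤ 1 + if j ∈ J then 1 else 0 := by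
    constructor
    · intro h j hj
      by_contra hlt
      have := h (lam.seq j - if j ∈ J then 1 else 0) (Multiset.mem_filter.mpr
        ⟨Multiset.mem_map_of_mem _ (Finset.mem_range.mpr hj), by omega⟩)
      omega
    · intro h b hb
      obtain ⟨hb, hb0⟩ := Multiset.mem_filter.mp hb
      obtain ⟨j, hj, rfl⟩ := Multiset.mem_map.mp hb
      have := h j (Finset.mem_range.mp hj)
      omega
  rw [← h3]
  refine ⟨fun h => h.2, fun h => ⟨?_, h⟩⟩
  rw [Multiset.eq_replicate_card.mpr h, Multiset.sum_replicate, smul_eq_mul, mul_one] at h1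
  exact h1

/-- The coefficients of `u_{(1^r)} u_{(1^s)}` and `u_{(1^s)} u_{(1^r)}` agree: for `λ = (2^a 1^b)`
both count subspaces of a `b`-dimensional space, of complementary dimensions. -/
lemma pieriPoly_ones_comm (r s : ℕ) (lam : Ptn) :
    pieriPoly (onesPtn r) s lam = pieriPoly (onesPtn s) r lam := by
  by_cases hsize : lam.1 = r + s
  swap
  · rw [pieriPoly_eq_zero hsize, pieriPoly_eq_zero (by rw [add_comm]; exact hsize)]
  set n := lam.len with hn
  by_cases h2 : ∀ j < n, lam.seq j ≤ 2
  -- Here `λ = (2^a 1^{n-a})`, and the sets `J` with `λ - 1_J = (1^r)` are those which contain the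
  -- first `a` indices; `flipSet` matches the ones with `r` and with `s` elements.
  · set a := ((Finset.range n).filter fun j => 2 ≤ lam.seq j).card with ha
    have hset : ((Finset.range n).filter fun j => 2 ≤ lam.seq j) = Finset.range a := by
      refine Finset.eq_of_subset_of_card_le (fun j hj => ?_) (by rw [Finset.card_range])
      rw [Finset.mem_filter, Finset.mem_range] at hj
      rw [Finset.mem_range, Nat.lt_iff_add_one_le, ← Finset.card_range (j + 1), ha]
      refine Finset.card_le_card fun i hi => ?_
      rw [Finset.mem_range] at hi
      rw [Finset.mem_filter, Finset.mem_range]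
      exact ⟨by omega, hj.2.trans (lam.seq_antitone (by omega))⟩
    have hval (j : ℕ) (hj : j < n) : lam.seq j = 1 + if j < a then 1 else 0 := by
      have h1 := h2 j hj
      have h3 := lam.seq_pos hj
      have h4 : j < a ↔ 2 ≤ lam.seq j := by
        rw [← Finset.mem_range, ← hset, Finset.mem_filter, Finset.mem_range]
        exact and_iff_right hj
      split_ifs with h <;> rw [h4] at h <;> omega
    have han : a ≤ n := by
      rw [← Finset.card_range a, ← Finset.card_range n, ← hset]
      exact Finset.card_le_card (Finset.filter_subset _ _)
    have hsum : n + a = r + s := by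
      rw [← hsize, ← sum_seq, ← hn,
        Finset.sum_congr rfl fun j hj => hval j (Finset.mem_range.mp hj),
        Finset.sum_add_distrib, ← Finset.card_filter]
      rw [show (Finset.range n).filter (· < a) = Finset.range a by
        ext j; simp only [Finset.mem_filter, Finset.mem_range]; omega]
      simp
    have key (r s : ℕ) (hrs : lam.1 = r + s) : pieriPoly (onesPtn r) s lam =
        ∑ J ∈ ((Finset.range n).powersetCard s).filter fun J => Finset.range a ⊆ J,
          Polynomial.X ^ cellDim J := by
      rw [pieriPoly]
      refine Finset.sum_congr (Finset.filter_congr fun J hJ => ?_) fun _ _ => rfl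
      rw [Finset.mem_powersetCard] at hJ
      rw [strip_eq_ones_iff hJ.1 (by rw [hJ.2, hrs])]
      constructor
      · intro h j hj
        rw [Finset.mem_range] at hj
        by_contra hjJ
        have h1 := h j (hj.trans_le han)
        rw [hval j (hj.trans_le han), if_pos hj, if_neg hjJ] at h1
        omega
      · intro h j hj
        rw [hval j hj]
        by_cases hja : j < a
        · rw [if_pos hja, if_pos (h (Finset.mem_range.mpr hja))]
        · rw [if_neg hja]; omega
    rw [key r s hsize, key s r (by rw [hsize, add_comm])]
    have hmem (r s : ℕ) (hrs : n + a = r + s) (J : Finset ℕ)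
        (hJ : J ∈ ((Finset.range n).powersetCard s).filter fun J => Finset.range a ⊆ J) :
        flipSet a n J ∈ ((Finset.range n).powersetCard r).filter fun J => Finset.range a ⊆ J := by
      rw [Finset.mem_filter, Finset.mem_powersetCard] at hJ ⊢
      have h1 := card_flipSet hJ.1.1 hJ.2
      exact ⟨⟨Finset.filter_subset _ _, by have := hJ.1.2; omega⟩,
        range_subset_flipSet hJ.1.1 hJ.2⟩
    refine Finset.sum_bij' (fun J _ => flipSet a n J) (fun J _ => flipSet a n J)
      (hmem r s hsum) (hmem s r (by omega)) ?_ ?_ ?_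
    · intro J hJ
      rw [Finset.mem_filter, Finset.mem_powersetCard] at hJ
      exact flipSet_flipSet hJ.1.1 hJ.2
    · intro J hJ
      rw [Finset.mem_filter, Finset.mem_powersetCard] at hJ
      exact flipSet_flipSet hJ.1.1 hJ.2
    · intro J hJ
      rw [Finset.mem_filter, Finset.mem_powersetCard] at hJ
      rw [cellDim_flipSet hJ.1.1 hJ.2]
  -- A part larger than `2` cannot become `1` when at most `1` is subtracted.
  · push Not at h2
    obtain ⟨j, hj, h2⟩ := h2
    have key (r s : ℕ) (hrs : lam.1 = r + s) : pieriPoly (onesPtn r) s lam = 0 := by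
      rw [pieriPoly, Finset.filter_eq_empty_iff.mpr, Finset.sum_empty]
      intro J hJ h
      rw [Finset.mem_powersetCard] at hJ
      rw [strip_eq_ones_iff hJ.1 (by rw [hJ.2, hrs])] at h
      have := h j hj
      split_ifs at this <;> omega
    rw [key r s hsize, key s r (by rw [hsize, add_comm])]

/-! ### Universal structure polynomials and rings with a Pieri basis -/

/-- Induction on partitions: to treat `λ ≠ ∅` of length `r` one may use `λ - (1^r)` and the
partitions of the same size which are longer than `λ`. -/
lemma Ptn.induction_pred {P : Ptn → Prop} (zero : P (onesPtn 0))
    (step : ∀ lam : Ptn, lam.1 ≠ 0 → P lam.pred →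
      (∀ kap : lam.1.Partition, lam.len < Ptn.len ⟨lam.1, kap⟩ → P ⟨lam.1, kap⟩) → P lam)
    (lam : Ptn) : P lam := by
  by_cases h : lam.1 = 0
  · rw [Ptn.eq_empty h]; exact zero
  · exact step lam h (induction_pred zero step lam.pred)
      fun kap _ => induction_pred zero step ⟨lam.1, kap⟩
termination_by (lam.1, lam.1 - lam.len)
decreasing_by
  · have := lam.pred_size
    have := Ptn.len_pos h
    exact Prod.Lex.left _ _ (by omega)
  · have := Ptn.len_le ⟨lam.1, kap⟩
    exact Prod.Lex.right _ (by simp only at this ⊢; omega)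

/-- The polynomial `g_{μν}^λ`, by the recursion which the expansion of `u_{ν - (1^r)} u_{(1^r)}`
yields, where `r` is the length of `ν`. -/
noncomputable def structPoly (nu mu lam : Ptn) : ℤ[X] :=
  open Classical in
  if h0 : nu.1 = 0 then if mu = lam then 1 else 0
  else ∑ kap : (mu.1 + nu.pred.1).Partition,
      structPoly nu.pred mu ⟨_, kap⟩ * pieriPoly ⟨_, kap⟩ nu.len lam -
    ∑ kap : nu.1.Partition, if h : nu.len < Ptn.len ⟨nu.1, kap⟩ then
      pieriPoly nu.pred nu.len ⟨nu.1, kap⟩ * structPoly ⟨nu.1, kap⟩ mu lam else 0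
termination_by (nu.1, nu.1 - nu.len)
decreasing_by
  · have := nu.pred_size
    have := Ptn.len_pos h0
    exact Prod.Lex.left _ _ (by omega)
  · have := Ptn.len_le ⟨nu.1, kap⟩
    exact Prod.Lex.right _ (by simp only at this ⊢; omega)

lemma structPoly_zero (mu lam : Ptn) [Decidable (mu = lam)] :
    structPoly (onesPtn 0) mu lam = if mu = lam then 1 else 0 := by
  rw [structPoly, dif_pos (show (onesPtn 0).1 = 0 from rfl)]
  congr

lemma structPoly_of_ne_zero {nu : Ptn} (h0 : nu.1 ≠ 0) (mu lam : Ptn) : structPoly nu mu lam =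
    ∑ kap : (mu.1 + nu.pred.1).Partition,
      structPoly nu.pred mu ⟨_, kap⟩ * pieriPoly ⟨_, kap⟩ nu.len lam -
    ∑ kap : nu.1.Partition, if nu.len < Ptn.len ⟨nu.1, kap⟩ then
      pieriPoly nu.pred nu.len ⟨nu.1, kap⟩ * structPoly ⟨nu.1, kap⟩ mu lam else 0 := by
  rw [structPoly, dif_neg h0]
  simp only [dite_eq_ite]

lemma structPoly_eq_zero (nu : Ptn) : ∀ mu lam : Ptn, lam.1 ≠ mu.1 + nu.1 →
    structPoly nu mu lam = 0 := by
  classical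
  induction nu using Ptn.induction_pred with
  | zero =>
    intro mu lam h
    rw [structPoly_zero, if_neg]
    rintro rfl
    exact h rfl
  | step nu h0 ih1 ih2 =>
    intro mu lam h
    rw [structPoly_of_ne_zero h0, Finset.sum_eq_zero, Finset.sum_eq_zero, sub_zero]
    · intro kap _
      split_ifs with hk
      · rw [ih2 kap hk mu lam h, mul_zero]
      · rfl
    · intro kap _
      rw [pieriPoly_eq_zero, mul_zero]
      have := nu.pred_size
      simp only
      omega

/-- A basis `(u_λ)` of a ring which is multiplied by the elements `u_{(1^r)}` in the way
the Pieri polynomials prescribe, evaluated at `q`. -/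
structure IsPieriBasis {A : Type*} [Ring A] (u : Module.Basis Ptn ℤ A) (q : ℤ) : Prop where
  one : u (onesPtn 0) = 1
  repr_mul : ∀ mu r lam, u.repr (u mu * u (onesPtn r)) lam = (pieriPoly mu r lam).eval q

lemma repr_sum_partition {A : Type*} [AddCommGroup A] (u : Module.Basis Ptn ℤ A) (n : ℕ)
    (c : Ptn → ℤ) (lam : Ptn) :
    u.repr (∑ kap : n.Partition, c ⟨n, kap⟩ • u ⟨n, kap⟩) lam =
      if lam.1 = n then c lam else 0 := by
  rw [map_sum, Finsupp.finsetSum_apply]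
  simp only [map_smul, Module.Basis.repr_self, Finsupp.smul_single, smul_eq_mul, mul_one]
  split_ifs with hl
  · obtain ⟨m, lam⟩ := lam
    obtain rfl : m = n := hl
    rw [Finset.sum_eq_single lam]
    · rw [Finsupp.single_eq_same]
    · intro kap _ hk
      exact Finsupp.single_eq_of_ne fun e => hk (eq_of_heq (Sigma.mk.inj e).2).symm
    · exact fun h => absurd (Finset.mem_univ _) h
  · exact Finset.sum_eq_zero fun kap _ => Finsupp.single_eq_of_ne fun e => hl (by rw [e])

lemma basis_eq_sum {A : Type*} [AddCommGroup A] (u : Module.Basis Ptn ℤ A) (x : A) (n : ℕ)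
    (h : ∀ lam : Ptn, lam.1 ≠ n → u.repr x lam = 0) :
    x = ∑ kap : n.Partition, u.repr x ⟨n, kap⟩ • u ⟨n, kap⟩ := by
  apply u.repr.injective
  ext lam
  rw [repr_sum_partition u n (u.repr x)]
  split_ifs with hl
  · rfl
  · exact h lam hl

namespace IsPieriBasis

section Ring

variable {A : Type*} [Ring A] {u : Module.Basis Ptn ℤ A} {q : ℤ}

lemma mul_ones (h : IsPieriBasis u q) (mu : Ptn) (r n : ℕ) (hn : mu.1 + r = n) :
    u mu * u (onesPtn r) =
      ∑ kap : n.Partition, (pieriPoly mu r ⟨_, kap⟩).eval q • u ⟨n, kap⟩ := by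
  rw [basis_eq_sum u (u mu * u (onesPtn r)) n]
  · exact Finset.sum_congr rfl fun kap _ => by rw [h.repr_mul]
  · intro lam hl
    rw [h.repr_mul, pieriPoly_eq_zero (by rwa [hn]), Polynomial.eval_zero]

/-- The triangularity which drives all inductions: up to partitions longer than `λ`, the element
`u_λ` is the product of `u_{λ - (1^r)}` and `u_{(1^r)}`, where `r` is the length of `λ`. -/
lemma eq_pred_mul_ones_sub (h : IsPieriBasis u q) (lam : Ptn) :
    u lam = u lam.pred * u (onesPtn lam.len) -
      ∑ kap : lam.1.Partition, if lam.len < Ptn.len ⟨lam.1, kap⟩ then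
        (pieriPoly lam.pred lam.len ⟨_, kap⟩).eval q • u ⟨lam.1, kap⟩ else 0 := by
  classical
  rw [eq_sub_iff_add_eq, h.mul_ones _ _ _ lam.pred_size]
  have h1 : u lam = ∑ kap : lam.1.Partition, if lam.2 = kap then u ⟨lam.1, kap⟩ else 0 := by
    rw [Finset.sum_ite_eq]; simp
  rw [h1, ← Finset.sum_add_distrib]
  refine Finset.sum_congr rfl fun kap _ => ?_
  rcases lt_trichotomy lam.len (Ptn.len ⟨lam.1, kap⟩) with hl | hl | hl
  · rw [if_neg, if_pos hl, zero_add]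
    rintro rfl
    exact lt_irrefl _ hl
  · rw [if_neg hl.not_lt, add_zero]
    by_cases hk : lam.2 = kap
    · subst hk
      rw [if_pos rfl, pieriPoly_len, if_pos rfl, Polynomial.eval_one, one_smul]
    · rw [if_neg hk, hl, pieriPoly_len, if_neg, Polynomial.eval_zero, zero_smul]
      intro e
      have := Ptn.eq_of_pred_eq e hl.symm
      exact hk (eq_of_heq (Sigma.mk.inj this).2).symm
  · rw [if_neg hl.not_gt, add_zero, pieriPoly_eq_zero_of_len_lt hl, Polynomial.eval_zero,
      zero_smul, if_neg]
    rintro rfl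
    exact lt_irrefl _ hl

/-- The structure constants of a ring with a Pieri basis are the values of the universal
polynomials. -/
theorem repr_mul_eq_eval_structPoly (h : IsPieriBasis u q) (nu : Ptn) : ∀ mu lam : Ptn,
    u.repr (u mu * u nu) lam = (structPoly nu mu lam).eval q := by
  classical
  induction nu using Ptn.induction_pred with
  | zero =>
    intro mu lam
    rw [h.one, mul_one, structPoly_zero, u.repr_self, Finsupp.single_apply]
    split_ifs <;> simp
  | step nu h0 ih1 ih2 =>
    intro mu lam
    rw [h.eq_pred_mul_ones_sub nu, structPoly_of_ne_zero h0, mul_sub, ← mul_assoc,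
      basis_eq_sum u (u mu * u nu.pred) (mu.1 + nu.pred.1)]
    · rw [Finset.sum_mul, Finset.mul_sum, map_sub, map_sum, map_sum, Finsupp.sub_apply,
        Finsupp.finsetSum_apply, Finsupp.finsetSum_apply, Polynomial.eval_sub,
        Polynomial.eval_finsetSum, Polynomial.eval_finsetSum]
      congr 1
      · refine Finset.sum_congr rfl fun kap _ => ?_
        rw [smul_mul_assoc, map_smul, Finsupp.smul_apply, h.repr_mul, ih1, Polynomial.eval_mul,
          smul_eq_mul]
      · refine Finset.sum_congr rfl fun kap _ => ?_
        split_ifs with hk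
        · rw [mul_smul_comm, map_smul, Finsupp.smul_apply, ih2 kap hk, Polynomial.eval_mul,
            smul_eq_mul]
        · rw [mul_zero, map_zero, Finsupp.zero_apply, Polynomial.eval_zero]
    · intro lam hl
      rw [ih1, structPoly_eq_zero _ _ _ hl, Polynomial.eval_zero]

theorem adjoin_eq_top (h : IsPieriBasis u q) :
    Algebra.adjoin ℤ (Set.range fun r : ℕ+ => u (onesPtn r)) = ⊤ := by
  have key (lam : Ptn) : u lam ∈ Algebra.adjoin ℤ (Set.range fun r : ℕ+ => u (onesPtn r)) := by
    induction lam using Ptn.induction_pred with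
    | zero => rw [h.one]; exact one_mem _
    | step lam h0 ih1 ih2 =>
      rw [h.eq_pred_mul_ones_sub lam]
      refine sub_mem (mul_mem ih1 (Algebra.subset_adjoin ⟨⟨lam.len, Ptn.len_pos h0⟩, rfl⟩))
        (sum_mem fun kap _ => ?_)
      split_ifs with hk
      · exact Subalgebra.smul_mem _ (ih2 kap hk) _
      · exact zero_mem _
  rw [← Algebra.toSubmodule_eq_top, eq_top_iff, ← u.span_eq, Submodule.span_le]
  rintro _ ⟨lam, rfl⟩
  exact key lam

lemma ones_mul_comm (h : IsPieriBasis u q) (r s : ℕ) :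
    u (onesPtn r) * u (onesPtn s) = u (onesPtn s) * u (onesPtn r) := by
  rw [h.mul_ones (onesPtn r) s (r + s) rfl, h.mul_ones (onesPtn s) r (r + s) (add_comm _ _)]
  exact Finset.sum_congr rfl fun kap _ => by rw [pieriPoly_ones_comm]

theorem mul_comm (h : IsPieriBasis u q) (x y : A) : x * y = y * x := by
  have hx : x ∈ Algebra.adjoin ℤ (Set.range fun r : ℕ+ => u (onesPtn r)) := by
    rw [h.adjoin_eq_top]; trivial
  have hy : y ∈ Algebra.adjoin ℤ (Set.range fun r : ℕ+ => u (onesPtn r)) := by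
    rw [h.adjoin_eq_top]; trivial
  refine Algebra.commute_of_mem_adjoin_of_forall_mem_commute hy ?_
  rintro _ ⟨r, rfl⟩
  refine (Algebra.commute_of_mem_adjoin_of_forall_mem_commute hx ?_).symm
  rintro _ ⟨s, rfl⟩
  exact h.ones_mul_comm r s

end Ring

section CommRing

variable {A : Type*} [CommRing A] {u : Module.Basis Ptn ℤ A} {q : ℤ}

/-- The products of the `u_{(1^r)}` of weight `|λ|` generate a subgroup which contains `u_λ`. -/
lemma mem_span_prod_ones (h : IsPieriBasis u q) (lam : Ptn) :
    u lam ∈ Submodule.span ℤ ((fun kap : Ptn => (kap.2.parts.map fun r => u (onesPtn r)).prod) ''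
      {kap | kap.1 = lam.1}) := by
  induction lam using Ptn.induction_pred with
  | zero =>
    refine Submodule.subset_span ⟨onesPtn 0, rfl, ?_⟩
    rw [h.one]
    simp [onesPtn]
  | step lam h0 ih1 ih2 =>
    rw [h.eq_pred_mul_ones_sub lam]
    refine sub_mem ?_ (sum_mem fun kap _ => ?_)
    · refine Submodule.span_induction (p := fun x _ => x * u (onesPtn lam.len) ∈ _)
        ?_ (by rw [zero_mul]; exact zero_mem _) (fun x y _ _ hx hy => ?_) (fun a x _ hx => ?_) ih1
      · rintro _ ⟨kap, hk, rfl⟩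
        have hk : kap.1 = lam.pred.1 := hk
        have h1 : (Ptn.ofMultiset (lam.len ::ₘ kap.2.parts)).2.parts =
            lam.len ::ₘ kap.2.parts := by
          rw [Ptn.ofMultiset_parts, Multiset.filter_cons_of_pos (p := (· ≠ 0)) _
            (Ptn.len_pos h0).ne', kap.parts_filter]
        refine Submodule.subset_span ⟨Ptn.ofMultiset (lam.len ::ₘ kap.2.parts), ?_, ?_⟩
        · change (lam.len ::ₘ kap.2.parts).sum = lam.1
          rw [Multiset.sum_cons, kap.2.parts_sum, hk, ← lam.pred_size, add_comm]
        · simp only [h1, Multiset.map_cons, Multiset.prod_cons]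
          exact _root_.mul_comm _ _
      · rw [add_mul]; exact add_mem hx hy
      · rw [smul_mul_assoc]; exact Submodule.smul_mem _ _ hx
    · split_ifs with hk
      · exact Submodule.smul_mem _ _ (ih2 kap hk)
      · exact zero_mem _

/-- The products of the elements `u_{(1^r)}` of weight at most `n` span a free module of rank the
number of partitions of size at most `n`, and there are as many of them, so they are independent. -/
lemma linearIndependent_prod_ones (h : IsPieriBasis u q) : LinearIndependent ℤ
    fun kap : Ptn => (kap.2.parts.map fun r => u (onesPtn r)).prod := by
  set v := fun kap : Ptn => (kap.2.parts.map fun r => u (onesPtn r)).prod with hv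
  have key (n : ℕ) : LinearIndepOn ℤ v {kap : Ptn | kap.1 ≤ n} := by
    let ι := {kap : Ptn // kap.1 ≤ n}
    have : Finite ι := by
      refine Finite.of_injective
        (fun kap : ι => (⟨⟨kap.1.1, Nat.lt_succ_of_le kap.2⟩, kap.1.2⟩ :
          Σ m : Fin (n + 1), (m : ℕ).Partition)) fun kap kap' e => ?_
      obtain ⟨⟨m, kap⟩, hk⟩ := kap
      obtain ⟨⟨m', kap'⟩, hk'⟩ := kap'
      simp only [Sigma.mk.injEq, Fin.mk.injEq] at e
      obtain ⟨rfl, e⟩ := e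
      rw [eq_of_heq e]
    let f : (ι →₀ ℤ) →ₗ[ℤ] A := Finsupp.linearCombination ℤ fun kap : ι => v kap
    let g : A →ₗ[ℤ] (ι →₀ ℤ) :=
      (Finsupp.lcomapDomain (Subtype.val : ι → Ptn) Subtype.val_injective) ∘ₗ u.repr.toLinearMap
    -- `g` reads off the coordinates at the `u_λ` with `|λ| ≤ n`, and these `u_λ` lie in the image
    -- of `f`.
    have hsurj : Function.Surjective (g ∘ₗ f) := by
      rw [← LinearMap.range_eq_top, eq_top_iff, ← Finsupp.basisSingleOne.span_eq,
        Submodule.span_le]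
      rintro _ ⟨lam, rfl⟩
      have h1 : u lam.1 ∈ LinearMap.range f := by
        rw [Finsupp.range_linearCombination]
        refine Submodule.span_mono ?_ (h.mem_span_prod_ones lam.1)
        rintro _ ⟨kap, hk, rfl⟩
        have hk : kap.1 = lam.1.1 := hk
        exact ⟨⟨kap, by rw [hk]; exact lam.2⟩, rfl⟩
      obtain ⟨x, hx⟩ := h1
      refine ⟨x, ?_⟩
      rw [LinearMap.comp_apply, hx]
      ext kap
      simp only [g, LinearMap.comp_apply, LinearEquiv.coe_coe, u.repr_self,
        Finsupp.coe_basisSingleOne]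
      change Finsupp.single lam.1 (1 : ℤ) kap.1 = _
      exact Finsupp.single_apply_left Subtype.val_injective _ _ _
    have hinj := OrzechProperty.injective_of_surjective_endomorphism _ hsurj
    rw [LinearMap.coe_comp] at hinj
    exact hinj.of_comp
  rw [linearIndependent_iff]
  intro x hx
  obtain ⟨n, hn⟩ : ∃ n, ∀ kap ∈ x.support, kap.1 ≤ n :=
    ⟨x.support.sup Sigma.fst, fun kap hk => Finset.le_sup (f := Sigma.fst) hk⟩
  exact (linearIndepOn_iff.mp (key n)) x (by
    rw [Finsupp.mem_supported]; exact fun kap hk => hn kap hk) hx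

theorem algebraicIndependent (h : IsPieriBasis u q) :
    AlgebraicIndependent ℤ (fun r : ℕ+ => u (onesPtn r)) := by
  let φ : (ℕ+ →₀ ℕ) → Ptn := fun a => Ptn.ofMultiset (a.toMultiset.map (fun r : ℕ+ => (r : ℕ)))
  have hφ (a : ℕ+ →₀ ℕ) : (φ a).2.parts = a.toMultiset.map (fun r : ℕ+ => (r : ℕ)) := by
    rw [Ptn.ofMultiset_parts, Multiset.filter_eq_self]
    intro r hr
    obtain ⟨s, -, rfl⟩ := Multiset.mem_map.mp hr
    exact s.ne_zero
  have hinj : Function.Injective φ := by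
    intro a b hab
    have h1 := congrArg (fun k : Ptn => k.2.parts) hab
    simp only [hφ] at h1
    rw [← a.toMultiset_toFinsupp, Multiset.map_injective PNat.coe_injective h1,
      b.toMultiset_toFinsupp]
  have h1 := h.linearIndependent_prod_ones.comp φ hinj
  rw [algebraicIndependent_iff_injective_aeval]
  have h2 : (MvPolynomial.aeval (fun r : ℕ+ => u (onesPtn r)) :
      MvPolynomial ℕ+ ℤ →ₐ[ℤ] A).toLinearMap =
      (Finsupp.linearCombination ℤ ((fun kap : Ptn =>
        (kap.2.parts.map fun r => u (onesPtn r)).prod) ∘ φ)) ∘ₗ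
        (MvPolynomial.basisMonomials ℕ+ ℤ).repr.toLinearMap := by
    refine (MvPolynomial.basisMonomials ℕ+ ℤ).ext fun a => ?_
    rw [LinearMap.comp_apply, LinearEquiv.coe_coe, Module.Basis.repr_self,
      Finsupp.linearCombination_single, one_smul, MvPolynomial.coe_basisMonomials,
      AlgHom.toLinearMap_apply, MvPolynomial.aeval_monomial, map_one, one_mul,
      Function.comp_apply, hφ, Multiset.map_map, Finset.prod_multiset_map_count,
      a.toFinset_toMultiset]
    exact Finset.prod_congr rfl fun r _ => by rw [a.count_toMultiset]; rfl
  rw [← AlgHom.coe_toLinearMap, h2, LinearMap.coe_comp]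
  exact Function.Injective.comp h1 (LinearEquiv.injective _)

lemma bijective_aeval (h : IsPieriBasis u q) :
    Function.Bijective (MvPolynomial.aeval (R := ℤ) fun r : ℕ+ => u (onesPtn r)) := by
  refine ⟨h.algebraicIndependent, ?_⟩
  rw [← AlgHom.range_eq_top, ← Algebra.adjoin_range_eq_range_aeval, h.adjoin_eq_top]

end CommRing

/-- Two commutative rings with Pieri bases are polynomial rings in the elements `u_{(1^r)}`, for
`r > 0`, hence isomorphic. -/
theorem existsUnique_algEquiv {A B : Type*} [CommRing A] [CommRing B] {u : Module.Basis Ptn ℤ A}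
    {v : Module.Basis Ptn ℤ B} {q q' : ℤ} (hu : IsPieriBasis u q) (hv : IsPieriBasis v q') :
    ∃! ψ : A ≃ₐ[ℤ] B, ∀ r : ℕ+, ψ (u (onesPtn r)) = v (onesPtn r) := by
  let e := AlgEquiv.ofBijective _ hu.bijective_aeval
  let f := AlgEquiv.ofBijective _ hv.bijective_aeval
  have he (r : ℕ+) : e (MvPolynomial.X r) = u (onesPtn r) := MvPolynomial.aeval_X _ r
  have hf (r : ℕ+) : f (MvPolynomial.X r) = v (onesPtn r) := MvPolynomial.aeval_X _ r
  refine ⟨e.symm.trans f, fun r => ?_, fun ψ hψ => ?_⟩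
  · rw [← he, AlgEquiv.trans_apply, AlgEquiv.symm_apply_apply, hf]
  · have h1 : (ψ : A →ₐ[ℤ] B) = (e.symm.trans f : A ≃ₐ[ℤ] B) := by
      refine AlgHom.ext_of_adjoin_eq_top hu.adjoin_eq_top ?_
      rintro _ ⟨r, rfl⟩
      change ψ (u (onesPtn r)) = f (e.symm (u (onesPtn r)))
      rw [hψ, ← he, AlgEquiv.symm_apply_apply, hf]
    exact AlgEquiv.ext fun x => DFunLike.congr_fun h1 x

end IsPieriBasis

/-! ### Finite modules over a discrete valuation ring: classification -/

/-- The submodule `a M` of `M`. -/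
def smulRange {R : Type*} [CommRing R] (M : Type*) [AddCommGroup M] [Module R M] (a : R) :
    Submodule R M := LinearMap.range (LinearMap.lsmul R M a)

section smulRange

variable {R : Type*} [CommRing R] {M N : Type*} [AddCommGroup M] [Module R M] [AddCommGroup N]
  [Module R N]

lemma mem_smulRange {a : R} {x : M} : x ∈ smulRange M a ↔ ∃ y, a • y = x := Iff.rfl

lemma card_smulRange_congr (e : M ≃ₗ[R] N) (a : R) :
    Nat.card (smulRange M a) = Nat.card (smulRange N a) := by
  refine Nat.card_congr (e.toEquiv.subtypeEquiv fun x => ?_)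
  rw [mem_smulRange, mem_smulRange]
  exact ⟨fun ⟨y, hy⟩ => ⟨e y, by rw [← map_smul, hy]; rfl⟩,
    fun ⟨y, hy⟩ => ⟨e.symm y, by rw [← map_smul, hy]; exact e.symm_apply_apply x⟩⟩

lemma card_smulRange_pi {ι : Type*} [Fintype ι] (M : ι → Type*) [∀ i, AddCommGroup (M i)]
    [∀ i, Module R (M i)] (a : R) :
    Nat.card (smulRange (∀ i, M i) a) = ∏ i, Nat.card (smulRange (M i) a) := by
  rw [← Nat.card_pi]
  refine Nat.card_congr ⟨fun x i => ⟨x.1 i, ?_⟩, fun x => ⟨fun i => (x i).1, ?_⟩, ?_, ?_⟩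
  · obtain ⟨y, hy⟩ := mem_smulRange.mp x.2
    exact mem_smulRange.mpr ⟨y i, by rw [← hy]; rfl⟩
  · choose y hy using fun i => mem_smulRange.mp (x i).2
    exact mem_smulRange.mpr ⟨y, funext hy⟩
  · exact fun _ => rfl
  · exact fun _ => rfl

/-- The length formula for the image of a submodule `N` in the quotient `M/A`. -/
lemma card_map_mkQ_mul (A N : Submodule R M) :
    Nat.card (N.map A.mkQ) * Nat.card (A ⊓ N : Submodule R M) = Nat.card N := by
  have h := Submodule.card_eq_card_quotient_mul_card (LinearMap.ker (A.mkQ.domRestrict N))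
  rw [h]
  have h1 : N.map A.mkQ = LinearMap.range (A.mkQ.domRestrict N) :=
    (LinearMap.range_domRestrict N A.mkQ).symm
  rw [h1, Nat.card_congr (A.mkQ.domRestrict N).quotKerEquivRange.toEquiv]
  rw [mul_comm]
  congr 1
  refine Nat.card_congr ⟨fun x => ⟨⟨x.1, x.2.2⟩, ?_⟩, fun x => ⟨x.1.1, ?_, x.1.2⟩, ?_, ?_⟩
  · rw [LinearMap.mem_ker]
    exact (Submodule.Quotient.mk_eq_zero A).mpr x.2.1
  · exact (Submodule.Quotient.mk_eq_zero A).mp (LinearMap.mem_ker.mp x.2)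
  · exact fun _ => rfl
  · exact fun _ => rfl

lemma smulRange_quotient (A : Submodule R M) (a : R) :
    smulRange (M ⧸ A) a = (smulRange M a).map A.mkQ := by
  ext x
  constructor
  · rintro ⟨y, rfl⟩
    obtain ⟨y, rfl⟩ := A.mkQ_surjective y
    exact ⟨a • y, ⟨y, rfl⟩, map_smul _ _ _⟩
  · rintro ⟨_, ⟨y, rfl⟩, rfl⟩
    exact ⟨A.mkQ y, (map_smul A.mkQ a y).symm⟩

end smulRange

section DVR

open IsLocalRing

variable {R : Type u} [CommRing R] [IsDomain R] [IsDiscreteValuationRing R]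

lemma card_quotient_maximalIdeal_pow (n : ℕ) :
    Nat.card (R ⧸ maximalIdeal R ^ n) = Nat.card (ResidueField R) ^ n := by
  have h := cardQuot_pow_of_prime (P := maximalIdeal R) (i := n)
    (IsDiscreteValuationRing.not_a_field R)
  rw [Submodule.cardQuot_apply, Submodule.cardQuot_apply] at h
  exact h

lemma maximalIdeal_pow_eq {p : R} (hp : Irreducible p) (n : ℕ) :
    maximalIdeal R ^ n = Ideal.span {p ^ n} := by
  rw [hp.maximalIdeal_eq, Ideal.span_singleton_pow]

lemma pow_smul_quotient_eq_zero {p : R} (hp : Irreducible p) {k i : ℕ} (h : k ≤ i)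
    (x : R ⧸ maximalIdeal R ^ k) : p ^ i • x = 0 := by
  obtain ⟨b, rfl⟩ := Ideal.Quotient.mk_surjective x
  change Ideal.Quotient.mk _ (p ^ i * b) = 0
  rw [Ideal.Quotient.eq_zero_iff_mem, maximalIdeal_pow_eq hp, Ideal.mem_span_singleton]
  exact (pow_dvd_pow p h).mul_right b

lemma card_smulRange_quotient_pow {p : R} (hp : Irreducible p) (k i : ℕ) :
    Nat.card (smulRange (R ⧸ maximalIdeal R ^ k) (p ^ i)) =
      Nat.card (ResidueField R) ^ (k - i) := by
  rcases le_total k i with h | h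
  · have h0 : smulRange (R ⧸ maximalIdeal R ^ k) (p ^ i) = ⊥ := by
      rw [eq_bot_iff]
      rintro _ ⟨x, rfl⟩
      exact (Submodule.mem_bot R).mpr (pow_smul_quotient_eq_zero hp h x)
    rw [h0, Nat.sub_eq_zero_of_le h, pow_zero]
    exact Nat.card_unique
  · rw [← card_quotient_maximalIdeal_pow]
    let f : R →ₗ[R] R ⧸ maximalIdeal R ^ k :=
      (Submodule.mkQ (maximalIdeal R ^ k)).comp (LinearMap.lsmul R R (p ^ i))
    have hker : LinearMap.ker f = maximalIdeal R ^ (k - i) := by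
      ext x
      rw [LinearMap.mem_ker]
      change Ideal.Quotient.mk _ (p ^ i * x) = 0 ↔ _
      rw [Ideal.Quotient.eq_zero_iff_mem, maximalIdeal_pow_eq hp, maximalIdeal_pow_eq hp,
        Ideal.mem_span_singleton, Ideal.mem_span_singleton]
      conv_lhs => rw [← Nat.add_sub_cancel' h, pow_add]
      exact mul_dvd_mul_iff_left (pow_ne_zero _ hp.ne_zero)
    have hran : LinearMap.range f = smulRange (R ⧸ maximalIdeal R ^ k) (p ^ i) := by
      ext x
      constructor
      · rintro ⟨y, rfl⟩
        exact ⟨Submodule.mkQ _ y, (map_smul (Submodule.mkQ _) (p ^ i) y).symm⟩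
      · rintro ⟨y, rfl⟩
        obtain ⟨y, rfl⟩ := Submodule.mkQ_surjective _ y
        exact ⟨y, map_smul (Submodule.mkQ _) (p ^ i) y⟩
    rw [← hran, ← hker]
    exact (Nat.card_congr f.quotKerEquivRange.toEquiv).symm

lemma card_smulRange_pi_quotient {p : R} (hp : Irreducible p) {ι : Type*} [Fintype ι]
    (f : ι → ℕ) (i : ℕ) :
    Nat.card (smulRange (∀ j : ι, R ⧸ maximalIdeal R ^ f j) (p ^ i)) =
      Nat.card (ResidueField R) ^ excess (Finset.univ.val.map f) i := by
  rw [card_smulRange_pi, excess, Multiset.map_map]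
  simp only [card_smulRange_quotient_pow hp]
  exact Finset.prod_pow_eq_pow_sum _ _ _

variable [Finite (ResidueField R)]

lemma one_lt_card_residueField : 1 < Nat.card (ResidueField R) := Finite.one_lt_card

/-- The module `⨁_j R/𝔪^{f j}` of a finite family `f` of natural numbers is the module of type `λ`,
where the parts of `λ` are the nonzero members of `f`. -/
lemma exists_ofPtn_equiv_pi {ι : Type*} [Fintype ι] (f : ι → ℕ) (lam : Ptn)
    (h : ((Finset.univ : Finset ι).val.map f).filter (· ≠ 0) = lam.2.parts) :
    Nonempty ((FinMod.ofPtn R lam).carrier ≃ₗ[R] ∀ j : ι, R ⧸ maximalIdeal R ^ f j) := by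
  classical
  have h1 : (Finset.univ : Finset lam.2.parts).val.map (fun j : lam.2.parts => (j : ℕ)) =
      (Finset.univ : Finset {j : ι // f j ≠ 0}).val.map
        (fun j : {j : ι // f j ≠ 0} => f j.1) := by
    refine (Multiset.map_univ_coe lam.2.parts).trans ?_
    rw [← h, Multiset.filter_map]
    change _ = (Finset.univ : Finset {j : ι // f j ≠ 0}).val.map (f ∘ Subtype.val)
    rw [← Multiset.map_map]
    congr 1
    have := Finset.univ.subtype_map (fun j : ι => f j ≠ 0)
    rw [Finset.subtype_univ] at this
    exact (congrArg Finset.val this).symm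
  obtain ⟨e, he⟩ := exists_equiv_of_map_eq _ _ h1
  have e1 : (∀ j : lam.2.parts, R ⧸ maximalIdeal R ^ (j : ℕ)) ≃ₗ[R]
      ∀ j : {j : ι // f j ≠ 0}, R ⧸ maximalIdeal R ^ f j :=
    (LinearEquiv.piCongrRight fun j => Submodule.quotEquivOfEq _ _ (by rw [← he])).trans
      (LinearEquiv.piCongrLeft R (fun j : {j : ι // f j ≠ 0} => R ⧸ maximalIdeal R ^ f j) e)
  let res : (∀ j : ι, R ⧸ maximalIdeal R ^ f j) →ₗ[R]
      ∀ j : {j : ι // f j ≠ 0}, R ⧸ maximalIdeal R ^ f j :=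
    LinearMap.pi fun j => LinearMap.proj j.1
  refine ⟨e1.trans (LinearEquiv.ofBijective res ⟨fun x y hxy => funext fun j => ?_,
    fun y => ⟨fun j => if h : f j ≠ 0 then y ⟨j, h⟩ else 0, funext fun j => dif_pos j.2⟩⟩).symm⟩
  by_cases hj : f j = 0
  · have : Subsingleton (R ⧸ maximalIdeal R ^ f j) := by
      rw [hj, pow_zero, Ideal.one_eq_top]
      exact Submodule.Quotient.subsingleton_iff.mpr rfl
    exact Subsingleton.elim _ _
  · exact congrFun hxy ⟨j, hj⟩

lemma exists_ofPtn_equiv (M : Type u) [AddCommGroup M] [Module R M] [Finite M] :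
    ∃ lam : Ptn, Nonempty ((FinMod.ofPtn R lam).carrier ≃ₗ[R] M) := by
  obtain ⟨p, hp⟩ := IsDiscreteValuationRing.exists_irreducible R
  have htor : Module.IsTorsion R M := by
    intro x
    refine ⟨⟨p ^ Nat.card M, mem_nonZeroDivisors_of_ne_zero (pow_ne_zero _ hp.ne_zero)⟩, ?_⟩
    refine FinMod.pow_smul_eq_zero x _ ?_
    rw [maximalIdeal_pow_eq hp]
    exact Ideal.mem_span_singleton_self _
  classical
  obtain ⟨ι, _, p', hp', e, ⟨E⟩⟩ := Module.equiv_directSum_of_isTorsion htor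
  have h1 (i : ι) : R ∙ p' i ^ e i = maximalIdeal R ^ e i := (maximalIdeal_pow_eq (hp' i) _).symm
  obtain ⟨E'⟩ := exists_ofPtn_equiv_pi (R := R) e
    (Ptn.ofMultiset ((Finset.univ : Finset ι).val.map e)) rfl
  exact ⟨_, ⟨E'.trans ((LinearEquiv.piCongrRight fun i =>
    Submodule.quotEquivOfEq _ _ (h1 i).symm).trans
    ((DirectSum.linearEquivFunOnFintype R ι _).symm.trans E.symm))⟩⟩

lemma card_smulRange_ofPtn {p : R} (hp : Irreducible p) (lam : Ptn) (i : ℕ) :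
    Nat.card (smulRange (FinMod.ofPtn R lam).carrier (p ^ i)) =
      Nat.card (ResidueField R) ^ excess lam.2.parts i := by
  have h := card_smulRange_pi_quotient hp (fun j : lam.2.parts => (j : ℕ)) i
  rw [Multiset.map_univ_coe] at h
  exact h

/-- A finite module is of type `λ` if and only if `𝔪^i M` has length `∑_j (λ_j - i)^+`
for all `i`. -/
lemma cls_eq_ofPtn_iff {p : R} (hp : Irreducible p) (M : FinMod R) (lam : Ptn) :
    (FinMod.system R).cls M = (FinMod.system R).cls (FinMod.ofPtn R lam) ↔
      ∀ i, Nat.card (smulRange M.carrier (p ^ i)) =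
        Nat.card (ResidueField R) ^ excess lam.2.parts i := by
  constructor
  · intro h i
    obtain ⟨e⟩ : Nonempty (M.carrier ≃ₗ[R] (FinMod.ofPtn R lam).carrier) := Quotient.exact h
    rw [card_smulRange_congr e, card_smulRange_ofPtn hp]
  · intro h
    obtain ⟨mu, ⟨e⟩⟩ := exists_ofPtn_equiv (R := R) M.carrier
    have : mu = lam := by
      refine Ptn.excess_injective fun i => Nat.pow_right_injective
        (one_lt_card_residueField (R := R)) ?_
      simp only
      rw [← h i, ← card_smulRange_congr e, card_smulRange_ofPtn hp]
    subst this
    exact Quotient.sound ⟨e.symm⟩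

lemma bijective_cls_ofPtn :
    Function.Bijective fun lam : Ptn => (FinMod.system R).cls (FinMod.ofPtn R lam) := by
  obtain ⟨p, hp⟩ := IsDiscreteValuationRing.exists_irreducible R
  constructor
  · intro lam mu h
    refine Ptn.excess_injective fun i => Nat.pow_right_injective
      (one_lt_card_residueField (R := R)) ?_
    simp only
    rw [← card_smulRange_ofPtn hp, ← (cls_eq_ofPtn_iff hp _ mu).mp h i]
  · intro c
    induction c using Quotient.inductionOn with | _ M => ?_
    change FinMod R at M
    obtain ⟨mu, e⟩ := exists_ofPtn_equiv (R := R) M.carrier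
    exact ⟨mu, Quotient.sound e⟩

end DVR

/-! ### Counting submodules of the socle by their position relative to a flag -/

section Flag

open IsLocalRing

variable {R : Type*} [CommRing R] {M : Type*} [AddCommGroup M] [Module R M]

open Classical in
/-- The indices at which the intersections of a submodule with the members of a flag grow. -/
noncomputable def jumps (F : ℕ → Submodule R M) (A : Submodule R M) (n : ℕ) : Finset ℕ :=
  (Finset.range n).filter fun i => ¬ A ⊓ F (i + 1) ≤ F i

lemma jumps_subset (F : ℕ → Submodule R M) (A : Submodule R M) (n : ℕ) :
    jumps F A n ⊆ Finset.range n := by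
  classical
  exact Finset.filter_subset _ _

lemma jumps_succ_of_le {F : ℕ → Submodule R M} {A : Submodule R M} {n : ℕ}
    (h : A ⊓ F (n + 1) ≤ F n) : jumps F A (n + 1) = jumps F A n := by
  classical
  rw [jumps, Finset.range_add_one, Finset.filter_insert, if_neg (not_not.mpr h)]
  rfl

lemma jumps_succ_of_not_le {F : ℕ → Submodule R M} {A : Submodule R M} {n : ℕ}
    (h : ¬ A ⊓ F (n + 1) ≤ F n) : jumps F A (n + 1) = insert n (jumps F A n) := by
  classical
  rw [jumps, Finset.range_add_one, Finset.filter_insert, if_pos h, jumps]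

lemma mem_jumps {F : ℕ → Submodule R M} {A : Submodule R M} {n i : ℕ} :
    i ∈ jumps F A n ↔ i < n ∧ ¬ A ⊓ F (i + 1) ≤ F i := by
  classical
  rw [jumps, Finset.mem_filter, Finset.mem_range]

lemma notMem_jumps (F : ℕ → Submodule R M) (A : Submodule R M) (n : ℕ) : n ∉ jumps F A n :=
  fun h => lt_irrefl n (Finset.mem_range.mp (jumps_subset _ _ _ h))

lemma jumps_filter_lt (F : ℕ → Submodule R M) (A : Submodule R M) {m n : ℕ} (h : m ≤ n) :
    (jumps F A n).filter (· < m) = jumps F A m := by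
  ext i
  rw [Finset.mem_filter, mem_jumps, mem_jumps]
  exact ⟨fun h => ⟨h.2, h.1.2⟩, fun h' => ⟨⟨h'.1.trans_le h, h'.2⟩, h'.1⟩⟩

variable [IsLocalRing R]

/-- A complete flag `0 = F 0 < F 1 < ⋯ < F n` of submodules of `M` which are annihilated by the
maximal ideal. -/
structure IsSocleFlag (F : ℕ → Submodule R M) (n : ℕ) : Prop where
  zero : F 0 = ⊥
  le : ∀ i < n, F i ≤ F (i + 1)
  exists_notMem : ∀ i < n, ∃ g ∈ F (i + 1), g ∉ F i
  exists_sub_mem : ∀ i < n, ∀ g ∈ F (i + 1), g ∉ F i → ∀ y ∈ F (i + 1), ∃ r : R, y - r • g ∈ F i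
  smul_eq_zero : ∀ i ≤ n, ∀ x ∈ F i, ∀ a ∈ maximalIdeal R, a • x = 0

lemma mem_maximalIdeal_of_smul_mem {H : Submodule R M} {g : M} {r : R} (hg : g ∉ H)
    (h : r • g ∈ H) : r ∈ maximalIdeal R := by
  rw [mem_maximalIdeal, mem_nonunits_iff]
  exact fun hu => hg ((Submodule.smul_mem_iff_of_isUnit H hu).mp h)

/-- Adding to `H` an element outside of `H` annihilated by the maximal ideal multiplies the
cardinality by that of the residue field. -/
lemma card_sup_span_singleton {H : Submodule R M} {g : M} (hg : g ∉ H)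
    (hm : ∀ a ∈ maximalIdeal R, a • g = 0) :
    Nat.card (H ⊔ Submodule.span R {g} : Submodule R M) =
      Nat.card (ResidueField R) * Nat.card H := by
  let f : R →ₗ[R] M ⧸ H := H.mkQ.comp (LinearMap.toSpanSingleton R M g)
  have hker : LinearMap.ker f = maximalIdeal R := by
    ext r
    rw [LinearMap.mem_ker]
    change (Submodule.Quotient.mk (r • g) : M ⧸ H) = 0 ↔ _
    rw [Submodule.Quotient.mk_eq_zero]
    exact ⟨mem_maximalIdeal_of_smul_mem hg, fun hr => by rw [hm r hr]; exact zero_mem _⟩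
  have hran : (H ⊔ Submodule.span R {g}).map H.mkQ = LinearMap.range f := by
    rw [Submodule.map_sup, LinearMap.range_comp, LinearMap.range_toSpanSingleton]
    simp
  rw [← card_map_mkQ_mul H, hran, inf_eq_left.mpr le_sup_left]
  congr 1
  rw [← Nat.card_congr f.quotKerEquivRange.toEquiv, hker]
  rfl

namespace IsSocleFlag

variable {F : ℕ → Submodule R M} {n : ℕ}

lemma mono (h : IsSocleFlag F n) {m : ℕ} (hm : m ≤ n) : IsSocleFlag F m :=
  ⟨h.zero, fun i hi => h.le i (hi.trans_le hm), fun i hi => h.exists_notMem i (hi.trans_le hm),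
    fun i hi => h.exists_sub_mem i (hi.trans_le hm), fun i hi => h.smul_eq_zero i (hi.trans hm)⟩

/-- The intersection of `A` with the flag grows by one dimension at each jump. -/
lemma card_inf (h : IsSocleFlag F n) (A : Submodule R M) :
    Nat.card (A ⊓ F n : Submodule R M) = Nat.card (ResidueField R) ^ (jumps F A n).card := by
  induction n with
  | zero =>
    rw [h.zero, inf_bot_eq]
    simp [jumps]
  | succ n ih =>
    have ih := ih (h.mono n.le_succ)
    by_cases hA : A ⊓ F (n + 1) ≤ F n
    · rw [jumps_succ_of_le hA, ← ih, le_antisymm (le_inf inf_le_left hA)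
        (inf_le_inf_left A (h.le n n.lt_succ_self))]
    · rw [jumps_succ_of_not_le hA, Finset.card_insert_of_notMem (notMem_jumps F A n), pow_succ',
        ← ih]
      obtain ⟨g, hg, hgn⟩ := SetLike.not_le_iff_exists.mp hA
      rw [← card_sup_span_singleton (g := g) (fun h' : g ∈ A ⊓ F n => hgn h'.2)
        (h.smul_eq_zero (n + 1) le_rfl g hg.2)]
      have : A ⊓ F (n + 1) = A ⊓ F n ⊔ Submodule.span R {g} := by
        refine le_antisymm (fun y hy => ?_) (sup_le (inf_le_inf_left A (h.le n n.lt_succ_self))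
          ((Submodule.span_singleton_le_iff_mem _ _).mpr hg))
        obtain ⟨r, hr⟩ := h.exists_sub_mem n n.lt_succ_self g hg.2 hgn y hy.2
        rw [← sub_add_cancel y (r • g)]
        exact add_mem (Submodule.mem_sup_left ⟨sub_mem hy.1 (A.smul_mem r hg.1), hr⟩)
          (Submodule.mem_sup_right (Submodule.smul_mem _ r (Submodule.mem_span_singleton_self g)))
      rw [this]

lemma card_eq (h : IsSocleFlag F n) : Nat.card (F n) = Nat.card (ResidueField R) ^ n := by
  have h1 := h.card_inf ⊤
  have h2 : jumps F ⊤ n = Finset.range n := by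
    refine Finset.Subset.antisymm (jumps_subset _ _ _) fun i hi => ?_
    obtain ⟨g, hg, hg'⟩ := h.exists_notMem i (Finset.mem_range.mp hi)
    refine mem_jumps.mpr ⟨Finset.mem_range.mp hi, ?_⟩
    exact fun h' => hg' (h' ⟨trivial, hg⟩)
  rwa [top_inf_eq, h2, Finset.card_range] at h1

/-- The submodules `A` of `F (n + 1)` which are not contained in `F n` and intersect it in a given
submodule `B` are generated by `B` and one element of a fixed coset `g + F n`. -/
lemma card_fiber [Finite M] (h : IsSocleFlag F (n + 1)) {B : Submodule R M} (hB : B ≤ F n) :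
    Nat.card {A : Submodule R M // A ≤ F (n + 1) ∧ A ⊓ F n = B ∧ ¬ A ≤ F n} * Nat.card B =
      Nat.card (F n) := by
  obtain ⟨g, hg, hgn⟩ := h.exists_notMem n n.lt_succ_self
  have hle := h.le n n.lt_succ_self
  have hgh (x : F n) : g + x ∈ F (n + 1) := add_mem hg (hle x.2)
  have hghn (x : F n) : g + x ∉ F n := fun h' => hgn ((add_mem_cancel_right x.2).mp h')
  let S := {A : Submodule R M // A ≤ F (n + 1) ∧ A ⊓ F n = B ∧ ¬ A ≤ F n}
  let ψ : F n → S := fun x => ⟨B ⊔ Submodule.span R {g + (x : M)},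
    sup_le (hB.trans hle) ((Submodule.span_singleton_le_iff_mem _ _).mpr (hgh x)), by
      refine le_antisymm ?_ (le_inf le_sup_left hB)
      rintro y ⟨hy, hyn⟩
      obtain ⟨b, hb, z, hz, rfl⟩ := Submodule.mem_sup.mp hy
      obtain ⟨r, rfl⟩ := Submodule.mem_span_singleton.mp hz
      have hr := mem_maximalIdeal_of_smul_mem (hghn x)
        ((add_mem_cancel_left (hB hb)).mp hyn)
      rw [h.smul_eq_zero (n + 1) le_rfl _ (hgh x) r hr, add_zero]
      exact hb,
    fun h' => hghn x (h' (Submodule.mem_sup_right (Submodule.mem_span_singleton_self _)))⟩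
  have hψ (x : F n) (A : S) : ψ x = A ↔ g + (x : M) ∈ A.1 := by
    constructor
    · rintro rfl
      exact Submodule.mem_sup_right (Submodule.mem_span_singleton_self _)
    · intro hx
      refine Subtype.ext (le_antisymm ?_ fun y hy => ?_)
      · refine sup_le ?_ ((Submodule.span_singleton_le_iff_mem _ _).mpr hx)
        exact A.2.2.1.symm.trans_le inf_le_left
      · obtain ⟨r, hr⟩ := h.exists_sub_mem n n.lt_succ_self _ (hgh x) (hghn x) y (A.2.1 hy)
        rw [← sub_add_cancel y (r • (g + (x : M)))]
        refine add_mem (Submodule.mem_sup_left ?_) (Submodule.mem_sup_right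
          (Submodule.smul_mem _ r (Submodule.mem_span_singleton_self _)))
        exact A.2.2.1.le ⟨sub_mem hy (A.1.smul_mem r hx), hr⟩
  have hfib (A : S) : Nat.card {x : F n // ψ x = A} = Nat.card B := by
    obtain ⟨a, ha, han⟩ := SetLike.not_le_iff_exists.mp A.2.2.2
    obtain ⟨r, hr⟩ := h.exists_sub_mem n n.lt_succ_self a (A.2.1 ha) han g hg
    have hB' (b : M) : b ∈ B ↔ b ∈ A.1 ∧ b ∈ F n :=
      (SetLike.ext_iff.mp A.2.2.1 b).symm
    let x₀ : F n := ⟨r • a - g, by rw [← neg_sub]; exact neg_mem hr⟩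
    have hx₀ : g + (x₀ : M) ∈ A.1 := by
      change g + (r • a - g) ∈ A.1
      rw [add_sub_cancel]
      exact A.1.smul_mem r ha
    refine Nat.card_congr ⟨fun x => ⟨x.1 - x₀, (hB' _).mpr ⟨?_, sub_mem x.1.2 x₀.2⟩⟩,
      fun b => ⟨⟨b + x₀, add_mem (hB b.2) x₀.2⟩, (hψ _ _).mpr ?_⟩, fun x => ?_, fun b => ?_⟩
    · have := sub_mem ((hψ _ _).mp x.2) hx₀
      rwa [add_sub_add_left_eq_sub] at this
    · change g + ((b : M) + x₀) ∈ A.1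
      rw [add_left_comm]
      exact add_mem ((hB' _).mp b.2).1 hx₀
    · exact Subtype.ext (Subtype.ext (sub_add_cancel _ _))
    · exact Subtype.ext (add_sub_cancel_right _ _)
  have : Fintype S := Fintype.ofFinite _
  rw [← Nat.card_congr (Equiv.sigmaFiberEquiv ψ), Nat.card_sigma, Finset.sum_congr rfl
    fun A _ => hfib A, Finset.sum_const, Finset.card_univ, smul_eq_mul, Nat.card_eq_fintype_card]

/-- The submodules with given jumps form a Schubert cell. -/
theorem card_jumps_eq [Finite M] [Finite (ResidueField R)] (h : IsSocleFlag F n) {J : Finset ℕ}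
    (hJ : J ⊆ Finset.range n) : Nat.card {A : Submodule R M // A ≤ F n ∧ jumps F A n = J} =
      Nat.card (ResidueField R) ^ cellDim J := by
  induction n generalizing J with
  | zero =>
    have hJ0 : J = ∅ := Finset.subset_empty.mp hJ
    subst hJ0
    have : Unique {A : Submodule R M // A ≤ F 0 ∧ jumps F A 0 = ∅} :=
      ⟨⟨⟨⊥, bot_le, rfl⟩⟩, fun A => Subtype.ext (by
        exact le_bot_iff.mp (A.2.1.trans h.zero.le))⟩
    rw [Nat.card_unique]
    rfl
  | succ n ih =>
    have hle := h.le n n.lt_succ_self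
    have h' := h.mono n.le_succ
    by_cases hn : n ∈ J
    · set J' := J.erase n with hJ'
      have hJn : J' ⊆ Finset.range n := by
        intro j hj
        have := Finset.mem_range.mp (hJ (Finset.mem_of_mem_erase hj))
        have := Finset.ne_of_mem_erase hj
        exact Finset.mem_range.mpr (by omega)
      have hnJ' : n ∉ J' := Finset.notMem_erase n J
      have hins : insert n J' = J := Finset.insert_erase hn
      have hinf (A : Submodule R M) : jumps F (A ⊓ F n) n = jumps F A n := by
        ext i
        rw [mem_jumps, mem_jumps]
        refine and_congr_right fun hi => ?_
        have hi' : F (i + 1) ≤ F n := by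
          have hmono : ∀ k ≤ n, ∀ j ≤ k, F j ≤ F k := by
            intro k
            induction k with
            | zero => intro _ j hj; rw [Nat.le_zero.mp hj]
            | succ k ihk =>
              intro hk j hj
              rcases hj.eq_or_lt with rfl | hj
              · exact le_rfl
              · exact (ihk (by omega) j (by omega)).trans (h.le k (by omega))
          exact hmono n le_rfl (i + 1) hi
        rw [inf_assoc, inf_eq_right.mpr hi']
      let T := {A : Submodule R M // A ≤ F (n + 1) ∧ jumps F A (n + 1) = J}
      let U := {B : Submodule R M // B ≤ F n ∧ jumps F B n = J'}
      have hT (A : Submodule R M) : (A ≤ F (n + 1) ∧ jumps F A (n + 1) = J) ↔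
          A ≤ F (n + 1) ∧ jumps F (A ⊓ F n) n = J' ∧ ¬ A ≤ F n := by
        refine and_congr_right fun hA => ?_
        have hA' : A ⊓ F (n + 1) = A := inf_eq_left.mpr hA
        rw [hinf]
        constructor
        · intro hj
          by_cases hAn : A ⊓ F (n + 1) ≤ F n
          · rw [jumps_succ_of_le hAn] at hj
            exact absurd (hj ▸ hn) (notMem_jumps F A n)
          · rw [jumps_succ_of_not_le hAn, ← hins] at hj
            refine ⟨?_, by rwa [hA'] at hAn⟩
            rw [← Finset.erase_insert (notMem_jumps F A n), hj, Finset.erase_insert hnJ']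
        · rintro ⟨hj, hAn⟩
          rw [jumps_succ_of_not_le (by rwa [hA']), hj, hins]
      let ψ : T → U := fun A => ⟨A.1 ⊓ F n, inf_le_right, ((hT A.1).mp A.2).2.1⟩
      have hq : 0 < Nat.card (ResidueField R) := Nat.card_pos
      have hcard : J'.card ≤ n := by simpa using Finset.card_le_card hJn
      -- `card_fiber` divides `|F n| = q^n` by `|B| = q^{|J'|}`.
      have hfib (B : U) : Nat.card {A : T // ψ A = B} =
          Nat.card (ResidueField R) ^ (n - J'.card) := by
        have h1 := h.card_fiber B.2.1
        have h2 := h'.card_inf B.1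
        rw [inf_eq_left.mpr B.2.1, B.2.2] at h2
        have h3 : Nat.card {A : T // ψ A = B} = Nat.card {A : Submodule R M //
            A ≤ F (n + 1) ∧ A ⊓ F n = B ∧ ¬ A ≤ F n} := by
          refine Nat.card_congr ⟨fun A => ⟨A.1.1, A.1.2.1, congrArg Subtype.val A.2,
            ((hT _).mp A.1.2).2.2⟩, fun A => ⟨⟨A.1, (hT _).mpr ⟨A.2.1, ?_, A.2.2.2⟩⟩,
            Subtype.ext A.2.2.1⟩, fun _ => rfl, fun _ => rfl⟩
          rw [A.2.2.1, B.2.2]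
        rw [h3]
        rw [h2, h'.card_eq] at h1
        refine Nat.eq_of_mul_eq_mul_right (pow_pos hq J'.card) ?_
        rw [h1, ← pow_add, Nat.sub_add_cancel hcard]
      have : Fintype U := Fintype.ofFinite _
      change Nat.card T = _
      rw [← Nat.card_congr (Equiv.sigmaFiberEquiv ψ), Nat.card_sigma, Finset.sum_congr rfl
        fun B _ => hfib B, Finset.sum_const, Finset.card_univ, smul_eq_mul,
        ← Nat.card_eq_fintype_card, ih h' hJn, ← pow_add]
      congr 1
      conv_rhs => rw [← hins, cellDim, Finset.sum_insert hnJ']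
      rw [add_comm, hins]
      congr 1
      · rw [← hins, Finset.sdiff_insert_of_notMem (by simp), Finset.card_sdiff_of_subset hJn,
          Finset.card_range]
      · refine Finset.sum_congr rfl fun j hj => ?_
        rw [← hins, Finset.sdiff_insert_of_notMem]
        have := Finset.mem_range.mp (hJn hj)
        simp only [Finset.mem_range]
        omega
    · have hJn : J ⊆ Finset.range n := by
        intro j hj
        have := Finset.mem_range.mp (hJ hj)
        have : j ≠ n := fun e => hn (e ▸ hj)
        exact Finset.mem_range.mpr (by omega)
      rw [← ih h' hJn]
      refine Nat.card_congr (Equiv.subtypeEquivRight fun A => ?_)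
      constructor
      · rintro ⟨hA, hj⟩
        have hAn : A ⊓ F (n + 1) ≤ F n := by
          by_contra hAn
          rw [jumps_succ_of_not_le hAn] at hj
          exact hn (hj ▸ Finset.mem_insert_self _ _)
        rw [jumps_succ_of_le hAn] at hj
        rw [inf_eq_left.mpr hA] at hAn
        exact ⟨hAn, hj⟩
      · rintro ⟨hA, hj⟩
        exact ⟨hA.trans hle, by rw [jumps_succ_of_le (inf_le_left.trans hA), hj]⟩

end IsSocleFlag

end Flag

/-! ### The Hall algebra of a discrete valuation ring -/

namespace HallSystem

variable (S : HallSystem.{u}) (typ : Ptn → S.Ob)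
  (h : Function.Bijective fun lam : Ptn => S.cls (typ lam))

/-- If the isomorphism classes of objects correspond to the partitions, the Hall algebra has a basis
indexed by the partitions. -/
noncomputable def ptnBasis : Module.Basis Ptn ℤ S.Alg :=
  .ofRepr (AddEquiv.toIntLinearEquiv (show S.Alg ≃+ (Ptn →₀ ℤ) from
    (Finsupp.domCongr (Equiv.ofBijective _ h).symm : (S.Iso →₀ ℤ) ≃+ (Ptn →₀ ℤ))))

lemma ptnBasis_repr (x : S.Alg) (lam : Ptn) :
    (S.ptnBasis typ h).repr x lam = x (S.cls (typ lam)) := rfl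

lemma ptnBasis_apply (lam : Ptn) :
    S.ptnBasis typ h lam = S.basisElt (S.cls (typ lam)) := by
  classical
  apply (S.ptnBasis typ h).repr.injective
  ext mu
  rw [Module.Basis.repr_self, ptnBasis_repr, basisElt_coe, Finsupp.single_apply]
  exact if_congr h.injective.eq_iff.symm rfl rfl

lemma ptnBasis_repr_mul (mu nu lam : Ptn) :
    (S.ptnBasis typ h).repr (S.ptnBasis typ h mu * S.ptnBasis typ h nu) lam =
      S.hallNumber (S.cls (typ mu)) (S.cls (typ nu)) (S.cls (typ lam)) := by
  rw [ptnBasis_apply, ptnBasis_apply, basisElt_mul, ptnBasis_repr]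
  rfl

end HallSystem

section DVR

open IsLocalRing

variable {R : Type u} [CommRing R] [IsDomain R] [IsDiscreteValuationRing R]


lemma exists_eq_mk_mul_pow {p : R} (hp : Irreducible p) {k : ℕ}
    {x : R ⧸ maximalIdeal R ^ (k + 1)} (hx : p • x = 0) :
    ∃ a : R, x = Ideal.Quotient.mk _ (a * p ^ k) := by
  obtain ⟨b, rfl⟩ := Ideal.Quotient.mk_surjective x
  change Ideal.Quotient.mk _ (p * b) = 0 at hx
  rw [Ideal.Quotient.eq_zero_iff_mem, maximalIdeal_pow_eq hp, Ideal.mem_span_singleton, pow_succ',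
    mul_dvd_mul_iff_left hp.ne_zero] at hx
  obtain ⟨a, rfl⟩ := hx
  exact ⟨a, by rw [mul_comm]⟩

lemma mk_mul_pow_eq_zero_iff {p : R} (hp : Irreducible p) {k : ℕ} {a : R} :
    Ideal.Quotient.mk (maximalIdeal R ^ (k + 1)) (a * p ^ k) = 0 ↔ a ∈ maximalIdeal R := by
  rw [Ideal.Quotient.eq_zero_iff_mem, maximalIdeal_pow_eq hp, Ideal.mem_span_singleton, pow_succ',
    mul_dvd_mul_iff_right (pow_ne_zero _ hp.ne_zero), hp.maximalIdeal_eq, Ideal.mem_span_singleton]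

lemma eq_zero_of_pow_zero (x : R ⧸ maximalIdeal R ^ 0) : x = 0 := by
  obtain ⟨b, rfl⟩ := Ideal.Quotient.mk_surjective x
  rw [Ideal.Quotient.eq_zero_iff_mem, pow_zero, Ideal.one_eq_top]
  trivial

/-- The socle of `R/𝔪^k` is generated by any of its nonzero elements. -/
lemma exists_smul_eq_of_socle {p : R} (hp : Irreducible p) {k : ℕ}
    {x y : R ⧸ maximalIdeal R ^ k} (hx : p • x = 0) (hy : p • y = 0) (hx0 : x ≠ 0) :
    ∃ r : R, y = r • x := by
  rcases k with _ | k
  · exact absurd (eq_zero_of_pow_zero x) hx0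
  obtain ⟨a, rfl⟩ := exists_eq_mk_mul_pow hp hx
  obtain ⟨b, rfl⟩ := exists_eq_mk_mul_pow hp hy
  rw [ne_eq, mk_mul_pow_eq_zero_iff hp, mem_maximalIdeal, mem_nonunits_iff, not_not] at hx0
  obtain ⟨a, rfl⟩ := hx0
  refine ⟨b * ↑a⁻¹, ?_⟩
  change _ = Ideal.Quotient.mk _ (b * ↑a⁻¹ * (a * p ^ k))
  rw [← mul_assoc, mul_assoc b, Units.inv_mul, mul_one]

lemma exists_pow_smul_eq_of_socle {p : R} (hp : Irreducible p) {k i : ℕ} (h : i < k)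
    {x : R ⧸ maximalIdeal R ^ k} (hx : p • x = 0) :
    ∃ y : R ⧸ maximalIdeal R ^ k, p ^ i • y = x := by
  obtain ⟨l, rfl⟩ := Nat.exists_eq_add_of_lt h
  obtain ⟨a, rfl⟩ := exists_eq_mk_mul_pow hp hx
  refine ⟨Ideal.Quotient.mk _ (a * p ^ l), ?_⟩
  change Ideal.Quotient.mk _ (p ^ i * (a * p ^ l)) = _
  congr 1
  ring

/-- The submodule of the socle of `⨁_j R/𝔪^{f j}` formed by the elements whose coordinates from the
`i`-th on vanish. -/
def socleFlag (p : R) {n : ℕ} (f : Fin n → ℕ) (i : ℕ) :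
    Submodule R (∀ j : Fin n, R ⧸ maximalIdeal R ^ f j) where
  carrier := {x | ∀ j, p • x j = 0 ∧ (i ≤ (j : ℕ) → x j = 0)}
  zero_mem' j := ⟨smul_zero _, fun _ => rfl⟩
  add_mem' {x y} hx hy j := ⟨by rw [Pi.add_apply, smul_add, (hx j).1, (hy j).1, add_zero],
    fun h => by rw [Pi.add_apply, (hx j).2 h, (hy j).2 h, add_zero]⟩
  smul_mem' a x hx j := ⟨by rw [Pi.smul_apply, smul_comm, (hx j).1, smul_zero],
    fun h => by rw [Pi.smul_apply, (hx j).2 h, smul_zero]⟩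

lemma mem_socleFlag {p : R} {n : ℕ} {f : Fin n → ℕ} {i : ℕ}
    {x : ∀ j : Fin n, R ⧸ maximalIdeal R ^ f j} :
    x ∈ socleFlag p f i ↔ ∀ j, p • x j = 0 ∧ (i ≤ (j : ℕ) → x j = 0) := Iff.rfl

lemma mem_socleFlag_self {p : R} {n : ℕ} {f : Fin n → ℕ}
    {x : ∀ j : Fin n, R ⧸ maximalIdeal R ^ f j} : x ∈ socleFlag p f n ↔ p • x = 0 := by
  rw [mem_socleFlag]
  exact ⟨fun h => funext fun j => (h j).1,
    fun h j => ⟨congrFun h j, fun hj => absurd j.2 (not_lt.mpr hj)⟩⟩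

lemma isSocleFlag_socleFlag {p : R} (hp : Irreducible p) {n : ℕ} {f : Fin n → ℕ}
    (hf : ∀ j, 0 < f j) : IsSocleFlag (socleFlag p f) n where
  zero := by
    rw [eq_bot_iff]
    exact fun x hx => (Submodule.mem_bot R).mpr (funext fun j => (hx j).2 (Nat.zero_le _))
  le i _ x hx j := ⟨(hx j).1, fun h => (hx j).2 (i.le_succ.trans h)⟩
  exists_notMem i hi := by
    obtain ⟨k, hk⟩ := Nat.exists_eq_add_of_lt (hf ⟨i, hi⟩)
    have hpm : p ∈ maximalIdeal R := by
      rw [hp.maximalIdeal_eq]; exact Ideal.mem_span_singleton_self p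
    obtain ⟨x, hx, hx0⟩ : ∃ x : R ⧸ maximalIdeal R ^ f ⟨i, hi⟩, p • x = 0 ∧ x ≠ 0 := by
      rw [hk, zero_add]
      refine ⟨Ideal.Quotient.mk _ (1 * p ^ k), ?_, ?_⟩
      · change Ideal.Quotient.mk _ (p * (1 * p ^ k)) = 0
        rw [one_mul, mk_mul_pow_eq_zero_iff hp]
        exact hpm
      · rw [ne_eq, mk_mul_pow_eq_zero_iff hp, mem_maximalIdeal, mem_nonunits_iff, not_not]
        exact isUnit_one
    refine ⟨Pi.single ⟨i, hi⟩ x, fun j => ?_, fun h => hx0 ?_⟩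
    · by_cases hj : j = ⟨i, hi⟩
      · subst hj
        rw [Pi.single_eq_same]
        exact ⟨hx, fun h => absurd h (by simp)⟩
      · rw [Pi.single_eq_of_ne hj]
        exact ⟨smul_zero _, fun _ => rfl⟩
    · have := (h ⟨i, hi⟩).2 le_rfl
      rwa [Pi.single_eq_same] at this
  exists_sub_mem i hi g hg hgi y hy := by
    have hg0 : g ⟨i, hi⟩ ≠ 0 := fun h0 => hgi fun j => ⟨(hg j).1, fun hj => by
      rcases hj.eq_or_lt with e | hlt
      · have : j = ⟨i, hi⟩ := Fin.ext e.symm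
        rw [this, h0]
      · exact (hg j).2 hlt⟩
    obtain ⟨r, hr⟩ := exists_smul_eq_of_socle hp (hg ⟨i, hi⟩).1 (hy ⟨i, hi⟩).1 hg0
    refine ⟨r, fun j => ⟨((sub_mem hy (Submodule.smul_mem _ r hg)) j).1, fun hj => ?_⟩⟩
    rcases hj.eq_or_lt with e | hlt
    · have : j = ⟨i, hi⟩ := Fin.ext e.symm
      rw [this, Pi.sub_apply, Pi.smul_apply, hr, sub_self]
    · exact ((sub_mem hy (Submodule.smul_mem _ r hg)) j).2 hlt
  smul_eq_zero i _ x hx a ha := by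
    rw [hp.maximalIdeal_eq, Ideal.mem_span_singleton'] at ha
    obtain ⟨b, rfl⟩ := ha
    rw [mul_smul]
    have : p • x = 0 := funext fun j => (hx j).1
    rw [this, smul_zero]

/-- The intersection of the socle with `𝔪^i M` is the member of the flag whose index is the number
of the parts larger than `i`. -/
lemma socleFlag_inf_smulRange {p : R} (hp : Irreducible p) {n : ℕ} {f : Fin n → ℕ} {i c : ℕ}
    (hc : ∀ j : Fin n, i < f j ↔ (j : ℕ) < c) :
    socleFlag p f n ⊓ smulRange _ (p ^ i) = socleFlag p f c := by
  ext x
  constructor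
  · rintro ⟨hx, y, rfl⟩
    intro j
    refine ⟨(hx j).1, fun hj => ?_⟩
    exact pow_smul_quotient_eq_zero hp
      (not_lt.mp fun h => absurd ((hc j).mp h) (not_lt.mpr hj)) (y j)
  · intro hx
    refine ⟨mem_socleFlag_self.mpr (funext fun j => (hx j).1), ?_⟩
    have key (j : Fin n) : ∃ y : R ⧸ maximalIdeal R ^ f j, p ^ i • y = x j := by
      by_cases hj : (j : ℕ) < c
      · exact exists_pow_smul_eq_of_socle hp ((hc j).mpr hj) (hx j).1
      · exact ⟨0, by rw [smul_zero, (hx j).2 (not_lt.mp hj)]⟩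
    choose y hy using key
    exact ⟨y, funext hy⟩

lemma excess_replicate_one (r i : ℕ) : excess (Multiset.replicate r 1) i = r * (1 - i) := by
  simp [excess]

/-- The decreasing rearrangement makes the indices of the parts larger than `i` an initial
segment. -/
lemma Ptn.exists_lt_seq_iff (lam : Ptn) (i : ℕ) :
    ∃ c ≤ lam.len, ∀ j, i < lam.seq j ↔ j < c := by
  classical
  have hex : ∃ c, lam.seq c ≤ i := ⟨lam.len, by rw [lam.seq_eq_zero le_rfl]; exact Nat.zero_le _⟩
  refine ⟨Nat.find hex, Nat.find_min' hex (by rw [lam.seq_eq_zero le_rfl]; exact Nat.zero_le _),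
    fun j => ⟨fun h => ?_, fun h => not_le.mp (Nat.find_min hex h)⟩⟩
  by_contra hj
  exact absurd (lam.seq_antitone (not_lt.mp hj)) (not_le.mpr ((Nat.find_spec hex).trans_lt h))

variable [Finite (ResidueField R)]

/-- The lengths of `𝔪^i (M/A)`, for a submodule `A` of the socle with set of jumps `J`, are those
which belong to the partition `λ - 1_J`. -/
lemma card_smulRange_quotient_socle {p : R} (hp : Irreducible p) (lam : Ptn)
    {A : Submodule R (∀ j : Fin lam.len, R ⧸ maximalIdeal R ^ lam.seq j)}
    (hA : A ≤ socleFlag p (fun j : Fin lam.len => lam.seq j) lam.len) (i : ℕ) :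
    Nat.card (smulRange (_ ⧸ A) (p ^ i)) = Nat.card (ResidueField R) ^
      excess (strip (Finset.range lam.len) lam.seq
        (jumps (socleFlag p fun j : Fin lam.len => lam.seq j) A lam.len)) i := by
  have hflag : IsSocleFlag (socleFlag p fun j : Fin lam.len => lam.seq j) lam.len :=
    isSocleFlag_socleFlag hp fun j => lam.seq_pos j.2
  obtain ⟨c, hcn, hc⟩ := lam.exists_lt_seq_iff i
  have h1 := card_map_mkQ_mul A (smulRange _ (p ^ i))
  have h2 : A ⊓ smulRange _ (p ^ i) = A ⊓ socleFlag p (fun j : Fin lam.len => lam.seq j) c := by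
    rw [← socleFlag_inf_smulRange hp (i := i) (c := c) fun j : Fin lam.len => hc j, ← inf_assoc,
      inf_eq_left.mpr hA]
  have h3 : (jumps (socleFlag p fun j : Fin lam.len => lam.seq j) A lam.len).filter
      (fun j => i < lam.seq j) = jumps (socleFlag p fun j : Fin lam.len => lam.seq j) A c := by
    rw [← jumps_filter_lt _ A hcn]
    exact Finset.filter_congr fun j _ => hc j
  have h4 := excess_strip (Finset.range lam.len) lam.seq
    (jumps_subset (socleFlag p fun j : Fin lam.len => lam.seq j) A lam.len) i
  rw [h3] at h4
  have h5 : excess (Finset.univ.val.map fun j : Fin lam.len => lam.seq j) i =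
      ∑ j ∈ Finset.range lam.len, (lam.seq j - i) := by
    rw [excess, Multiset.map_map, Finset.sum_range]
    rfl
  rw [h2, (hflag.mono hcn).card_inf, card_smulRange_pi_quotient hp, h5, ← h4, pow_add] at h1
  rw [smulRange_quotient]
  exact Nat.eq_of_mul_eq_mul_right (pow_pos (one_lt_card_residueField.le) _) h1

lemma cls_eq_ofPtn_ones_iff {p : R} (hp : Irreducible p) (M : FinMod R) (r : ℕ) :
    (FinMod.system R).cls M = (FinMod.system R).cls (FinMod.ofPtn R (onesPtn r)) ↔
      (∀ x : M.carrier, p • x = 0) ∧ Nat.card M.carrier = Nat.card (ResidueField R) ^ r := by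
  rw [cls_eq_ofPtn_iff hp]
  have h0 : Nat.card (smulRange M.carrier (p ^ 0)) = Nat.card M.carrier := by
    have : smulRange M.carrier (p ^ 0) = ⊤ := by
      rw [eq_top_iff]
      exact fun x _ => ⟨x, by simp⟩
    rw [this]
    exact Nat.card_congr Submodule.topEquiv.toEquiv
  have hr (i : ℕ) : excess (onesPtn r).2.parts i = r * (1 - i) := excess_replicate_one r i
  constructor
  · intro h
    refine ⟨fun x => ?_, by rw [← h0, h 0, hr, Nat.sub_zero, mul_one]⟩
    have h1 := h 1
    rw [hr, Nat.sub_self, mul_zero, pow_zero, Nat.card_eq_one_iff_unique] at h1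
    have := h1.1
    have h2 : (⟨p ^ 1 • x, x, rfl⟩ : smulRange M.carrier (p ^ 1)) = 0 := Subsingleton.elim _ _
    simpa using congrArg Subtype.val h2
  · rintro ⟨h1, h2⟩ i
    rcases i with _ | i
    · rw [h0, h2, hr, Nat.sub_zero, mul_one]
    · have : smulRange M.carrier (p ^ (i + 1)) = ⊥ := by
        rw [eq_bot_iff]
        rintro _ ⟨x, rfl⟩
        refine (Submodule.mem_bot R).mpr ?_
        change p ^ (i + 1) • x = 0
        rw [pow_succ, mul_smul, h1, smul_zero]
      rw [this, hr, Nat.sub_eq_zero_of_le (by omega), mul_zero, pow_zero]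
      exact Nat.card_unique

/-- The number of submodules `A` of a module of type `λ` with `A` of type `(1^r)` and quotient of
type `μ` is the value of the Pieri polynomial at the cardinality of the residue field. -/
theorem hallNumber_ones_eq (mu : Ptn) (r : ℕ) (lam : Ptn) :
    ((FinMod.system R).hallNumber ((FinMod.system R).cls (FinMod.ofPtn R mu))
      ((FinMod.system R).cls (FinMod.ofPtn R (onesPtn r)))
      ((FinMod.system R).cls (FinMod.ofPtn R lam)) : ℤ) =
      (pieriPoly mu r lam).eval (Nat.card (ResidueField R) : ℤ) := by
  classical
  obtain ⟨p, hp⟩ := IsDiscreteValuationRing.exists_irreducible R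
  set n := lam.len with hn
  let f : Fin n → ℕ := fun j => lam.seq j
  obtain ⟨e⟩ := exists_ofPtn_equiv_pi (R := R) f lam (by
    have : (Finset.univ : Finset (Fin n)).val.map f = lam.2.parts := by
      have hran : Finset.range n = (Finset.univ : Finset (Fin n)).map Fin.valEmbedding := by
        ext i; simp
      rw [← lam.map_seq, ← hn, hran, Finset.map_val, Multiset.map_map]
      rfl
    rw [this, lam.parts_filter])
  have := Finite.of_equiv _ e.toEquiv
  let M : FinMod R := ⟨∀ j : Fin n, R ⧸ maximalIdeal R ^ f j⟩
  have hM : (FinMod.system R).cls (FinMod.ofPtn R lam) = (FinMod.system R).cls M :=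
    Quotient.sound ⟨e⟩
  set F := socleFlag p f with hF
  have hflag : IsSocleFlag F n := isSocleFlag_socleFlag hp fun j => lam.seq_pos j.2
  have hiff (A : Submodule R M.carrier) :
      ((FinMod.system R).cls ((FinMod.system R).sub (M := M) A) =
        (FinMod.system R).cls (FinMod.ofPtn R (onesPtn r)) ∧
      (FinMod.system R).cls ((FinMod.system R).quo (M := M) A) =
        (FinMod.system R).cls (FinMod.ofPtn R mu)) ↔
      (A ≤ F n ∧ (jumps F A n).card = r ∧
        strip (Finset.range n) lam.seq (jumps F A n) = mu.2.parts) := by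
    have hsub : (FinMod.system R).cls ((FinMod.system R).sub (M := M) A) =
        (FinMod.system R).cls (FinMod.ofPtn R (onesPtn r)) ↔
        A ≤ F n ∧ (jumps F A n).card = r := by
      refine (cls_eq_ofPtn_ones_iff hp ⟨A⟩ r).trans ?_
      have h1 : (∀ x : A, p • x = 0) ↔ A ≤ F n := by
        constructor
        · intro h x hx
          exact mem_socleFlag_self.mpr (congrArg Subtype.val (h ⟨x, hx⟩))
        · exact fun h x => Subtype.ext (mem_socleFlag_self.mp (h x.2))
      refine (and_congr_left' h1).trans (and_congr_right fun hA => ?_)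
      have h2 := hflag.card_inf A
      rw [inf_eq_left.mpr hA] at h2
      change Nat.card A = _ ↔ _
      rw [h2]
      exact (Nat.pow_right_injective (one_lt_card_residueField (R := R))).eq_iff
    rw [hsub, and_assoc]
    refine and_congr_right fun hA => and_congr_right fun _ => ?_
    refine (cls_eq_ofPtn_iff hp _ mu).trans ?_
    have h3 := card_smulRange_quotient_socle hp lam hA
    constructor
    · intro h
      refine excess_injective (zero_notMem_strip _ _ _) (fun h => (mu.2.parts_pos h).ne rfl)
        fun i => Nat.pow_right_injective (one_lt_card_residueField (R := R)) ?_
      exact (h3 i).symm.trans (h i)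
    · intro h i
      exact (h3 i).trans (by rw [← h])
  rw [hM]
  let T := {A : Submodule R M.carrier // A ≤ F n ∧ (jumps F A n).card = r ∧
    strip (Finset.range n) lam.seq (jumps F A n) = mu.2.parts}
  let U := ((Finset.range n).powersetCard r).filter
    (fun J => strip (Finset.range n) lam.seq J = mu.2.parts)
  let ψ : T → U := fun A => ⟨jumps F A n, Finset.mem_filter.mpr
    ⟨Finset.mem_powersetCard.mpr ⟨jumps_subset _ _ _, A.2.2.1⟩, A.2.2.2⟩⟩
  have hfib (J : U) : Nat.card {A : T // ψ A = J} =
      Nat.card (ResidueField R) ^ cellDim J := by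
    obtain ⟨h1, h2⟩ := Finset.mem_filter.mp J.2
    obtain ⟨h1, h3⟩ := Finset.mem_powersetCard.mp h1
    rw [← hflag.card_jumps_eq h1]
    refine Nat.card_congr ⟨fun A => ⟨A.1.1, A.1.2.1, congrArg Subtype.val A.2⟩,
      fun A => ⟨⟨A.1, A.2.1, by rw [A.2.2]; exact ⟨h3, h2⟩⟩, Subtype.ext A.2.2⟩,
      fun _ => rfl, fun _ => rfl⟩
  have hcard : Nat.card T = ∑ J ∈ U, Nat.card (ResidueField R) ^ cellDim J := by
    rw [← Nat.card_congr (Equiv.sigmaFiberEquiv ψ), Nat.card_sigma,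
      Finset.sum_congr rfl fun J _ => hfib J]
    exact Finset.sum_coe_sort U fun J => Nat.card (ResidueField R) ^ cellDim J
  refine (congrArg Nat.cast (((FinMod.system R).hallNumber_mk _ _ M).trans
    ((Nat.card_congr (Equiv.subtypeEquivRight hiff)).trans hcard))).trans ?_
  rw [pieriPoly, Polynomial.eval_finsetSum]
  push_cast
  exact Finset.sum_congr rfl fun J _ => by simp

variable (R) in
/-- The basis `(u_λ)` of the Hall algebra. -/
noncomputable def basisDVR : Module.Basis Ptn ℤ (HallDVR R) :=
  (FinMod.system R).ptnBasis (FinMod.ofPtn R) bijective_cls_ofPtn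

lemma basisDVR_apply (lam : Ptn) : basisDVR R lam = uDVR R lam :=
  HallSystem.ptnBasis_apply _ _ _ _

theorem isPieriBasis_basisDVR : IsPieriBasis (basisDVR R) (Nat.card (ResidueField R)) where
  one := by
    rw [basisDVR_apply, uDVR, HallSystem.one_def]
    congr 1
    have : IsEmpty ((onesPtn 0).2.parts) := by
      change IsEmpty ((0 : Multiset ℕ) : Type)
      infer_instance
    exact Quotient.sound ⟨LinearEquiv.ofSubsingleton (R := R)
      (∀ i : (onesPtn 0).2.parts, R ⧸ maximalIdeal R ^ (i : ℕ)) PUnit.{u + 1}⟩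
  repr_mul mu r lam :=
    (HallSystem.ptnBasis_repr_mul _ _ _ _ _ _).trans (hallNumber_ones_eq mu r lam)

end DVR

/-! ### Finite modules over `𝔽₁[[t]]` -/

namespace F1Mod

/-- The number of elements of `T^i K` other than the marked point. -/
noncomputable def rank (K : F1Mod) (i : ℕ) : ℕ :=
  Nat.card {x : K.carrier // x ≠ K.pt ∧ ∃ y, K.T^[i] y = x}

lemma rank_congr {K L : F1Mod} (h : Isom K L) (i : ℕ) : K.rank i = L.rank i := by
  obtain ⟨e, he, he'⟩ := h
  have hs : Function.Semiconj e (K.T^[i]) (L.T^[i]) := Function.Semiconj.iterate_right he' i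
  refine Nat.card_congr (e.subtypeEquiv fun x => and_congr ?_ ?_)
  · rw [ne_eq, ne_eq, ← he, e.injective.eq_iff]
  · constructor
    · rintro ⟨y, rfl⟩
      exact ⟨e y, (hs y).symm⟩
    · rintro ⟨y, hy⟩
      obtain ⟨y, rfl⟩ := e.surjective y
      exact ⟨y, e.injective ((hs y).trans hy)⟩

lemma iterate_pt (K : F1Mod) (i : ℕ) : K.T^[i] K.pt = K.pt := Function.iterate_fixed K.map_pt i

lemma iterate_inj (K : F1Mod) (i : ℕ) {x y : K.carrier} (hx : K.T^[i] x ≠ K.pt)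
    (h : K.T^[i] x = K.T^[i] y) : x = y := by
  induction i with
  | zero => exact h
  | succ i ih =>
    rw [Function.iterate_succ_apply'] at hx h
    rw [Function.iterate_succ_apply'] at h
    exact ih (fun h' => hx (by rw [h', K.map_pt])) (K.inj _ _ hx h)

lemma iterate_eq_pt_of_le (K : F1Mod) {i j : ℕ} (hij : i ≤ j) {x : K.carrier}
    (h : K.T^[i] x = K.pt) : K.T^[j] x = K.pt := by
  obtain ⟨k, rfl⟩ := Nat.exists_eq_add_of_le hij
  rw [add_comm, Function.iterate_add_apply, h, iterate_pt]

/-- The element of height `h` in the chain belonging to the part `j` of `λ`. -/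
def chainElt (lam : Ptn) (j : lam.2.parts) (h : ℕ) (hh : h < (j : ℕ)) : (ofPtn lam).carrier :=
  some ⟨j, ⟨h, hh⟩⟩

section chainElt

variable {lam : Ptn} {j j' : lam.2.parts} {h h' i : ℕ}

lemma chainElt_ne_pt (hh : h < (j : ℕ)) : chainElt lam j h hh ≠ (ofPtn lam).pt :=
  Option.some_ne_none _

lemma chainElt_inj {hh : h < (j : ℕ)} {hh' : h' < (j' : ℕ)}
    (e : chainElt lam j h hh = chainElt lam j' h' hh') : j = j' ∧ h = h' := by
  obtain ⟨rfl, e⟩ := Sigma.mk.inj (Option.some.inj e)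
  exact ⟨rfl, congrArg Fin.val (eq_of_heq e)⟩

lemma exists_chainElt_eq {x : (ofPtn lam).carrier} (hx : x ≠ (ofPtn lam).pt) :
    ∃ (j : lam.2.parts) (h : ℕ) (hh : h < (j : ℕ)), chainElt lam j h hh = x := by
  rcases x with _ | ⟨j, h⟩
  · exact absurd rfl hx
  · exact ⟨j, h, h.2, rfl⟩

lemma T_chainElt_zero (hh : 0 < (j : ℕ)) :
    (ofPtn lam).T (chainElt lam j 0 hh) = (ofPtn lam).pt := rfl

lemma iterate_chainElt (hh : h + i < (j : ℕ)) :
    (ofPtn lam).T^[i] (chainElt lam j (h + i) hh) = chainElt lam j h (by omega) := by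
  induction i with
  | zero => rfl
  | succ i ih => exact ih (by omega)

lemma iterate_chainElt_of_lt (hi : h < i) (hh : h < (j : ℕ)) :
    (ofPtn lam).T^[i] (chainElt lam j h hh) = (ofPtn lam).pt := by
  refine (ofPtn lam).iterate_eq_pt_of_le (i := h + 1) hi ?_
  rw [Function.iterate_succ_apply']
  have h1 := iterate_chainElt (lam := lam) (j := j) (h := 0) (i := h) (by omega)
  simp only [zero_add] at h1
  rw [h1, T_chainElt_zero]

lemma exists_iterate_eq_chainElt_iff (hh : h < (j : ℕ)) :
    (∃ y, (ofPtn lam).T^[i] y = chainElt lam j h hh) ↔ h + i < j := by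
  constructor
  · rintro ⟨y, hy⟩
    have hy0 : y ≠ (ofPtn lam).pt := by
      rintro rfl
      rw [iterate_pt] at hy
      exact chainElt_ne_pt hh hy.symm
    obtain ⟨j', h', hh', rfl⟩ := exists_chainElt_eq hy0
    by_cases hi : i ≤ h'
    · obtain ⟨k, rfl⟩ := Nat.exists_eq_add_of_le' hi
      rw [iterate_chainElt] at hy
      obtain ⟨rfl, rfl⟩ := chainElt_inj hy
      exact hh'
    · rw [iterate_chainElt_of_lt (not_le.mp hi)] at hy
      exact absurd hy.symm (chainElt_ne_pt hh)
  · exact fun hi => ⟨chainElt lam j (h + i) hi, iterate_chainElt hi⟩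

end chainElt

lemma rank_ofPtn (lam : Ptn) (i : ℕ) : (ofPtn lam).rank i = excess lam.2.parts i := by
  have h1 : excess lam.2.parts i = Nat.card (Σ j : lam.2.parts, Fin ((j : ℕ) - i)) := by
    rw [Nat.card_sigma, excess]
    conv_lhs => rw [← Multiset.map_univ_coe lam.2.parts, Multiset.map_map]
    simp only [Nat.card_fin]
    rfl
  rw [h1, rank]
  symm
  have hlt (p : Σ j : lam.2.parts, Fin ((j : ℕ) - i)) : (p.2 : ℕ) + i < (p.1 : ℕ) := by
    have := p.2.2; omega
  refine Nat.card_congr (Equiv.ofBijective (fun p => ⟨chainElt lam p.1 p.2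
    (lt_of_le_of_lt (Nat.le_add_right _ _) (hlt p)), chainElt_ne_pt _,
    (exists_iterate_eq_chainElt_iff _).mpr (hlt p)⟩) ⟨?_, ?_⟩)
  · rintro ⟨j, h⟩ ⟨j', h'⟩ e
    obtain ⟨rfl, e2⟩ := chainElt_inj (congrArg Subtype.val e)
    exact congrArg (Sigma.mk j) (Fin.ext e2)
  · rintro ⟨x, hx, hy⟩
    obtain ⟨j, h, hh, rfl⟩ := exists_chainElt_eq hx
    have := (exists_iterate_eq_chainElt_iff hh).mp hy
    exact ⟨⟨j, ⟨h, by omega⟩⟩, rfl⟩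

/-- Every finite `𝔽₁[[t]]`-module is a union of chains, one for every element `s` of the socle: as
`T` is injective off the preimage of the marked point, for every `h` there is at most one `x` with
`T^h x = s`. -/
theorem exists_isom_ofPtn (K : F1Mod) : ∃ lam : Ptn, Isom (ofPtn lam) K := by
  classical
  obtain ⟨N, hN⟩ := K.nilp
  let S := {s : K.carrier // s ≠ K.pt ∧ K.T s = K.pt}
  have : Fintype S := Fintype.ofFinite _
  have hex (s : S) : ∃ h, ¬ ∃ x, K.T^[h] x = s.1 :=
    ⟨N, fun ⟨x, hx⟩ => s.2.1 (by rw [← hx, hN])⟩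
  let len (s : S) : ℕ := Nat.find (hex s)
  have hlen (s : S) (h : ℕ) : h < len s ↔ ∃ x, K.T^[h] x = s.1 := by
    constructor
    · exact fun hh => not_not.mp (Nat.find_min (hex s) hh)
    · rintro ⟨x, hx⟩
      by_contra hh
      obtain ⟨k, rfl⟩ := Nat.exists_eq_add_of_le (not_lt.mp hh)
      refine Nat.find_spec (hex s) ⟨K.T^[k] x, ?_⟩
      rw [← Function.iterate_add_apply]
      exact hx
  have hpos (s : S) : 0 < len s := (hlen s 0).mpr ⟨s.1, rfl⟩
  let lam := Ptn.ofMultiset ((Finset.univ : Finset S).val.map len)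
  have hparts : lam.2.parts = (Finset.univ : Finset S).val.map len := by
    rw [Ptn.ofMultiset_parts, Multiset.filter_eq_self]
    intro a ha
    obtain ⟨s, -, rfl⟩ := Multiset.mem_map.mp ha
    exact (hpos s).ne'
  obtain ⟨e, he⟩ := exists_equiv_of_map_eq (fun j : lam.2.parts => (j : ℕ)) len
    ((Multiset.map_univ_coe _).trans hparts)
  have hc (j : lam.2.parts) (h : Fin (j : ℕ)) : ∃ x, K.T^[h] x = (e j).1 :=
    (hlen _ _).mp (by rw [he]; exact h.2)
  choose c hc using hc
  have hne (j : lam.2.parts) (h : Fin (j : ℕ)) : c j h ≠ K.pt := fun h' =>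
    (e j).2.1 (by rw [← hc j h, h', iterate_pt])
  have hkill (j : lam.2.parts) (h : Fin (j : ℕ)) : K.T^[h + 1] (c j h) = K.pt := by
    rw [Function.iterate_succ_apply', hc, (e j).2.2]
  let g : (ofPtn lam).carrier → K.carrier := fun x => x.elim K.pt fun p => c p.1 p.2
  have hg : Function.Bijective g := by
    constructor
    · rintro (_ | ⟨j, h⟩) (_ | ⟨j', h'⟩) hx
      · rfl
      · exact absurd hx.symm (hne j' h')
      · exact absurd hx (hne j h)
      · have hx : c j h = c j' h' := hx
        have hle {j j' : lam.2.parts} {h : Fin (j : ℕ)} {h' : Fin (j' : ℕ)}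
            (hx : c j h = c j' h') : (h : ℕ) ≤ h' := by
          by_contra hlt
          have h1 := hkill j' h'
          rw [← hx] at h1
          have h2 := K.iterate_eq_pt_of_le (show (h' : ℕ) + 1 ≤ h by omega) h1
          rw [hc] at h2
          exact (e j).2.1 h2
        have hhh : (h : ℕ) = h' := le_antisymm (hle hx) (hle hx.symm)
        have hjj : j = j' := by
          apply e.injective
          apply Subtype.ext
          rw [← hc j h, ← hc j' h', hx, hhh]
        subst hjj
        rw [Fin.ext hhh]
    · intro x
      by_cases hx : x = K.pt
      · exact ⟨none, hx.symm⟩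
      · have hex : ∃ k, K.T^[k] x = K.pt := ⟨N, hN x⟩
        obtain ⟨h, hh⟩ : ∃ h, Nat.find hex = h + 1 :=
          Nat.exists_eq_succ_of_ne_zero fun h0 => hx (by
            have := Nat.find_spec hex
            rwa [h0] at this)
        have h1 : K.T^[h] x ≠ K.pt := Nat.find_min hex (by omega)
        have h2 : K.T (K.T^[h] x) = K.pt := by
          rw [← Function.iterate_succ_apply' K.T, Nat.succ_eq_add_one, ← hh]
          exact Nat.find_spec hex
        obtain ⟨j, hj⟩ := e.surjective ⟨K.T^[h] x, h1, h2⟩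
        have hhj : h < (j : ℕ) := by
          rw [← he, hlen, hj]
          exact ⟨x, rfl⟩
        refine ⟨some ⟨j, ⟨h, hhj⟩⟩, ?_⟩
        have h3 := hc j ⟨h, hhj⟩
        rw [hj] at h3
        exact (K.iterate_inj h h1 h3.symm).symm
  refine ⟨lam, Equiv.ofBijective g hg, rfl, ?_⟩
  intro x
  change g ((ofPtn lam).T x) = K.T (g x)
  by_cases hx : x = (ofPtn lam).pt
  · subst hx
    exact K.map_pt.symm
  · obtain ⟨j, h, hh, rfl⟩ := exists_chainElt_eq hx
    have h1 := hc j ⟨h, hh⟩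
    rcases h with _ | h
    · have h1 : c j ⟨0, hh⟩ = (e j).1 := h1
      change K.pt = K.T (c j ⟨0, hh⟩)
      rw [h1, (e j).2.2]
    · change c j ⟨h, _⟩ = K.T (c j ⟨h + 1, hh⟩)
      have h2 : K.T^[h] (c j ⟨h, by omega⟩) = (e j).1 := hc j ⟨h, by omega⟩
      refine K.iterate_inj h (by rw [h2]; exact (e j).2.1) ?_
      rw [h2, ← Function.iterate_succ_apply, ← h1]

lemma cls_eq_ofPtn_iff (K : F1Mod) (lam : Ptn) :
    system.cls K = system.cls (ofPtn lam) ↔ ∀ i, K.rank i = excess lam.2.parts i := by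
  constructor
  · intro h i
    rw [rank_congr (Quotient.exact h : Isom K (ofPtn lam)), rank_ofPtn]
  · intro h
    obtain ⟨mu, e⟩ := exists_isom_ofPtn K
    have : mu = lam := Ptn.excess_injective fun i => by
      rw [← h i, ← rank_congr e, rank_ofPtn]
    subst this
    exact Quotient.sound (isoSetoid.symm e)

lemma bijective_cls_ofPtn : Function.Bijective fun lam : Ptn => system.cls (ofPtn lam) := by
  constructor
  · intro lam mu h
    refine Ptn.excess_injective fun i => ?_
    rw [← rank_ofPtn, (cls_eq_ofPtn_iff _ mu).mp h i]
  · intro c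
    induction c using Quotient.inductionOn with | _ K => ?_
    obtain ⟨mu, e⟩ := exists_isom_ofPtn K
    exact ⟨mu, Quotient.sound e⟩

lemma cls_eq_ofPtn_ones_iff (K : F1Mod) (r : ℕ) :
    system.cls K = system.cls (ofPtn (onesPtn r)) ↔
      (∀ x, K.T x = K.pt) ∧ Nat.card {x : K.carrier // x ≠ K.pt} = r := by
  rw [cls_eq_ofPtn_iff]
  have h0 : K.rank 0 = Nat.card {x : K.carrier // x ≠ K.pt} :=
    Nat.card_congr (Equiv.subtypeEquivRight fun x => and_iff_left ⟨x, rfl⟩)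
  have hr (i : ℕ) : excess (onesPtn r).2.parts i = r * (1 - i) := excess_replicate_one r i
  constructor
  · intro h
    refine ⟨fun x => ?_, by rw [← h0, h 0, hr, Nat.sub_zero, mul_one]⟩
    have h1 := h 1
    rw [hr, Nat.sub_self, mul_zero, rank, Finite.card_eq_zero_iff] at h1
    by_contra hx
    exact h1.false ⟨K.T x, hx, x, rfl⟩
  · rintro ⟨h1, h2⟩ i
    rcases i with _ | i
    · rw [h0, h2, hr, Nat.sub_zero, mul_one]
    · rw [hr, Nat.sub_eq_zero_of_le (by omega), mul_zero, rank, Finite.card_eq_zero_iff]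
      refine ⟨fun x => x.2.1 ?_⟩
      obtain ⟨y, hy⟩ := x.2.2
      rw [← hy, Function.iterate_succ_apply', h1]

/-- The points of `T^i(K/A)` are the points of `T^i K` outside of `A`. -/
lemma Sub.rank_quotient_add {K : F1Mod} (A : K.Sub) (i : ℕ) : A.quotient.rank i +
    Nat.card {x : K.carrier // x ∈ A.carrier ∧ x ≠ K.pt ∧ ∃ y, K.T^[i] y = x} = K.rank i := by
  classical
  have hs (y : K.carrier) : A.quotient.T^[i] (Quotient.mk A.collapse y) =
      Quotient.mk A.collapse (K.T^[i] y) := by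
    have : Function.Semiconj (Quotient.mk A.collapse) K.T A.quotient.T := fun _ => rfl
    exact (this.iterate_right i y).symm
  have h1 : A.quotient.rank i =
      Nat.card {x : K.carrier // x ∉ A.carrier ∧ x ≠ K.pt ∧ ∃ y, K.T^[i] y = x} := by
    symm
    refine Nat.card_congr (Equiv.ofBijective (fun x => ⟨Quotient.mk A.collapse x.1,
      fun h => x.2.1 ((A.mk_eq_pt _).mp h), ?_⟩) ⟨fun x y h => ?_, ?_⟩)
    · obtain ⟨y, hy⟩ := x.2.2.2
      exact ⟨Quotient.mk A.collapse y, by rw [hs, hy]⟩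
    · rcases Quotient.exact (congrArg Subtype.val h) with h | h
      · exact Subtype.ext h
      · exact absurd h.1 x.2.1
    · rintro ⟨x, hx, hy⟩
      induction x using Quotient.inductionOn with | _ x => ?_
      obtain ⟨y, hy⟩ := hy
      induction y using Quotient.inductionOn with | _ y => ?_
      have hxA : x ∉ A.carrier := fun h => hx ((A.mk_eq_pt x).mpr h)
      refine ⟨⟨x, hxA, fun h => hxA (h ▸ A.pt_mem), y, ?_⟩, rfl⟩
      rw [hs] at hy
      rcases Quotient.exact hy with h | h
      · exact h
      · exact absurd h.2 hxA
  rw [h1, rank]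
  have h2 := Nat.card_congr (Equiv.sumCompl fun x : {x : K.carrier // x ≠ K.pt ∧
    ∃ y, K.T^[i] y = x} => x.1 ∈ A.carrier)
  rw [Nat.card_sum] at h2
  rw [← h2, add_comm]
  congr 1
  · exact Nat.card_congr ((Equiv.subtypeEquivRight fun x => and_comm).trans
      (Equiv.subtypeSubtypeEquivSubtypeInter _ (fun x : K.carrier => x ∈ A.carrier)).symm)
  · exact Nat.card_congr ((Equiv.subtypeEquivRight fun x => and_comm).trans
      (Equiv.subtypeSubtypeEquivSubtypeInter _ (fun x : K.carrier => x ∉ A.carrier)).symm)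

/-- The element of the socle of the module of type `λ` which belongs to the part `j` of `λ`. -/
def socleElt (lam : Ptn) (j : lam.2.parts) : (ofPtn lam).carrier :=
  chainElt lam j 0 (lam.2.parts_pos Multiset.coe_mem)

lemma socleElt_injective (lam : Ptn) : Function.Injective (socleElt lam) := fun _ _ h =>
  (chainElt_inj h).1

lemma exists_socleElt_eq {lam : Ptn} {x : (ofPtn lam).carrier} (hx : x ≠ (ofPtn lam).pt)
    (h : (ofPtn lam).T x = (ofPtn lam).pt) : ∃ j, socleElt lam j = x := by
  obtain ⟨j, k, hk, rfl⟩ := exists_chainElt_eq hx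
  rcases k with _ | k
  · exact ⟨j, rfl⟩
  · exact absurd h (chainElt_ne_pt _)

/-- The submodule of the socle of the module of type `λ` which belongs to a set of parts of `λ`. -/
def socleSub (lam : Ptn) (J : Finset lam.2.parts) : (ofPtn lam).Sub where
  carrier := {x | x = (ofPtn lam).pt ∨ ∃ j ∈ J, socleElt lam j = x}
  pt_mem := .inl rfl
  T_mem := by
    rintro _ (rfl | ⟨j, -, rfl⟩)
    · exact .inl rfl
    · exact .inl rfl

lemma mem_socleSub {lam : Ptn} {J : Finset lam.2.parts} {x : (ofPtn lam).carrier} :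
    x ∈ (socleSub lam J).carrier ↔ x = (ofPtn lam).pt ∨ ∃ j ∈ J, socleElt lam j = x := Iff.rfl

lemma socleElt_mem_socleSub {lam : Ptn} {J : Finset lam.2.parts} {j : lam.2.parts} :
    socleElt lam j ∈ (socleSub lam J).carrier ↔ j ∈ J := by
  rw [mem_socleSub]
  constructor
  · rintro (h | ⟨j', hj', h⟩)
    · exact absurd h (chainElt_ne_pt _)
    · rwa [← socleElt_injective lam h]
  · exact fun h => .inr ⟨j, h, rfl⟩

lemma card_socleSub (lam : Ptn) (J : Finset lam.2.parts) (i : ℕ) :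
    Nat.card {x : (ofPtn lam).carrier // x ∈ (socleSub lam J).carrier ∧ x ≠ (ofPtn lam).pt ∧
      ∃ y, (ofPtn lam).T^[i] y = x} = (J.filter fun j : lam.2.parts => i < (j : ℕ)).card := by
  rw [← Nat.card_eq_finsetCard]
  symm
  have hiff (j : lam.2.parts) : (∃ y, (ofPtn lam).T^[i] y = socleElt lam j) ↔ i < (j : ℕ) := by
    rw [socleElt, exists_iterate_eq_chainElt_iff, zero_add]
  refine Nat.card_congr (Equiv.ofBijective (fun j => ⟨socleElt lam j.1,
    socleElt_mem_socleSub.mpr (Finset.mem_filter.mp j.2).1, chainElt_ne_pt _,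
    (hiff j.1).mpr (Finset.mem_filter.mp j.2).2⟩) ⟨fun j j' h => ?_, ?_⟩)
  · exact Subtype.ext (socleElt_injective lam (congrArg Subtype.val h))
  · rintro ⟨x, hx | ⟨j, hj, rfl⟩, hx', hy⟩
    · exact absurd hx hx'
    · exact ⟨⟨j, Finset.mem_filter.mpr ⟨hj, (hiff j).mp hy⟩⟩, rfl⟩

/-- The number of submodules `A` of the module of type `λ` with `A` of type `(1^r)` and quotient of
type `μ` is the value of the Pieri polynomial at `1`. -/
theorem hallNumber_ones_eq (mu : Ptn) (r : ℕ) (lam : Ptn) :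
    (system.hallNumber (system.cls (ofPtn mu)) (system.cls (ofPtn (onesPtn r)))
      (system.cls (ofPtn lam)) : ℤ) = (pieriPoly mu r lam).eval 1 := by
  classical
  have hcongr : stripCount (Finset.range lam.len) lam.seq r mu.2.parts =
      stripCount (Finset.univ : Finset lam.2.parts) (fun j => (j : ℕ)) r mu.2.parts :=
    stripCount_congr (lam.map_seq.trans (Multiset.map_univ_coe _).symm) _ _
  rw [pieriPoly_eval_one, hcongr, stripCount, ← Nat.card_eq_finsetCard]
  refine congrArg Nat.cast ((system.hallNumber_mk _ _ (ofPtn lam)).trans ?_)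
  symm
  have hsub (J : Finset lam.2.parts) :
      system.cls (socleSub lam J).toMod = system.cls (ofPtn (onesPtn r)) ↔ J.card = r := by
    rw [cls_eq_ofPtn_ones_iff, and_iff_right]
    · have h := card_socleSub lam J 0
      rw [Finset.filter_true_of_mem fun j _ => lam.2.parts_pos Multiset.coe_mem] at h
      rw [← h]
      refine iff_of_eq (congrArg (· = r) (Nat.card_congr ⟨fun x => ⟨x.1.1, x.1.2,
        fun h' => x.2 (Subtype.ext h'), x.1.1, rfl⟩, fun x => ⟨⟨x.1, x.2.1⟩,
        fun h' => x.2.2.1 (congrArg Subtype.val h')⟩, fun _ => rfl, fun _ => rfl⟩))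
    · rintro ⟨x, rfl | ⟨j, -, rfl⟩⟩
      · rfl
      · rfl
  have hquo (J : Finset lam.2.parts) :
      system.cls (socleSub lam J).quotient = system.cls (ofPtn mu) ↔
        strip Finset.univ (fun j : lam.2.parts => (j : ℕ)) J = mu.2.parts := by
    have key (i : ℕ) : (socleSub lam J).quotient.rank i =
        excess (strip Finset.univ (fun j : lam.2.parts => (j : ℕ)) J) i := by
      have h1 := (socleSub lam J).rank_quotient_add i
      have h2 := excess_strip Finset.univ (fun j : lam.2.parts => (j : ℕ))
        (Finset.subset_univ J) i
      have h3 : ∑ j : lam.2.parts, ((j : ℕ) - i) = excess lam.2.parts i := by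
        rw [excess]
        conv_rhs => rw [← Multiset.map_univ_coe lam.2.parts, Multiset.map_map]
        rfl
      rw [card_socleSub, rank_ofPtn] at h1
      omega
    rw [cls_eq_ofPtn_iff]
    simp only [key]
    exact ⟨fun h => excess_injective (zero_notMem_strip _ _ _)
      (fun h => (mu.2.parts_pos h).ne rfl) h, fun h i => by rw [h]⟩
  refine Nat.card_congr (Equiv.ofBijective (fun J => ⟨socleSub lam J.1, ?_, ?_⟩)
    ⟨fun J J' h => ?_, ?_⟩)
  · exact (hsub _).mpr (Finset.mem_powersetCard.mp (Finset.mem_filter.mp J.2).1).2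
  · exact (hquo _).mpr (Finset.mem_filter.mp J.2).2
  · refine Subtype.ext (Finset.ext fun j => ?_)
    rw [← socleElt_mem_socleSub, ← socleElt_mem_socleSub]
    exact iff_of_eq (congrArg (fun A : (ofPtn lam).Sub => socleElt lam j ∈ A.carrier)
      (congrArg Subtype.val h))
  · rintro ⟨A, h1, h2⟩
    change (ofPtn lam).Sub at A
    have hA : A = socleSub lam (Finset.univ.filter fun j => socleElt lam j ∈ A.carrier) := by
      have hT := ((cls_eq_ofPtn_ones_iff A.toMod r).mp h1).1
      refine Sub.ext (Set.ext fun x => ?_)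
      rw [mem_socleSub]
      constructor
      · intro hx
        by_cases h0 : x = (ofPtn lam).pt
        · exact .inl h0
        · obtain ⟨j, rfl⟩ := exists_socleElt_eq h0 (congrArg Subtype.val (hT ⟨x, hx⟩))
          exact .inr ⟨j, by simpa using hx, rfl⟩
      · rintro (rfl | ⟨j, hj, rfl⟩)
        · exact A.pt_mem
        · simpa using hj
    have h1' := (hsub (Finset.univ.filter fun j => socleElt lam j ∈ A.carrier)).mp
      (by rw [← hA]; exact h1)
    have h2' := (hquo (Finset.univ.filter fun j => socleElt lam j ∈ A.carrier)).mp
      (by rw [← hA]; exact h2)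
    exact ⟨⟨_, Finset.mem_filter.mpr ⟨Finset.mem_powersetCard.mpr
      ⟨Finset.subset_univ _, h1'⟩, h2'⟩⟩, Subtype.ext hA.symm⟩

end F1Mod

/-- The basis `(u_λ)` of the Hall algebra of `𝔽₁[[t]]`. -/
noncomputable def basisF1 : Module.Basis Ptn ℤ HallF1 :=
  F1Mod.system.ptnBasis F1Mod.ofPtn F1Mod.bijective_cls_ofPtn

lemma basisF1_apply (lam : Ptn) : basisF1 lam = uF1 lam := HallSystem.ptnBasis_apply _ _ _ _

theorem isPieriBasis_basisF1 : IsPieriBasis basisF1 1 where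
  one := by
    rw [basisF1_apply, uF1, HallSystem.one_def]
    congr 1
    refine Quotient.sound (F1Mod.isom_zero_of ?_)
    rintro (_ | ⟨j, h⟩)
    · rfl
    · exact absurd (Multiset.coe_mem (x := j)) (Multiset.notMem_zero _)
  repr_mul mu r lam :=
    (HallSystem.ptnBasis_repr_mul _ _ _ _ _ _).trans (F1Mod.hallNumber_ones_eq mu r lam)

/-! ### The monomial basis of the ring of symmetric functions -/

namespace SymFun

open MvPolynomial

lemma prod_map_X {σ : Type*} [DecidableEq σ] (s : Multiset σ) :
    (s.map (X : σ → MvPolynomial σ ℤ)).prod = monomial (Multiset.toFinsupp s) 1 := by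
  induction s using Multiset.induction_on with
  | empty => simp
  | cons a s ih =>
    rw [Multiset.map_cons, Multiset.prod_cons, ih, ← Multiset.singleton_add, map_add,
      Multiset.toFinsupp_singleton, X, monomial_mul, one_mul]

section shape

variable {σ : Type*} [Fintype σ]

/-- The multiset of the nonzero exponents of a monomial. -/
def shape (a : σ →₀ ℕ) : Multiset ℕ := (Finset.univ.val.map a).filter (· ≠ 0)

lemma shape_eq_map_support (a : σ →₀ ℕ) : shape a = a.support.val.map a := by
  classical
  have h : a.support = Finset.univ.filter fun i => a i ≠ 0 := by ext; simp
  rw [shape, h, Finset.filter_val, Multiset.filter_map]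
  rfl

lemma sum_shape (a : σ →₀ ℕ) : (shape a).sum = Multiset.card a.toMultiset := by
  rw [shape_eq_map_support, Finsupp.card_toMultiset]
  rfl

lemma ofSym_parts [DecidableEq σ] {k : ℕ} (s : Sym σ k) :
    (Nat.Partition.ofSym s).parts = shape (Multiset.toFinsupp s.1) := by
  rw [shape_eq_map_support, Multiset.toFinsupp_support]
  rfl

lemma coeff_msymm [DecidableEq σ] {k : ℕ} (mu : k.Partition) (a : σ →₀ ℕ) :
    coeff a (msymm σ ℤ mu) = if shape a = mu.parts then 1 else 0 := by
  rw [msymm, coeff_sum]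
  have h1 (s : {s : Sym σ k // Nat.Partition.ofSym s = mu}) :
      coeff a (s.1.1.map (X : σ → MvPolynomial σ ℤ)).prod =
        if Multiset.toFinsupp s.1.1 = a then 1 else 0 := by
    rw [prod_map_X, coeff_monomial]
  split_ifs with h
  · have hcard : Multiset.card a.toMultiset = k := by
      rw [← sum_shape, h, mu.parts_sum]
    let s₀ : Sym σ k := ⟨a.toMultiset, hcard⟩
    have hs₀ : Nat.Partition.ofSym s₀ = mu := by
      refine Nat.Partition.ext ?_
      rw [ofSym_parts, Finsupp.toMultiset_toFinsupp, h]
    rw [Finset.sum_eq_single ⟨s₀, hs₀⟩]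
    · exact (h1 _).trans (if_pos (Finsupp.toMultiset_toFinsupp a))
    · intro s _ hs
      refine (h1 s).trans (if_neg fun e => hs (Subtype.ext (Subtype.ext ?_)))
      rw [← Multiset.toFinsupp_toMultiset s.1.1, e]
    · exact fun h => absurd (Finset.mem_univ _) h
  · refine Finset.sum_eq_zero fun s _ => (h1 s).trans (if_neg fun e => h ?_)
    rw [← e, ← ofSym_parts, s.2]

/-- The coefficient of `x^c` in `m_μ m_{(1^r)}` is the number of ways to subtract `1` from `r` of
the exponents in such a way that a rearrangement of `μ` is left. -/
lemma coeff_msymm_mul_ones [DecidableEq σ] {k : ℕ} (mu : k.Partition) (r : ℕ) (c : σ →₀ ℕ) :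
    coeff c (msymm σ ℤ mu * msymm σ ℤ (onesPtn r).2) =
      stripCount c.support c r mu.parts := by
  have hones : (onesPtn r).2.parts = Multiset.replicate r 1 := rfl
  let ind (J : Finset σ) : σ →₀ ℕ := Finsupp.indicator J fun _ _ => 1
  have hind (J : Finset σ) (i : σ) : ind J i = if i ∈ J then 1 else 0 := by
    rw [Finsupp.indicator_apply, dite_eq_ite]
  have hsupp (J : Finset σ) : (ind J).support = J := by
    ext i; simp [hind]
  have hshape (J : Finset σ) : shape (ind J) = Multiset.replicate J.card 1 := by
    rw [shape_eq_map_support, hsupp, Multiset.eq_replicate, Multiset.card_map]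
    refine ⟨rfl, fun b hb => ?_⟩
    obtain ⟨i, hi, rfl⟩ := Multiset.mem_map.mp hb
    exact (hind J i).trans (if_pos hi)
  have hle (J : Finset σ) (hJ : J ⊆ c.support) : ind J ≤ c := by
    intro i
    rw [hind]
    split_ifs with h
    · exact Nat.one_le_iff_ne_zero.mpr (Finsupp.mem_support_iff.mp (hJ h))
    · exact Nat.zero_le _
  have hstrip (J : Finset σ) : shape (c - ind J) = strip c.support c J := by
    have h0 : c.support = Finset.univ.filter fun i => c i ≠ 0 := by ext; simp
    rw [shape, strip, h0, Finset.filter_val, Multiset.filter_map, Multiset.filter_map,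
      Multiset.filter_filter]
    simp only [Function.comp_apply, Finsupp.tsub_apply, hind]
    have hfun : (c - ind J : σ → ℕ) = fun j => c j - if j ∈ J then 1 else 0 :=
      funext fun j => by rw [Pi.sub_apply, hind]
    refine congrArg₂ Multiset.map hfun (Multiset.filter_congr fun i _ => ?_)
    split_ifs <;> omega
  rw [coeff_mul, stripCount, Finset.card_filter]
  simp only [coeff_msymm, hones]
  rw [Nat.cast_sum, ← Finset.sum_filter_add_sum_filter_not (Finset.HasAntidiagonal.antidiagonal c)
    (fun p => shape p.2 = Multiset.replicate r 1), add_comm, Finset.sum_eq_zero, zero_add]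
  · symm
    refine Finset.sum_bij' (fun J _ => (c - ind J, ind J)) (fun p _ => p.2.support) ?_ ?_ ?_ ?_ ?_
    · intro J hJ
      rw [Finset.mem_powersetCard] at hJ
      rw [Finset.mem_filter, Finset.HasAntidiagonal.mem_antidiagonal]
      exact ⟨tsub_add_cancel_of_le (hle J hJ.1), by rw [hshape, hJ.2]⟩
    · rintro ⟨a, b⟩ h
      rw [Finset.mem_filter, Finset.HasAntidiagonal.mem_antidiagonal] at h
      obtain ⟨rfl, h⟩ := h
      simp only at h
      rw [Finset.mem_powersetCard]
      refine ⟨fun i hi => ?_, ?_⟩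
      · rw [Finsupp.mem_support_iff] at hi ⊢
        have hi : b i ≠ 0 := hi
        change a i + b i ≠ 0
        omega
      · have := congrArg Multiset.card h
        rwa [shape_eq_map_support, Multiset.card_map, Multiset.card_replicate] at this
    · exact fun J _ => hsupp J
    · rintro ⟨a, b⟩ h
      rw [Finset.mem_filter, Finset.HasAntidiagonal.mem_antidiagonal] at h
      obtain ⟨rfl, h⟩ := h
      simp only at h
      have hb : ind b.support = b := by
        ext i
        rw [hind]
        split_ifs with hi
        · rw [shape_eq_map_support] at h
          exact (Multiset.eq_of_mem_replicate (h ▸ Multiset.mem_map_of_mem b hi)).symm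
        · exact (Finsupp.notMem_support_iff.mp hi).symm
      simp only [hb, add_tsub_cancel_right]
    · intro J hJ
      rw [Finset.mem_powersetCard] at hJ
      simp only [hshape, hstrip, hJ.2, if_true, mul_one]
      split_ifs <;> simp
  · intro p hp
    rw [if_neg (Finset.mem_filter.mp hp).2, mul_zero]

end shape

/-- The monomial with the exponents `λ_1, …, λ_n`. -/
noncomputable def ptnExp (lam : Ptn) (n : ℕ) : Fin n →₀ ℕ :=
  Finsupp.equivFunOnFinite.symm fun i => lam.seq i

lemma shape_ptnExp (lam : Ptn) {n : ℕ} (h : lam.len ≤ n) : shape (ptnExp lam n) = lam.2.parts := by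
  have h1 : (Finset.univ : Finset (Fin n)).val.map (ptnExp lam n) =
      (Finset.range n).val.map lam.seq := by
    have hran : Finset.range n = (Finset.univ : Finset (Fin n)).map Fin.valEmbedding := by
      ext i; simp
    rw [hran, Finset.map_val, Multiset.map_map]
    rfl
  rw [shape, h1, Multiset.filter_map, ← lam.map_seq]
  congr 1
  rw [← Finset.filter_val]
  congr 1
  ext i
  simp only [Function.comp_apply, Finset.mem_filter, Finset.mem_range]
  constructor
  · rintro ⟨-, hi⟩
    by_contra hi'
    exact hi (lam.seq_eq_zero (not_lt.mp hi'))
  · exact fun hi => ⟨hi.trans_le h, (lam.seq_pos hi).ne'⟩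

lemma ptnExp_succ (lam : Ptn) {n : ℕ} (h : lam.len ≤ n) :
    ptnExp lam (n + 1) = (ptnExp lam n).mapDomain Fin.castSucc := by
  ext i
  refine Fin.lastCases ?_ (fun i => ?_) i
  · rw [Finsupp.mapDomain_of_notMem_range]
    · exact lam.seq_eq_zero h
    · rintro ⟨i, hi⟩
      exact (Fin.castSucc_lt_last i).ne hi
  · rw [Finsupp.mapDomain_apply (Fin.castSucc_injective n)]
    rfl

/-- The coefficients of a symmetric function depend only on the shape of the monomial, and not on
the number of variables. -/
lemma coeff_eq_of_shape {k : ℕ} (f : piece k) (lam : Ptn) {n : ℕ} {a : Fin n →₀ ℕ}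
    (h : shape a = lam.2.parts) :
    coeff a (f.1 n) = coeff (ptnExp lam lam.len) (f.1 lam.len) := by
  have hn : lam.len ≤ n := by
    rw [Ptn.len, ← h, shape]
    refine (Multiset.card_le_card (Multiset.filter_le _ _)).trans ?_
    rw [Multiset.card_map]
    exact (Finset.card_fin n).le
  have h1 : coeff a (f.1 n) = coeff (ptnExp lam n) (f.1 n) := by
    obtain ⟨e, he⟩ := exists_equiv_of_map_eq a (ptnExp lam n) (multiset_eq_of_filter_eq
      (h.trans (shape_ptnExp lam hn).symm) (by rw [Multiset.card_map, Multiset.card_map]))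
    have h2 : ptnExp lam n = a.mapDomain e := by
      ext i
      obtain ⟨i, rfl⟩ := e.surjective i
      rw [Finsupp.mapDomain_apply e.injective, he]
    rw [h2]
    conv_rhs => rw [← (f.2 n).1 e]
    rw [coeff_rename_mapDomain _ e.injective]
  rw [h1]
  clear h1 h a
  induction n, hn using Nat.le_induction with
  | base => rfl
  | succ n hn ih =>
    rw [← ih, ptnExp_succ lam hn, ← coeff_killCompl (hf := Fin.castSucc_injective n), (f.2 n).2.2]

/-- The monomial symmetric function `m_μ` as an element of `Λ^k`. -/
noncomputable def monomPiece {k : ℕ} (mu : k.Partition) : piece k :=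
  ⟨fun n => msymm (Fin n) ℤ mu, by
    have h := (monom ⟨k, mu⟩ k).2
    rw [monom, DirectSum.of_eq_same] at h
    exact h⟩

lemma monom_eq (lam : Ptn) :
    monom lam = DirectSum.of (fun k => piece k) lam.1 (monomPiece lam.2) := rfl

lemma coe_sum_monomPiece {k : ℕ} (c : k.Partition → ℤ) (n : ℕ) (a : Fin n →₀ ℕ) :
    coeff a ((∑ mu : k.Partition, c mu • monomPiece mu : piece k).1 n) =
      ∑ mu : k.Partition, if shape a = mu.parts then c mu else 0 := by
  rw [AddSubgroup.val_finsetSum, Finset.sum_apply, coeff_sum]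
  refine Finset.sum_congr rfl fun mu _ => ?_
  have h : coeff a (c mu • msymm (Fin n) ℤ mu) = if shape a = mu.parts then c mu else 0 := by
    rw [coeff_smul, coeff_msymm, smul_eq_mul, mul_ite, mul_one, mul_zero]
  exact h

lemma coeff_sum_monomPiece_of_shape {c : Ptn → ℤ} (lam : Ptn) {n : ℕ} {a : Fin n →₀ ℕ}
    (h : shape a = lam.2.parts) :
    coeff a ((∑ mu : lam.1.Partition, c ⟨lam.1, mu⟩ • monomPiece mu : piece lam.1).1 n) =
      c lam := by
  rw [coe_sum_monomPiece, Finset.sum_eq_single lam.2]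
  · rw [if_pos h]
  · exact fun mu _ hmu => if_neg fun e => hmu (Nat.Partition.ext (by rw [← e, h]))
  · exact fun h => absurd (Finset.mem_univ _) h

lemma coeff_eq_zero_of_sum_shape_ne {k : ℕ} (f : piece k) {n : ℕ} {a : Fin n →₀ ℕ}
    (h : (shape a).sum ≠ k) : coeff a (f.1 n) = 0 := by
  refine (f.2 n).2.1.coeff_eq_zero fun e => h ?_
  rw [← e, shape_eq_map_support]
  rfl

/-- Two elements of `Λ^k` agree if their coefficients at monomials with the shape of a partition
of `k` agree. -/
lemma piece_ext {k : ℕ} {f g : piece k} (h : ∀ (mu : k.Partition) (n : ℕ) (a : Fin n →₀ ℕ),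
    shape a = mu.parts → coeff a (f.1 n) = coeff a (g.1 n)) : f = g := by
  refine Subtype.ext (funext fun n => MvPolynomial.ext _ _ fun a => ?_)
  by_cases ha : (shape a).sum = k
  · subst ha
    refine h (Nat.Partition.ofSums _ (shape a) rfl) n a ?_
    change shape a = (shape a).filter (· ≠ 0)
    rw [shape, Multiset.filter_filter]
    simp
  · rw [coeff_eq_zero_of_sum_shape_ne f ha, coeff_eq_zero_of_sum_shape_ne g ha]

/-- The coefficient of the monomial `x^λ`. -/
noncomputable def coeffAt (lam : Ptn) : SymFun →ₗ[ℤ] ℤ :=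
  AddMonoidHom.toIntLinearMap
    { toFun := fun x => coeff (ptnExp lam lam.len) ((x lam.1).1 lam.len)
      map_zero' := rfl
      map_add' := fun _ _ => rfl }

lemma coeffAt_apply (lam : Ptn) (x : SymFun) :
    coeffAt lam x = coeff (ptnExp lam lam.len) ((x lam.1).1 lam.len) := rfl

lemma coeffAt_monom (lam kap : Ptn) [Decidable (kap = lam)] :
    coeffAt lam (monom kap) = if kap = lam then 1 else 0 := by
  rw [coeffAt_apply, monom_eq]
  by_cases h : kap.1 = lam.1
  · obtain ⟨k, lam⟩ := lam
    obtain ⟨k', kap⟩ := kap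
    obtain rfl : k' = k := h
    rw [DirectSum.of_eq_same]
    change coeff _ (msymm (Fin _) ℤ kap) = _
    rw [coeff_msymm, shape_ptnExp _ le_rfl]
    refine if_congr ?_ rfl rfl
    exact ⟨fun e => Ptn.ext_parts e.symm, fun e => congrArg (fun m : Ptn => m.2.parts) e.symm⟩
  · rw [DirectSum.of_eq_of_ne _ _ _ (Ne.symm h), if_neg fun e => h (by rw [e])]
    rfl

lemma linearIndependent_monom : LinearIndependent ℤ monom := by
  classical
  rw [linearIndependent_iff]
  intro x hx
  ext lam
  have h := congrArg (coeffAt lam) hx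
  rw [Finsupp.linearCombination_apply, Finsupp.sum, map_sum, map_zero] at h
  simp only [map_smul, coeffAt_monom, smul_eq_mul, mul_ite, mul_one, mul_zero,
    Finset.sum_ite_eq'] at h
  by_cases hl : lam ∈ x.support
  · rwa [if_pos hl] at h
  · exact Finsupp.notMem_support_iff.mp hl

lemma span_monom : ⊤ ≤ Submodule.span ℤ (Set.range monom) := by
  rintro x -
  induction x using DirectSum.induction_on with
  | zero => exact zero_mem _
  | add x y hx hy => exact add_mem hx hy
  | of k f =>
    have h : f = ∑ mu : k.Partition, coeff (ptnExp ⟨k, mu⟩ (Ptn.len ⟨k, mu⟩))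
        (f.1 (Ptn.len ⟨k, mu⟩)) • monomPiece mu := by
      refine piece_ext fun mu n a ha => ?_
      rw [coeff_eq_of_shape f ⟨k, mu⟩ ha]
      exact (coeff_sum_monomPiece_of_shape
        (c := fun lam => coeff (ptnExp lam lam.len) (f.1 lam.len)) ⟨k, mu⟩ ha).symm
    rw [h, map_sum]
    refine sum_mem fun mu _ => ?_
    rw [map_zsmul]
    exact Submodule.smul_mem _ _ (Submodule.subset_span ⟨⟨k, mu⟩, rfl⟩)

/-- The basis `(m_λ)` of the ring of symmetric functions. -/
noncomputable def monomBasis : Module.Basis Ptn ℤ SymFun :=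
  Module.Basis.mk linearIndependent_monom span_monom

lemma monomBasis_apply (lam : Ptn) : monomBasis lam = monom lam := by
  rw [monomBasis, Module.Basis.mk_apply]

lemma monom_mul_ones (mu : Ptn) (r : ℕ) : monom mu * monom (onesPtn r) =
    ∑ kap : (mu.1 + r).Partition,
      (pieriPoly mu r ⟨mu.1 + r, kap⟩).eval 1 • monom ⟨mu.1 + r, kap⟩ := by
  have h : (GradedMonoid.GMul.mul (A := fun k => piece k) (monomPiece mu.2)
      (monomPiece (onesPtn r).2) :
      piece (mu.1 + r)) =
      ∑ kap : (mu.1 + r).Partition, (pieriPoly mu r ⟨mu.1 + r, kap⟩).eval 1 • monomPiece kap := by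
    refine piece_ext fun kap n a ha => ?_
    rw [coeff_sum_monomPiece_of_shape (c := fun lam => (pieriPoly mu r lam).eval 1)
      ⟨mu.1 + r, kap⟩ ha, pieriPoly_eval_one]
    refine (coeff_msymm_mul_ones mu.2 r a).trans (congrArg Nat.cast (stripCount_congr ?_ _ _))
    rw [Ptn.map_seq, ← shape_eq_map_support]
    exact ha
  have h' := congrArg (DirectSum.of (fun k => piece k) (mu.1 + r)) h
  rw [map_sum] at h'
  refine (DirectSum.of_mul_of (A := fun k => piece k) (monomPiece mu.2)
    (monomPiece (onesPtn r).2)).trans (h'.trans (Finset.sum_congr rfl fun kap _ => ?_))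
  rw [map_zsmul]
  rfl

theorem isPieriBasis_monomBasis : IsPieriBasis monomBasis 1 where
  one := by
    rw [monomBasis_apply]
    refine congrArg (DirectSum.of (fun k => piece k) 0) (Subtype.ext (funext fun n => ?_))
    refine MvPolynomial.ext _ _ fun a => (coeff_msymm _ a).trans ?_
    change _ = coeff a (1 : MvPolynomial (Fin n) ℤ)
    rw [coeff_one]
    refine if_congr ?_ rfl rfl
    change shape a = 0 ↔ _
    rw [shape_eq_map_support, Multiset.map_eq_zero, Finset.val_eq_zero, Finsupp.support_eq_empty,
      eq_comm]
  repr_mul mu r lam := by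
    have h := repr_sum_partition monomBasis (mu.1 + r) (fun k => (pieriPoly mu r k).eval 1) lam
    simp only [monomBasis_apply] at h ⊢
    rw [monom_mul_ones, h]
    split_ifs with hl
    · rfl
    · rw [pieriPoly_eq_zero hl, Polynomial.eval_zero]

end SymFun

/-! ### Comparison of the Hall algebras with the ring of symmetric functions -/

theorem mainTheorem8 :
    (∀ (R : Type u) [CommRing R] [IsDomain R] [IsDiscreteValuationRing R]
      [Finite (IsLocalRing.ResidueField R)],
      ∃ hcomm : ∀ x y : HallDVR R, x * y = y * x,
        letI : CommRing (HallDVR R) :=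
          { (inferInstance : Ring (HallDVR R)) with mul_comm := hcomm }
        AlgebraicIndependent ℤ (fun r : ℕ+ => uDVR R (onesPtn r)) ∧
        Algebra.adjoin ℤ (Set.range fun r : ℕ+ => uDVR R (onesPtn r)) = ⊤ ∧
        ∃! ψ : HallDVR R ≃ₐ[ℤ] SymFun, ∀ r : ℕ+, ψ (uDVR R (onesPtn r)) =
          SymFun.monom (onesPtn r)) ∧
    ∃ g : Ptn → Ptn → Ptn → ℤ[X],
      (∀ (R : Type u) [CommRing R] [IsDomain R] [IsDiscreteValuationRing R]
        [Finite (IsLocalRing.ResidueField R)],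
        ∃ b : Module.Basis Ptn ℤ (HallDVR R), (∀ lam, b lam = uDVR R lam) ∧
          ∀ mu nu lam, b.repr (uDVR R mu * uDVR R nu) lam =
            (g mu nu lam).eval (Nat.card (IsLocalRing.ResidueField R) : ℤ)) ∧
      (∃ b : Module.Basis Ptn ℤ HallF1, (∀ lam, b lam = uF1 lam) ∧
          ∀ mu nu lam, b.repr (uF1 mu * uF1 nu) lam = (g mu nu lam).eval 1) ∧
      (∃ b : Module.Basis Ptn ℤ SymFun, (∀ lam, b lam = SymFun.monom lam) ∧
          ∀ mu nu lam, b.repr (SymFun.monom mu * SymFun.monom nu) lam = (g mu nu lam).eval 1) := by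
  -- `structPoly` takes the partition of the right factor first.
  refine ⟨fun R _ _ _ _ => ?_, fun mu nu lam => structPoly nu mu lam, fun R _ _ _ _ => ?_, ?_, ?_⟩
  · have h := isPieriBasis_basisDVR (R := R)
    refine ⟨h.mul_comm, ?_⟩
    let : CommRing (HallDVR R) :=
      { (inferInstance : Ring (HallDVR R)) with mul_comm := h.mul_comm }
    have h : IsPieriBasis (basisDVR R) _ := h
    have hu : uDVR R = basisDVR R := funext fun lam => (basisDVR_apply lam).symm
    have hv : SymFun.monom = SymFun.monomBasis :=
      funext fun lam => (SymFun.monomBasis_apply lam).symm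
    rw [hu, hv]
    exact ⟨h.algebraicIndependent, h.adjoin_eq_top,
      h.existsUnique_algEquiv SymFun.isPieriBasis_monomBasis⟩
  · refine ⟨basisDVR R, basisDVR_apply, fun mu nu lam => ?_⟩
    rw [← basisDVR_apply, ← basisDVR_apply]
    exact isPieriBasis_basisDVR.repr_mul_eq_eval_structPoly nu mu lam
  · refine ⟨basisF1, basisF1_apply, fun mu nu lam => ?_⟩
    rw [← basisF1_apply, ← basisF1_apply]
    exact isPieriBasis_basisF1.repr_mul_eq_eval_structPoly nu mu lam
  · refine ⟨SymFun.monomBasis, SymFun.monomBasis_apply, fun mu nu lam => ?_⟩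
    rw [← SymFun.monomBasis_apply, ← SymFun.monomBasis_apply]
    exact SymFun.isPieriBasis_monomBasis.repr_mul_eq_eval_structPoly nu mu lam
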